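/- Let $X$ be a finite, connected, admissible two-dimensional simplicial complex without boundary (every simplex lies in a 2-simplex; any two 2-simplices through a vertex $v$ are joined by a chain of 2-simplices through $v$ in which consecutive ones share an edge; no edge lies in exactly one 2-simplex), with every 2-simplex metrized as a Euclidean equilateral triangle of side $1$. Let $X^0$ be its set of vertices, $X_*=X\setminus X^0$, and let $p:\tilde X\to X$ be the universal cover. "Smooth" on a subset of $X$ or $\tilde X$ means: on each closed 2-simplex, restriction of a smooth function on a neighbourhood in the plane; for 1-forms the restrictions to a common edge must moreover agree. Let $E\to X$ be a smooth complex vector bundle of rank $r$ with a smooth Hermitian metric $h$ and a fixed smooth trivialization $p^*E\cong\tilde X\times\mathbb C^r$. A 1-form $\omega=\{\omega_\sigma\}$ on $\tilde X\setminus p^{-1}(X^0)$ is *balanced* if $\sum_{\sigma>\tau}\omega_\sigma(\nu_\sigma)=0$ along every open edge $\tau$, where $\nu_\sigma$ is the inward unit normal of $\tau$ in the 2-simplex $\sigma$ (for forms of class $L^2_1$, in the sense of traces). Near a vertex use polar coordinates $(\rho,\theta)$ in each 2-simplex and $t=-\log\rho$. For $\delta\in\mathbb R$, a section or form, written in the fixed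 trivialization and in the coordinates $(t,\theta)$, is of class $L^2_{1,\delta}$ if it and its first derivatives are square integrable for $e^{t\delta}\,dt\,d\theta$ near the vertices, and square integrable away from them. Let $\mathcal G^{\mathbb C}_{bal,\delta}(E)$ be the set of sections $g$ of $\operatorname{End}E$ over $X_*$ that are locally of class $L^2_2$ (in particular continuous) and satisfy $\det g=1$, with $dg$ (in the fixed trivialization) balanced and of class $L^2_{1,\delta}$; let $\mathcal G_{bal,\delta}(E)$ be the subset of those $g$ that preserve $h$. Fix $\delta\ge 0$. For $i=1,2$ let $d_{A_i}$ be a unitary connection on $E|_{X_*}$ and $\psi_i$ a 1-form on $X_*$ with values in the $h$-self-adjoint traceless endomorphisms of $E$, such that, in the fixed trivialization, $d_{A_i}=d+A_i$ with $A_i$ traceless, and $A_i,\psi_i$ are smooth on $X_*$, balanced and of class $L^2_{1,\delta}$. Suppose that both pairs satisfy, on $X_*$, $$F_{A_i}+\psi_i\wedge\psi_i=0,\qquad d_{A_i}\psi_i=0,\qquad d_{A_i}^*\psi_i=0 .$$ If the pairs are $\mathcal G^{\mathbb C}_{bal,\delta}(E)$-gauge equivalent, i.e. $d_{A_1}+\psi_1=g^{-1}\circ(d_{A_2}+\psi_2)\circ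 g$ for some $g\in\mathcal G^{\mathbb C}_{bal,\delta}(E)$, then they are $\mathcal G_{bal,\delta}(E)$-gauge equivalent, i.e. there is $u\in\mathcal G_{bal,\delta}(E)$ with $d_{A_1}=u^{-1}\circ d_{A_2}\circ u$ and $\psi_1=u^{-1}\psi_2u$. -/

import Mathlib

open scoped Matrix.Norms.Frobenius ComplexOrder ContDiff Matrix

noncomputable section

namespace HiggsComplex

open MeasureTheory Set

/-! ### Two-dimensional simplicial complexes -/

/-- The geometric realization, in barycentric coordinates. All complexes below are locally finite,
so that the topology induced by the product topology is the usual one. -/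
def realization {V : Type*} (K : AbstractSimplicialComplex V) : Set (V → ℝ) :=
  {x | ∃ s ∈ K.faces, (∀ v, 0 ≤ x v) ∧ (∀ v, v ∉ s → x v = 0) ∧ ∑ v ∈ s, x v = 1}

/-- The 2-cells of `K`, as sets of three vertices. -/
def IsFace2 {V : Type*} (K : AbstractSimplicialComplex V) (s : Finset V) : Prop :=
  s ∈ K.faces ∧ s.card = 3

/-- Admissible complexes of dimension two: connected, dimensionally homogeneous and locally
1-chainable. -/
structure IsAdmissible {V : Type*} (K : AbstractSimplicialComplex V) : Prop where
  connected : IsConnected (realization K)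
  dim_le : ∀ s ∈ K.faces, s.card ≤ 3
  homogeneous : ∀ s ∈ K.faces, ∃ t, IsFace2 K t ∧ s ⊆ t
  chainable : ∀ (v : V) (s t : Finset V), IsFace2 K s → IsFace2 K t → v ∈ s → v ∈ t →
    Relation.ReflTransGen
      (fun a b => IsFace2 K b ∧ v ∈ b ∧ ∃ e, e.card = 2 ∧ e ⊆ a ∧ e ⊆ b) s t

/-- `∂K = ∅`: no 1-cell lies in exactly one 2-cell. -/
def WithoutBoundary {V : Type*} (K : AbstractSimplicialComplex V) : Prop :=
  ∀ e ∈ K.faces, e.card = 2 → ¬ ∃! s, IsFace2 K s ∧ e ⊆ s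

/-- `p : Y → X` is the universal cover of the complex `X`: a simplicial covering map (every simplex
of `X` through `p w` lifts uniquely to a simplex through `w`) whose total space is simply
connected. -/
structure IsUniversalCover {V W : Type*} (Y : AbstractSimplicialComplex W)
    (X : AbstractSimplicialComplex V) (p : W → V) : Prop where
  surjective : Function.Surjective p
  map_face : ∀ t ∈ Y.faces, ∃ s ∈ X.faces, (s : Set V) = p '' (t : Set W)
  lift_face : ∀ (w : W), ∀ s ∈ X.faces, p w ∈ s →
    ∃! t, t ∈ Y.faces ∧ w ∈ t ∧ p '' (t : Set W) = (s : Set V)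
  simplyConnected : SimplyConnectedSpace (realization Y)

/-! ### The model 2-cell

Every closed 2-cell is the equilateral triangle of side one in the Euclidean plane `ℂ`, with
vertices `0`, `1` and `exp (i π / 3)`. -/

/-- Barycentric coordinates with respect to `0`, `1`, `exp (i π / 3)`. -/
def bary : Fin 3 → ℂ → ℝ :=
  ![fun z => 1 - z.re - z.im / √3, fun z => z.re - z.im / √3, fun z => 2 * z.im / √3]

/-- The closed triangle. -/
def tri : Set ℂ := {z | ∀ i, 0 ≤ bary i z}

/-- The open triangle. -/
def triInt : Set ℂ := {z | ∀ i, 0 < bary i z}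

/-- The closed triangle without its three vertices. -/
def triStar : Set ℂ := {z | ∀ i, 0 ≤ bary i z ∧ bary i z < 1}

/-- `σ` is a 2-cell with an ordering of its vertices. -/
def IsTri {W : Type*} (Y : AbstractSimplicialComplex W) (σ : Fin 3 → W) : Prop :=
  Function.Injective σ ∧ ∃ s ∈ Y.faces, (s : Set W) = range σ

open Classical in
/-- The isometric affine parametrization of the 2-cell `σ` by the model triangle that sends
`0`, `1`, `exp (i π / 3)` to `σ 0`, `σ 1`, `σ 2`. -/
def chart {W : Type*} (σ : Fin 3 → W) (z : ℂ) : W → ℝ :=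
  fun w => ∑ i, if σ i = w then bary i z else 0

/-- The linear part of `chart σ`. -/
def chartVec {W : Type*} (σ : Fin 3 → W) (v : ℂ) : W → ℝ := chart σ v - chart σ 0

/-- `f` restricted to `K` extends to a smooth function on a neighbourhood of `K` in the plane. -/
def SmoothUpTo {F : Type*} [NormedAddCommGroup F] [NormedSpace ℝ F] (K : Set ℂ) (f : ℂ → F) :
    Prop :=
  ∃ (U : Set ℂ) (f' : ℂ → F), IsOpen U ∧ K ⊆ U ∧ ContDiffOn ℝ ∞ f' U ∧ EqOn f f' K

/-- `r × r` complex matrices. -/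
abbrev Mat (r : ℕ) := Matrix (Fin r) (Fin r) ℂ

/-- The values of 1-forms on the plane: real-linear maps, with the topology that comes from the norm
of `F` (for matrices, the Frobenius norm). -/
abbrev PlaneHom (F : Type*) [NormedAddCommGroup F] [NormedSpace ℝ F] := ℂ →L[ℝ] F

/-! ### Hermitian bundles with a fixed trivialization over the universal cover -/

/-- A smooth complex vector bundle `E` of rank `r` over `X`, with a fixed trivialization of `p^* E`
over the universal cover `Y` and with a smooth Hermitian metric.

The fibre of `E` over a point of `X` is identified with `ℂ ^ r` once for each lift of the point to
`Y`, and `trans x y` is the transition matrix `g_{xy}` between the lifts `x` and `y` of one point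
(so that `s_x = g_{xy} s_y`). Pairs of lifts of a point are `chart σ z`, `chart τ z` with
`p ∘ σ = p ∘ τ`. The metric at the lift `x` is `⟨s, t⟩ = s^* (metric x) t`. -/
structure HermitianBundle {V W : Type*} (Y : AbstractSimplicialComplex W) (p : W → V) (r : ℕ) where
  trans : (W → ℝ) → (W → ℝ) → Mat r
  metric : (W → ℝ) → Mat r
  trans_self : ∀ σ, IsTri Y σ → ∀ z ∈ tri, trans (chart σ z) (chart σ z) = 1
  trans_mul : ∀ σ τ υ, IsTri Y σ → IsTri Y τ → IsTri Y υ → p ∘ σ = p ∘ τ → p ∘ τ = p ∘ υ →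
    ∀ z ∈ tri, trans (chart σ z) (chart τ z) * trans (chart τ z) (chart υ z) =
      trans (chart σ z) (chart υ z)
  trans_smooth : ∀ σ τ, IsTri Y σ → IsTri Y τ → p ∘ σ = p ∘ τ →
    SmoothUpTo tri (fun z => trans (chart σ z) (chart τ z))
  metric_posDef : ∀ σ, IsTri Y σ → ∀ z ∈ tri, (metric (chart σ z)).PosDef
  metric_smooth : ∀ σ, IsTri Y σ → SmoothUpTo tri (fun z => metric (chart σ z))
  metric_trans : ∀ σ τ, IsTri Y σ → IsTri Y τ → p ∘ σ = p ∘ τ → ∀ z ∈ tri,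
    metric (chart τ z) =
      (trans (chart σ z) (chart τ z))ᴴ * metric (chart σ z) * trans (chart σ z) (chart τ z)

/-! ### Matrix-valued 1-forms on the universal cover -/

/-- A family of matrix-valued 1-forms, one on each 2-cell: `η σ z v` is the value at the point
`chart σ z` on the tangent vector `chartVec σ v`. -/
abbrev FormFamily (W : Type*) (r : ℕ) := (Fin 3 → W) → ℂ → PlaneHom (Mat r)

/-- Smooth 1-forms on `Y` minus its vertices: smooth on each 2-cell up to its open edges, and the
values depend only on the point and the tangent vector. The last condition says that the forms for
different orderings of the vertices of a 2-cell agree, and that the forms on two 2-cells with a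
common edge have the same restriction to this edge. -/
structure IsSmoothForm {W : Type*} {r : ℕ} (Y : AbstractSimplicialComplex W)
    (η : FormFamily W r) : Prop where
  smooth : ∀ σ, IsTri Y σ → SmoothUpTo triStar (η σ)
  compat : ∀ σ τ, IsTri Y σ → IsTri Y τ → ∀ z ∈ triStar, ∀ z' ∈ triStar, ∀ v v' : ℂ,
    chart σ z = chart τ z' → chartVec σ v = chartVec τ v' → η σ z v = η τ z' v'

/-- The balancing condition: along every open edge `ab`, the values on the inward pointing unit
normals, summed over all 2-cells `abc` that contain the edge, add up to zero. In the chart of `abc`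
the edge is the real segment from `0` to `1`, and the inward unit normal is `i`. -/
def IsBalancedForm {W : Type*} {r : ℕ} (Y : AbstractSimplicialComplex W) (η : FormFamily W r) :
    Prop :=
  ∀ (a b : W) (x : ℝ), 0 < x → x < 1 →
    ∑ᶠ c ∈ {c | IsTri Y ![a, b, c]}, η ![a, b, c] (x : ℂ) Complex.I = 0

/-- All values of the form are matrices of trace zero. -/
def IsTracelessForm {W : Type*} {r : ℕ} (Y : AbstractSimplicialComplex W) (η : FormFamily W r) :
    Prop :=
  ∀ σ, IsTri Y σ → ∀ z ∈ triStar, ∀ v, (η σ z v).trace = 0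

section Bundle

variable {V W : Type*} {Y : AbstractSimplicialComplex W} {p : W → V} {r : ℕ}

/-- `d + A` descends to a connection on `E`: `A_β = g_{αβ}⁻¹ d g_{αβ} + g_{αβ}⁻¹ A_α g_{αβ}`. -/
def IsConnectionForm (E : HermitianBundle Y p r) (A : FormFamily W r) : Prop :=
  ∀ σ τ, IsTri Y σ → IsTri Y τ → p ∘ σ = p ∘ τ → ∀ z ∈ triInt, ∀ v,
    A τ z v = (E.trans (chart σ z) (chart τ z))⁻¹ *
        fderiv ℝ (fun z => E.trans (chart σ z) (chart τ z)) z v +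
      (E.trans (chart σ z) (chart τ z))⁻¹ * A σ z v * E.trans (chart σ z) (chart τ z)

/-- `d + A` is compatible with the Hermitian metric: `d h = A^* h + h A`. -/
def IsUnitaryForm (E : HermitianBundle Y p r) (A : FormFamily W r) : Prop :=
  ∀ σ, IsTri Y σ → ∀ z ∈ triInt, ∀ v,
    fderiv ℝ (fun z => E.metric (chart σ z)) z v =
      (A σ z v)ᴴ * E.metric (chart σ z) + E.metric (chart σ z) * A σ z v

/-- `ψ` descends to a 1-form on `X` with values in `End E`. -/
def IsEndForm (E : HermitianBundle Y p r) (ψ : FormFamily W r) : Prop :=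
  ∀ σ τ, IsTri Y σ → IsTri Y τ → p ∘ σ = p ∘ τ → ∀ z ∈ triInt, ∀ v,
    ψ τ z v =
      (E.trans (chart σ z) (chart τ z))⁻¹ * ψ σ z v * E.trans (chart σ z) (chart τ z)

/-- The values of `ψ` are self-adjoint for the Hermitian metric. -/
def IsSelfAdjointForm (E : HermitianBundle Y p r) (ψ : FormFamily W r) : Prop :=
  ∀ σ, IsTri Y σ → ∀ z ∈ triStar, ∀ v,
    (ψ σ z v)ᴴ * E.metric (chart σ z) = E.metric (chart σ z) * ψ σ z v

end Bundle

/-! ### Weighted Sobolev spaces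

Near the vertex `σ 0` of the 2-cell `σ`, with polar coordinates `(ρ, θ)` and `t = - log ρ`, the
coordinate is `w = log z = - t + i θ`. The corners `ρ < 3/4` of the 2-cells (for all the orderings of
their vertices) cover all 2-cells, and each of them stays away from the other two vertices. -/

/-- The corner `ρ < 3/4` in the coordinate `w = - t + i θ`. -/
def strip : Set ℂ := {w | w.re < Real.log (3 / 4) ∧ 0 < w.im ∧ w.im < Real.pi / 3}

/-- The double of `strip` along the edge `θ = 0`, this edge included. -/
def doubleStrip : Set ℂ := {w | w.re < Real.log (3 / 4) ∧ |w.im| < Real.pi / 3}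

/-- The measure `e^{t δ} dt dθ` on the corner. -/
def stripMeasure (δ : ℝ) : Measure ℂ :=
  (volume.restrict strip).withDensity (fun w => ENNReal.ofReal (Real.exp (-w.re * δ)))

section Sobolev

variable {F : Type*} [NormedAddCommGroup F] [NormedSpace ℝ F]

/-- A function in the coordinate `w = log z`. -/
def logFun (f : ℂ → F) : ℂ → F := fun w => f (Complex.exp w)

/-- A 1-form in the coordinate `w = log z` (pull-back by the exponential map). -/
def logForm (η : ℂ → PlaneHom F) : ℂ → PlaneHom F :=
  fun w => (η (Complex.exp w)).comp (ContinuousLinearMap.mul ℝ ℂ (Complex.exp w))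

/-- `f'` is the weak derivative of `f` on `Ω`. -/
def HasWeakDeriv (Ω : Set ℂ) (f : ℂ → F) (f' : ℂ → PlaneHom F) : Prop :=
  LocallyIntegrableOn f Ω ∧ LocallyIntegrableOn f' Ω ∧
    ∀ φ : ℂ → ℝ, ContDiff ℝ ∞ φ → HasCompactSupport φ → tsupport φ ⊆ Ω → ∀ v : ℂ,
      ∫ w, (fderiv ℝ φ w v) • f w = - ∫ w, φ w • f' w v

/-- `f` has weak derivative `f'` on the corner, and its `L²_{1,δ}`-norm is finite there. -/
def HasWeightedDeriv (δ : ℝ) (f : ℂ → F) (f' : ℂ → PlaneHom F) : Prop :=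
  HasWeakDeriv strip f f' ∧ MemLp f 2 (stripMeasure δ) ∧ MemLp f' 2 (stripMeasure δ)

end Sobolev

/-- 1-forms of class `L²_{1,δ}`. -/
def IsWeightedForm {W : Type*} {r : ℕ} (Y : AbstractSimplicialComplex W) (δ : ℝ)
    (η : FormFamily W r) : Prop :=
  ∀ σ, IsTri Y σ → ∃ b', HasWeightedDeriv δ (logForm (η σ)) b'

/-! ### Solutions of the Hitchin equations -/

section Pairs

variable {V W : Type*} {Y : AbstractSimplicialComplex W} {p : W → V} {r : ℕ}

/-- `F_A + ψ ∧ ψ = 0`, `d_A ψ = 0` and `d_A^* ψ = 0` on every open 2-cell, in the Euclidean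
coordinates `x + i y`. -/
structure SolvesHitchin (Y : AbstractSimplicialComplex W) (A ψ : FormFamily W r) : Prop where
  curvature : ∀ σ, IsTri Y σ → ∀ z ∈ triInt,
    (fderiv ℝ (A σ) z 1 Complex.I - fderiv ℝ (A σ) z Complex.I 1 +
        (A σ z 1 * A σ z Complex.I - A σ z Complex.I * A σ z 1)) +
      (ψ σ z 1 * ψ σ z Complex.I - ψ σ z Complex.I * ψ σ z 1) = 0
  closed : ∀ σ, IsTri Y σ → ∀ z ∈ triInt,
    fderiv ℝ (ψ σ) z 1 Complex.I - fderiv ℝ (ψ σ) z Complex.I 1 +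
      (A σ z 1 * ψ σ z Complex.I - ψ σ z Complex.I * A σ z 1) -
      (A σ z Complex.I * ψ σ z 1 - ψ σ z 1 * A σ z Complex.I) = 0
  coclosed : ∀ σ, IsTri Y σ → ∀ z ∈ triInt,
    -(fderiv ℝ (ψ σ) z 1 1 + (A σ z 1 * ψ σ z 1 - ψ σ z 1 * A σ z 1) +
      (fderiv ℝ (ψ σ) z Complex.I Complex.I +
        (A σ z Complex.I * ψ σ z Complex.I - ψ σ z Complex.I * A σ z Complex.I))) = 0

/-- `(d_A, ψ)`, with `d_A = d + A` in the fixed trivialization, is a smooth pair in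
`𝒜_{bal,δ}(E) × Ω¹_{bal,δ}(√-1 ad E)` that solves the Hitchin equations. -/
structure IsHitchinPair (E : HermitianBundle Y p r) (δ : ℝ) (A ψ : FormFamily W r) : Prop where
  smooth_A : IsSmoothForm Y A
  traceless_A : IsTracelessForm Y A
  connection_A : IsConnectionForm E A
  unitary_A : IsUnitaryForm E A
  balanced_A : IsBalancedForm Y A
  weighted_A : IsWeightedForm Y δ A
  smooth_ψ : IsSmoothForm Y ψ
  traceless_ψ : IsTracelessForm Y ψ
  end_ψ : IsEndForm E ψ
  selfAdjoint_ψ : IsSelfAdjointForm E ψ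
  balanced_ψ : IsBalancedForm Y ψ
  weighted_ψ : IsWeightedForm Y δ ψ
  solves : SolvesHitchin Y A ψ

/-! ### Weighted gauge groups -/

/-- The balancing condition for a 1-form `b` of class `L²_1` with weak derivative `b'` (both given in
the coordinate `w = log z` on the corners): the normal traces along the edge `a a'`, defined through
Green's formula `∫ (φ div b + ⟨dφ, b⟩) = - ∫_{θ = 0} φ b(∂_θ) `, add up to zero. -/
def IsWeaklyBalanced (Y : AbstractSimplicialComplex W) (b : FormFamily W r)
    (b' : (Fin 3 → W) → ℂ → PlaneHom (PlaneHom (Mat r))) : Prop :=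
  ∀ (a a' : W) (φ : ℂ → ℝ), ContDiff ℝ ∞ φ → HasCompactSupport φ → tsupport φ ⊆ doubleStrip →
    ∑ᶠ c ∈ {c | IsTri Y ![a, a', c]}, ∫ w in strip,
      (φ w • (b' ![a, a', c] w 1 1 + b' ![a, a', c] w Complex.I Complex.I) +
        (fderiv ℝ φ w 1 • b ![a, a', c] w 1 +
          fderiv ℝ φ w Complex.I • b ![a, a', c] w Complex.I)) = 0

/-- `g ∈ 𝒢^ℂ_{bal,δ}(E)`: a section of `End E` over `X` minus its vertices, of determinant one,
locally of class `L²_2` (hence continuous), whose derivative in the fixed trivialization is of class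
`L²_{1,δ}` and balanced. -/
structure IsComplexGauge (E : HermitianBundle Y p r) (δ : ℝ) (g : (W → ℝ) → Mat r) : Prop where
  continuous : ∀ σ, IsTri Y σ → ContinuousOn (fun z => g (chart σ z)) triStar
  equivariant : ∀ σ τ, IsTri Y σ → IsTri Y τ → p ∘ σ = p ∘ τ → ∀ z ∈ triStar,
    g (chart σ z) * E.trans (chart σ z) (chart τ z) =
      E.trans (chart σ z) (chart τ z) * g (chart τ z)
  det_eq_one : ∀ σ, IsTri Y σ → ∀ z ∈ triStar, (g (chart σ z)).det = 1
  weighted_balanced : ∃ (b : FormFamily W r) (b' : (Fin 3 → W) → ℂ → PlaneHom (PlaneHom (Mat r))),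
    (∀ σ, IsTri Y σ → HasWeakDeriv strip (logFun (fun z => g (chart σ z))) (b σ) ∧
      HasWeightedDeriv δ (b σ) (b' σ)) ∧
    IsWeaklyBalanced Y b b'

/-- `g ∈ 𝒢_{bal,δ}(E)`: moreover, `g` preserves the Hermitian metric. -/
structure IsUnitaryGauge (E : HermitianBundle Y p r) (δ : ℝ) (g : (W → ℝ) → Mat r) : Prop
    extends IsComplexGauge E δ g where
  unitary : ∀ σ, IsTri Y σ → ∀ z ∈ triStar,
    (g (chart σ z))ᴴ * E.metric (chart σ z) * g (chart σ z) = E.metric (chart σ z)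

/-- `d + α₁ = g⁻¹ ∘ (d + α₂) ∘ g`, that is, `α₁ = g⁻¹ dg + g⁻¹ α₂ g` almost everywhere. -/
def ConnectionsRelated (Y : AbstractSimplicialComplex W) (g : (W → ℝ) → Mat r)
    (α₁ α₂ : FormFamily W r) : Prop :=
  ∀ σ, IsTri Y σ → ∃ b, HasWeakDeriv strip (logFun (fun z => g (chart σ z))) b ∧
    ∀ᵐ w ∂(volume.restrict strip), ∀ v,
      logForm (α₁ σ) w v =
        (logFun (fun z => g (chart σ z)) w)⁻¹ * b w v +
          (logFun (fun z => g (chart σ z)) w)⁻¹ * logForm (α₂ σ) w v *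
            logFun (fun z => g (chart σ z)) w

/-- `ψ₁ = g⁻¹ ψ₂ g`. -/
def HiggsFieldsRelated (Y : AbstractSimplicialComplex W) (g : (W → ℝ) → Mat r)
    (ψ₁ ψ₂ : FormFamily W r) : Prop :=
  ∀ σ, IsTri Y σ → ∀ z ∈ triStar, ∀ v,
    ψ₁ σ z v = (g (chart σ z))⁻¹ * ψ₂ σ z v * g (chart σ z)

/-- Equivalence of pairs under `𝒢^ℂ_{bal,δ}(E)`, which acts through the associated
`SL(r, ℂ)`-connections `d_A + ψ` (the pair is recovered from `d_A + ψ` as its skew-adjoint and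
self-adjoint parts): `d_{A₁} + ψ₁ = g⁻¹ ∘ (d_{A₂} + ψ₂) ∘ g`. -/
def ComplexGaugeEquivalent (E : HermitianBundle Y p r) (δ : ℝ)
    (A₁ ψ₁ A₂ ψ₂ : FormFamily W r) : Prop :=
  ∃ g, IsComplexGauge E δ g ∧ ConnectionsRelated Y g (A₁ + ψ₁) (A₂ + ψ₂)

/-- Equivalence of pairs under `𝒢_{bal,δ}(E)`: `d_{A₁} = g⁻¹ ∘ d_{A₂} ∘ g` and `ψ₁ = g⁻¹ ψ₂ g`. -/
def UnitaryGaugeEquivalent (E : HermitianBundle Y p r) (δ : ℝ)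
    (A₁ ψ₁ A₂ ψ₂ : FormFamily W r) : Prop :=
  ∃ g, IsUnitaryGauge E δ g ∧ ConnectionsRelated Y g A₁ A₂ ∧ HiggsFieldsRelated Y g ψ₁ ψ₂

end Pairs

end HiggsComplex

end

/-! Write `g^*` for the adjoint of `g` with respect to the metric. The gauge relation reads dg =
g(A₁ + ψ₁) − (A₂ + ψ₂)g. Both connections are unitary for the same metric, so f = |g|² = Re tr(g^*
g) satisfies df = 2⟨g, gψ₁ − ψ₂g⟩, and λ = f⁻¹⟨g, gψ₁ − ψ₂g⟩ (`lamForm`) is half the differential of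
log f. Because ψ₁ and ψ₂ are coclosed, one more derivative gives div λ = (2/f) ∑ |gψ₁(v) − ψ₂(v)g −
λ(v)g|², summed over v = 1, i (`ChartData.exists_div_lamForm`). Thus log f is subharmonic on every
2-cell.

Globally this subharmonicity is rigid, by an integration by parts over the finitely many 2-cells of
X (`div_eq_zero_of_balanced`). The form λ does not depend on the lift to the universal cover. It is
balanced along the edges, since g is continuous across them and the Higgs fields are balanced, so
the edge terms in Green's formula cancel. Near the vertices, Cauchy–Schwarz bounds |λ| by a multiple
of |ψ₁| + |ψ₂| with no bound on g; this is the reason for taking the logarithm. For δ ≥ 0 the Higgs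
fields are square integrable on the cylindrical ends, hence on the triangles, because the L² norm of
a 1-form in dimension two is conformally invariant. Cutoffs at scale ε around a vertex have
Dirichlet energy bounded independently of ε, so the vertex contributions vanish as ε → 0 and div λ =
0.

Therefore gψ₁ − ψ₂g = λg. Multiplying by g⁻¹ and taking traces kills λ, because the Higgs fields are
traceless. So g intertwines the Higgs fields (`intertwines_higgs`) and satisfies dg = gA₁ − A₂g.

The unitary gauge transformation is the polar factor u = g(g^*g)^(-1/2). The section g^*g is
parallel for A₁ and commutes with ψ₁. Its minimal polynomial is constant on a 2-cell, so the inverse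
square root is one fixed real polynomial in g^*g, and parallelism, commutation and equivariance pass
to it algebraically. Being unitary, u is bounded, and du = uA₁ − A₂u. The embedding of L²_{1,δ} into
L⁴_δ controls the quadratic terms in the derivative of du, and du is balanced because A₁ and A₂ are.
-/

noncomputable section

namespace HiggsComplex

open MeasureTheory Set Filter Topology Metric
open scoped Convolution

/-! ### Weak derivatives and regularity by mollification -/

section WeakDerivatives

variable {F : Type*} [NormedAddCommGroup F] [NormedSpace ℝ F] {Ω : Set ℂ} {f : ℂ → F}
  {f' : ℂ → PlaneHom F}

/-- A function with compact support inside `Ω` times a function continuous on `Ω` is integrable. -/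
theorem integrable_smul_of_tsupport_subset {φ : ℂ → ℝ} (hΩ : IsOpen Ω) (hφ : Continuous φ)
    (hc : HasCompactSupport φ) (hs : tsupport φ ⊆ Ω) (hf : ContinuousOn f Ω) :
    Integrable (fun w => φ w • f w) := by
  refine Continuous.integrable_of_hasCompactSupport ?_ hc.smul_right
  rw [continuous_iff_continuousAt]
  intro w
  by_cases hw : w ∈ tsupport φ
  · exact hφ.continuousAt.smul (hf.continuousAt (hΩ.mem_nhds (hs hw)))
  · have : (fun w => φ w • f w) =ᶠ[𝓝 w] fun _ => 0 := by
      filter_upwards [(isClosed_tsupport φ).isOpen_compl.mem_nhds hw] with y hy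
      rw [image_eq_zero_of_notMem_tsupport hy, zero_smul]
    exact continuousAt_const.congr this.symm

/-- A classical derivative is a weak derivative. -/
theorem hasWeakDeriv_of_hasFDerivAt (hΩ : IsOpen Ω) (hf : ∀ w ∈ Ω, HasFDerivAt f (f' w) w)
    (hf' : ContinuousOn f' Ω) : HasWeakDeriv Ω f f' := by
  have hfc : ContinuousOn f Ω := fun w hw => (hf w hw).continuousAt.continuousWithinAt
  refine ⟨hfc.locallyIntegrableOn hΩ.measurableSet, hf'.locallyIntegrableOn hΩ.measurableSet, ?_⟩
  intro φ hφ hc hs v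
  have hd : Differentiable ℝ φ := hφ.differentiable (by simp)
  have hcv : ContinuousOn (fun w => f' w v) Ω := hf'.clm_apply continuousOn_const
  have hdc : Continuous fun w => fderiv ℝ φ w v :=
    (hφ.continuous_fderiv (by simp)).clm_apply continuous_const
  have hsub : tsupport (fun w => fderiv ℝ φ w v) ⊆ tsupport φ :=
    tsupport_fderiv_apply_subset ℝ v
  have i1 := integrable_smul_of_tsupport_subset hΩ hdc
    (HasCompactSupport.fderiv_apply ℝ hc v) (hsub.trans hs) hfc
  have i2 := integrable_smul_of_tsupport_subset hΩ hφ.continuous hc hs hcv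
  have i3 := integrable_smul_of_tsupport_subset hΩ hφ.continuous hc hs hfc
  have key := integral_bilinear_hasFDerivAt_right_eq_neg_left_of_integrable (μ := volume)
    (B := ContinuousLinearMap.lsmul ℝ ℝ (E := F)) (f := φ) (f' := fderiv ℝ φ) (g := f) (g' := f')
    (v := v)
    i1 i2 i3
    (fun x _ => (hd x).hasFDerivAt) (fun x hx => hf x (hs hx))
  simp only [ContinuousLinearMap.lsmul_apply] at key
  rw [key, neg_neg]

theorem planeHom_ext {a b : PlaneHom F} (h1 : a 1 = b 1) (hI : a Complex.I = b Complex.I) :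
    a = b := by
  ext v
  have hv : v = v.re • (1 : ℂ) + v.im • Complex.I := by
    simp [Complex.re_add_im]
  rw [hv, map_add, map_smul, map_smul, map_add, map_smul, map_smul, h1, hI]

/-- Weak derivatives are unique almost everywhere. -/
theorem HasWeakDeriv.ae_eq [CompleteSpace F] {f'' : ℂ → PlaneHom F} (hΩ : IsOpen Ω)
    (h : HasWeakDeriv Ω f f') (h' : HasWeakDeriv Ω f f'') :
    ∀ᵐ w ∂(volume.restrict Ω), f' w = f'' w := by
  have key : ∀ v : ℂ, ∀ᵐ w, w ∈ Ω → f' w v - f'' w v = 0 := by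
    intro v
    have hli : ∀ k : ℂ → PlaneHom F, LocallyIntegrableOn k Ω →
        LocallyIntegrableOn (fun w => k w v) Ω := fun k hk w hw => by
      obtain ⟨s, hs, hi⟩ := hk w hw
      exact ⟨s, hs, (ContinuousLinearMap.apply ℝ F v).integrable_comp hi⟩
    refine hΩ.ae_eq_zero_of_integral_contDiff_smul_eq_zero
      ((hli _ h.2.1).sub (hli _ h'.2.1)) ?_
    intro φ hφ hc hs
    have hint : ∀ k : ℂ → PlaneHom F, LocallyIntegrableOn k Ω →
        Integrable (fun w => φ w • k w v) := by
      intro k hk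
      have h1 : IntegrableOn (fun w => φ w • k w v) (tsupport φ) :=
        (((hli k hk).mono_set hs).integrableOn_isCompact hc).continuousOn_smul hφ.continuous.continuousOn hc
      exact (integrableOn_iff_integrable_of_support_subset
        ((Function.support_smul_subset_left _ _).trans (subset_tsupport φ))).1 h1
    simp only [smul_sub]
    rw [integral_sub (hint _ h.2.1) (hint _ h'.2.1), sub_eq_zero]
    have a := h.2.2 φ hφ hc hs v
    rw [h'.2.2 φ hφ hc hs v] at a
    exact (neg_injective a).symm
  rw [ae_restrict_iff' hΩ.measurableSet]
  filter_upwards [key 1, key Complex.I] with w h1 hI hw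
  exact planeHom_ext (sub_eq_zero.1 (h1 hw)) (sub_eq_zero.1 (hI hw))

theorem HasWeakDeriv.congr_ae {f'' : ℂ → PlaneHom F} (hΩ : IsOpen Ω)
    (h : HasWeakDeriv Ω f f') (he : ∀ᵐ w ∂(volume.restrict Ω), f' w = f'' w)
    (hi : LocallyIntegrableOn f'' Ω) : HasWeakDeriv Ω f f'' := by
  refine ⟨h.1, hi, fun φ hφ hc hs v => ?_⟩
  rw [h.2.2 φ hφ hc hs v]
  congr 1
  refine integral_congr_ae ?_
  rw [ae_restrict_iff' hΩ.measurableSet] at he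
  filter_upwards [he] with w hw
  by_cases hm : w ∈ Ω
  · rw [hw hm]
  · rw [image_eq_zero_of_notMem_tsupport fun h => hm (hs h), zero_smul, zero_smul]

/-- The derivative of a mollification is the mollification of the weak derivative. -/
theorem HasWeakDeriv.hasFDerivAt_convolution [CompleteSpace F] (h : HasWeakDeriv Ω f f')
    {K : Set ℂ} (hKΩ : K ⊆ Ω) (hfe : Integrable (K.indicator f)) (hfe' : Integrable (K.indicator f'))
    (φ : ContDiffBump (0 : ℂ)) {w : ℂ} (hθK : closedBall w φ.rOut ⊆ K) :
    HasFDerivAt (φ.normed volume ⋆[ContinuousLinearMap.lsmul ℝ ℝ] (K.indicator f))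
      ((φ.normed volume ⋆[ContinuousLinearMap.lsmul ℝ ℝ] (K.indicator f')) w) w := by
  obtain ⟨fe, hfe_def⟩ : ∃ k, k = K.indicator f := ⟨_, rfl⟩
  obtain ⟨fe', hfe'_def⟩ : ∃ k, k = K.indicator f' := ⟨_, rfl⟩
  rw [← hfe_def] at hfe ⊢
  rw [← hfe'_def] at hfe' ⊢
  have hder := HasCompactSupport.hasFDerivAt_convolution_left (𝕜 := ℝ) (μ := volume)
    (ContinuousLinearMap.lsmul ℝ ℝ) (φ.hasCompactSupport_normed (μ := volume))
    (φ.contDiff_normed (n := 1)) hfe.locallyIntegrable w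
  refine hder.congr_fderiv ?_
  have hcs : HasCompactSupport (φ.normed (volume : Measure ℂ)) := φ.hasCompactSupport_normed
  have hcs' : HasCompactSupport (fderiv ℝ (φ.normed (volume : Measure ℂ))) := hcs.fderiv ℝ
  have hcd : ContDiff ℝ 1 (φ.normed (volume : Measure ℂ)) := φ.contDiff_normed
  have hcf : Continuous (fderiv ℝ (φ.normed (volume : Measure ℂ))) :=
    hcd.continuous_fderiv one_ne_zero
  obtain ⟨C, hC⟩ := hcf.bounded_above_of_compact_support hcs'
  have hex1 : Integrable (fun y => ((ContinuousLinearMap.lsmul ℝ ℝ : ℝ →L[ℝ] F →L[ℝ] F).precompL ℂ)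
      (fderiv ℝ (φ.normed volume) (w - y)) (fe y)) :=
    ContinuousLinearMap.integrable_of_bilin_of_bdd_left _ C
      (hcf.comp (continuous_const.sub continuous_id)).aestronglyMeasurable
      (Eventually.of_forall fun y => hC (w - y)) hfe
  have hex2 : ConvolutionExistsAt (φ.normed volume) fe' w
      (ContinuousLinearMap.lsmul ℝ ℝ) volume :=
    hcs.convolutionExists_left (ContinuousLinearMap.lsmul ℝ ℝ) hcd.continuous
      hfe'.locallyIntegrable w
  -- The reflected bump around `w` is an admissible test function, since its support lies in a
  -- closed ball inside `K`. Testing against it moves the derivative from the bump to `f`, and the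
  -- truncation to `K` is not seen.
  obtain ⟨θ, hθ⟩ : ∃ θ : ℂ → ℝ, θ = fun y => φ.normed volume (w - y) := ⟨_, rfl⟩
  have hθd : ContDiff ℝ ∞ θ := hθ ▸ φ.contDiff_normed.comp (contDiff_const.sub contDiff_id)
  have hθsupp : tsupport θ ⊆ closedBall w φ.rOut := by
    refine closure_minimal ?_ isClosed_closedBall
    intro y hy
    have : w - y ∈ Function.support (φ.normed volume) := by rw [hθ] at hy; exact hy
    rw [φ.support_normed_eq, mem_ball_zero_iff] at this
    rw [mem_closedBall, dist_comm, dist_eq_norm]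
    exact this.le
  have hθfd : ∀ y v, fderiv ℝ θ y v = - fderiv ℝ (φ.normed volume) (w - y) v := by
    intro y v
    have h1 : HasFDerivAt (φ.normed volume) (fderiv ℝ (φ.normed volume) (w - y)) (w - y) :=
      ((φ.contDiff_normed (n := 1)).differentiable one_ne_zero _).hasFDerivAt
    have h2 : HasFDerivAt (fun y : ℂ => w - y) (-ContinuousLinearMap.id ℝ ℂ) y :=
      (hasFDerivAt_id y).const_sub w
    have := (h1.comp y h2).fderiv
    rw [hθ]; erw [this]; simp
  refine ContinuousLinearMap.ext fun v => ?_
  have hw' := h.2.2 θ hθd (HasCompactSupport.of_support_subset_isCompact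
    (isCompact_closedBall w φ.rOut) ((subset_tsupport θ).trans hθsupp))
    (hθsupp.trans (hθK.trans hKΩ)) v
  have e1 : (∫ y, (((ContinuousLinearMap.lsmul ℝ ℝ).precompL ℂ)
      (fderiv ℝ (φ.normed volume) (w - y)) (fe y)) v) = - ∫ y, fderiv ℝ θ y v • f y := by
    rw [← integral_neg]
    refine integral_congr_ae (Eventually.of_forall fun y => ?_)
    change fderiv ℝ (φ.normed volume) (w - y) v • fe y = - (fderiv ℝ θ y v • f y)
    by_cases hy : y ∈ K
    · rw [hθfd y, neg_smul, neg_neg, hfe_def, indicator_of_mem hy]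
    · have h1 : fderiv ℝ θ y = 0 :=
        image_eq_zero_of_notMem_tsupport fun hh => hy (hθK (hθsupp (tsupport_fderiv_subset ℝ hh)))
      have h0 : fderiv ℝ (φ.normed volume) (w - y) v = 0 := by
        have := hθfd y v
        rw [h1] at this
        simpa using this.symm
      rw [h0, h1]; simp
  have e2 : (∫ y, ((ContinuousLinearMap.lsmul ℝ ℝ) (φ.normed volume (w - y)) (fe' y)) v) =
      ∫ y, θ y • f' y v := by
    refine integral_congr_ae (Eventually.of_forall fun y => ?_)
    change φ.normed volume (w - y) • fe' y v = θ y • f' y v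
    rw [show φ.normed volume (w - y) = θ y by rw [hθ]]
    by_cases hy : y ∈ K
    · rw [hfe'_def, indicator_of_mem hy]
    · have : θ y = 0 := image_eq_zero_of_notMem_tsupport fun hh => hy (hθK (hθsupp hh))
      rw [this, zero_smul, zero_smul]
  rw [convolution_eq_swap, convolution_eq_swap,
    ContinuousLinearMap.integral_apply hex1,
    ContinuousLinearMap.integral_apply hex2.integrable_swap, e1, e2, hw', neg_neg]

/-- Mollifications of a function continuous on a closed ball converge uniformly on smaller balls. -/
theorem tendstoUniformlyOn_convolution [CompleteSpace F] {ε : ℝ} {w₀ : ℂ}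
    (φ : ℕ → ContDiffBump (0 : ℂ)) (hr0 : Tendsto (fun n => (φ n).rOut) atTop (𝓝 0))
    (hr : ∀ n, (φ n).rOut ≤ ε / 2) (hf : ContinuousOn f (closedBall w₀ ε)) :
    TendstoUniformlyOn (fun n w => ((φ n).normed volume ⋆[ContinuousLinearMap.lsmul ℝ ℝ]
      ((closedBall w₀ ε).indicator f)) w) f atTop (ball w₀ (ε / 2)) := by
  have hK := isCompact_closedBall w₀ ε
  have hki := (hf.integrableOn_compact (μ := volume) hK).integrable_indicator hK.measurableSet
  rw [Metric.tendstoUniformlyOn_iff]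
  intro η hη
  obtain ⟨d, hd, hkd⟩ :=
    Metric.uniformContinuousOn_iff.1 (hK.uniformContinuousOn_of_continuous hf) (η / 2)
      (by positivity)
  filter_upwards [hr0.eventually (gt_mem_nhds hd)] with n hn w hw
  have hin : ∀ y ∈ ball w (φ n).rOut, y ∈ closedBall w₀ ε := by
    intro y hy
    rw [mem_ball] at hw hy
    rw [mem_closedBall]
    linarith [dist_triangle y w w₀, hr n]
  have hwK := hin w (mem_ball_self (φ n).rOut_pos)
  have := ContDiffBump.dist_normed_convolution_le (φ := φ n) (x₀ := w) (ε := η / 2)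
    (g := (closedBall w₀ ε).indicator f) (μ := volume) hki.aestronglyMeasurable (by
      intro y hy
      rw [indicator_of_mem (hin y hy), indicator_of_mem hwK]
      exact (hkd y (hin y hy) w hwK ((mem_ball.1 hy).trans hn)).le)
  rw [indicator_of_mem hwK] at this
  rw [dist_comm]
  linarith

/-- A continuous function with a continuous weak derivative is continuously differentiable. -/
theorem HasWeakDeriv.hasFDerivAt [CompleteSpace F] (hΩ : IsOpen Ω)
    (h : HasWeakDeriv Ω f f') (hf : ContinuousOn f Ω) (hf' : ContinuousOn f' Ω) {w₀ : ℂ}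
    (hw₀ : w₀ ∈ Ω) : HasFDerivAt f (f' w₀) w₀ := by
  obtain ⟨ε, hε, hball⟩ := nhds_basis_closedBall.mem_iff.1 (hΩ.mem_nhds hw₀)
  have hK := isCompact_closedBall w₀ ε
  have hfe := ((hf.mono hball).integrableOn_compact (μ := volume) hK).integrable_indicator
    hK.measurableSet
  have hfe' := ((hf'.mono hball).integrableOn_compact (μ := volume) hK).integrable_indicator
    hK.measurableSet
  -- Outer radius at most `ε / 2`: averaging at a point of the half ball uses only values in the
  -- closed ball of radius `ε`.
  let φ : ℕ → ContDiffBump (0 : ℂ) := fun n =>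
    ⟨ε / 4 / (n + 1), ε / 2 / (n + 1), by positivity, by
      apply div_lt_div_of_pos_right _ (by positivity); linarith⟩
  have hr : ∀ n, (φ n).rOut ≤ ε / 2 := fun n => by
    change ε / 2 / (n + 1) ≤ ε / 2
    apply div_le_self (by positivity); linarith [n.cast_nonneg (α := ℝ)]
  have hr0 : Tendsto (fun n => (φ n).rOut) atTop (𝓝 0) := by
    change Tendsto (fun n : ℕ => ε / 2 / ((n : ℝ) + 1)) atTop (𝓝 0)
    exact tendsto_const_nhds.div_atTop
      (tendsto_natCast_atTop_atTop.atTop_add tendsto_const_nhds)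
  -- The mollifications converge to `f` and their derivatives converge uniformly to `f'`, so the
  -- limit is differentiable with derivative `f'`.
  refine hasFDerivAt_of_tendstoUniformlyOn (l := atTop) (s := ball w₀ (ε / 2)) isOpen_ball
    (tendstoUniformlyOn_convolution φ hr0 hr (hf'.mono hball)) (fun n w hw => ?_)
    (fun w hw => (tendstoUniformlyOn_convolution φ hr0 hr (hf.mono hball)).tendsto_at hw)
    (mem_ball_self (by positivity))
  refine h.hasFDerivAt_convolution hball hfe hfe' (φ n) fun y hy => ?_
  rw [mem_closedBall] at hy ⊢
  have := mem_ball.1 hw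
  linarith [dist_triangle y w w₀, hr n]

end WeakDerivatives

end HiggsComplex

namespace HiggsComplex

open MeasureTheory Set Filter Topology Metric

/-! ### Geometry of the equilateral triangle and its rotation -/

section Triangle

/-- The primitive third root of unity in the upper half plane. -/
def zeta : ℂ := ⟨-1 / 2, √3 / 2⟩

/-- The rotation of the model triangle that permutes its vertices cyclically. -/
def rot (z : ℂ) : ℂ := 1 + zeta * z

theorem sq_sqrt_three : √3 * √3 = 3 := Real.mul_self_sqrt (by norm_num)

theorem sqrt_three_pos : 0 < √3 := Real.sqrt_pos.2 (by norm_num)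

/-- Moves `√3` into numerators, so that identities between barycentric coordinates become polynomial
identities modulo `sq_sqrt_three`. -/
theorem div_sqrt_three (x : ℝ) : x / √3 = x * √3 / 3 := by
  rw [div_eq_div_iff sqrt_three_pos.ne' (by norm_num)]
  linear_combination (-x) * sq_sqrt_three

theorem bary_zero (z : ℂ) : bary 0 z = 1 - z.re - z.im * √3 / 3 := by
  rw [← div_sqrt_three]; rfl

theorem bary_one (z : ℂ) : bary 1 z = z.re - z.im * √3 / 3 := by
  rw [← div_sqrt_three]; rfl

theorem bary_two (z : ℂ) : bary 2 z = 2 * z.im * √3 / 3 := by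
  rw [← div_sqrt_three]; rfl

theorem bary_sum (z : ℂ) : bary 0 z + bary 1 z + bary 2 z = 1 := by
  rw [bary_zero, bary_one, bary_two]; ring

theorem rot_re (z : ℂ) : (rot z).re = 1 - z.re / 2 - √3 / 2 * z.im := by
  simp [rot, zeta]; ring

theorem rot_im (z : ℂ) : (rot z).im = √3 / 2 * z.re - z.im / 2 := by
  simp [rot, zeta]; ring

/-- The rotation sends 0 to 1, 1 to exp(iπ/3) and exp(iπ/3) to 0. It reduces questions about any
corner or side to the corner at 0 and the side from 0 to 1. -/
theorem bary_rot (i : Fin 3) (z : ℂ) : bary (i + 1) (rot z) = bary i z := by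
  have h := sq_sqrt_three
  fin_cases i
  · change bary 1 (rot z) = bary 0 z
    rw [bary_zero, bary_one, rot_re, rot_im]; linear_combination (-z.re / 6) * h
  · change bary 2 (rot z) = bary 1 z
    rw [bary_two, bary_one, rot_im]; linear_combination (z.re / 3) * h
  · change bary 0 (rot z) = bary 2 z
    rw [bary_zero, bary_two, rot_re, rot_im]; linear_combination (-z.re / 6) * h

theorem zeta_cube : zeta * zeta * zeta = 1 := by
  have h := sq_sqrt_three
  apply Complex.ext
  · simp [zeta]; linear_combination (3 / 8) * h
  · simp [zeta]; linear_combination (-√3 / 8) * h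

theorem zeta_sum : 1 + zeta + zeta * zeta = 0 := by
  have h := sq_sqrt_three
  apply Complex.ext
  · simp [zeta]; linear_combination (-1 / 4) * h
  · simp [zeta]; ring

theorem rot_rot_rot (z : ℂ) : rot (rot (rot z)) = z := by
  simp only [rot]
  linear_combination zeta_sum + z * zeta_cube

theorem norm_zeta : ‖zeta‖ = 1 := by
  have h : ‖zeta‖ * ‖zeta‖ = 1 := by
    rw [← sq, Complex.sq_norm, Complex.normSq_apply, zeta]
    linear_combination (1 / 4) * sq_sqrt_three
  nlinarith [norm_nonneg zeta]

theorem continuous_rot : Continuous rot := by unfold rot; fun_prop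

theorem rot_sub (z z' : ℂ) : rot z - rot z' = zeta * (z - z') := by simp only [rot]; ring

theorem hasFDerivAt_rot (z : ℂ) :
    HasFDerivAt rot (ContinuousLinearMap.mul ℝ ℂ zeta) z := by
  have := (ContinuousLinearMap.mul ℝ ℂ zeta).hasFDerivAt (x := z)
  exact this.const_add 1

theorem measurePreserving_rot : MeasurePreserving rot volume volume := by
  have h1 : MeasurePreserving (rotation ⟨zeta, by simp [Submonoid.unitSphere, norm_zeta]⟩) :=
    LinearIsometryEquiv.measurePreserving _
  exact (measurePreserving_add_left volume (1 : ℂ)).comp h1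

theorem measurableEmbedding_rot : MeasurableEmbedding rot :=
  continuous_rot.measurableEmbedding fun a b h => by
    rw [← rot_rot_rot a, ← rot_rot_rot b, h]

theorem bary_rot_forall {P : ℝ → Prop} (z : ℂ) :
    (∀ i, P (bary i (rot z))) ↔ ∀ i, P (bary i z) := by
  constructor
  · intro h i
    rw [← bary_rot]; exact h _
  · intro h i
    have := bary_rot (i - 1) z
    rw [sub_add_cancel] at this
    rw [this]; exact h _

theorem rot_mem_tri {z : ℂ} : rot z ∈ tri ↔ z ∈ tri := bary_rot_forall (P := fun x => 0 ≤ x) z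

theorem rot_mem_triInt {z : ℂ} : rot z ∈ triInt ↔ z ∈ triInt :=
  bary_rot_forall (P := fun x => 0 < x) z

theorem rot_mem_triStar {z : ℂ} : rot z ∈ triStar ↔ z ∈ triStar :=
  bary_rot_forall (P := fun x => 0 ≤ x ∧ x < 1) z

theorem continuous_bary (i : Fin 3) : Continuous (bary i) := by
  fin_cases i
  · change Continuous (bary 0); rw [funext bary_zero]; fun_prop
  · change Continuous (bary 1); rw [funext bary_one]; fun_prop
  · change Continuous (bary 2); rw [funext bary_two]; fun_prop

theorem isOpen_triInt : IsOpen triInt := by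
  simp only [triInt, ofPred_forall]
  exact isOpen_iInter_of_finite fun i => isOpen_lt continuous_const (continuous_bary i)

theorem isClosed_tri : IsClosed tri := by
  simp only [tri, ofPred_forall]
  exact isClosed_iInter fun i => isClosed_le continuous_const (continuous_bary i)

theorem triInt_subset_triStar : triInt ⊆ triStar := by
  intro z hz
  have h0 := hz 0
  have h1 := hz 1
  have h2 := hz 2
  have hs := bary_sum z
  intro i
  refine ⟨(hz i).le, ?_⟩
  fin_cases i
  · change bary 0 z < 1; linarith
  · change bary 1 z < 1; linarith
  · change bary 2 z < 1; linarith

theorem triStar_subset_tri : triStar ⊆ tri := fun _ hz i => (hz i).1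

theorem triInt_subset_tri : triInt ⊆ tri := fun _ hz i => (hz i).le

theorem norm_sq_eq_bary (z : ℂ) :
    ‖z‖ ^ 2 = bary 1 z ^ 2 + bary 1 z * bary 2 z + bary 2 z ^ 2 := by
  rw [Complex.sq_norm, Complex.normSq_apply, bary_one, bary_two]
  linear_combination (-z.im ^ 2 / 3) * sq_sqrt_three

/-- If s, t ≥ 0 are the other two coordinates, then |z|² = s² + st + t² ≤ (s + t)². -/
theorem norm_le_of_bary_zero {z : ℂ} (hz : z ∈ tri) : ‖z‖ ≤ 1 - bary 0 z := by
  have h1 := hz 1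
  have h2 := hz 2
  have hs := bary_sum z
  have := norm_sq_eq_bary z
  refine abs_le_of_sq_le_sq' (a := ‖z‖) (b := 1 - bary 0 z) ?_ (by linarith) |>.2
  rw [this, show 1 - bary 0 z = bary 1 z + bary 2 z by linarith]
  nlinarith [mul_nonneg h1 h2]

theorem isCompact_tri : IsCompact tri := by
  refine Metric.isCompact_of_isClosed_isBounded isClosed_tri ?_
  refine (Metric.isBounded_closedBall (x := (0 : ℂ)) (r := 1)).subset fun z hz => ?_
  rw [mem_closedBall_zero_iff]
  linarith [norm_le_of_bary_zero hz, hz 0]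

/-- To prove a statement on the open triangle, it suffices to prove it in the corners. -/
theorem triInt_induction {ι : Type*} {s : ι → ι} {P : ι → ℂ → Prop}
    (hP : ∀ i, ∀ z ∈ triInt, ‖z‖ < 3 / 4 → P i z)
    (hrot : ∀ i, ∀ z ∈ triInt, P (s i) z → P i (rot z)) (i : ι) {z : ℂ} (hz : z ∈ triInt) :
    P i z := by
  have hz1 : rot z ∈ triInt := rot_mem_triInt.2 hz
  have hz2 : rot (rot z) ∈ triInt := rot_mem_triInt.2 hz1
  have b1 : bary 0 (rot z) = bary 2 z := bary_rot 2 z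
  have b2 : bary 0 (rot (rot z)) = bary 1 z := by
    rw [← bary_rot 1 z]; exact bary_rot 2 (rot z)
  have n0 := norm_le_of_bary_zero (triInt_subset_tri hz)
  have n1 := norm_le_of_bary_zero (triInt_subset_tri hz1)
  have n2 := norm_le_of_bary_zero (triInt_subset_tri hz2)
  have hs := bary_sum z
  -- One of the three barycentric coordinates is at least 1/3, so the corresponding vertex is at
  -- distance at most 2/3 < 3/4.
  rcases le_or_gt (1 / 3) (bary 0 z) with h | h
  · exact hP i z hz (by linarith)
  rcases le_or_gt (1 / 3) (bary 1 z) with h' | h'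
  · rw [← rot_rot_rot z]
    exact hrot i _ hz2 (hP _ _ hz2 (by linarith))
  · rw [← rot_rot_rot z]
    exact hrot i _ hz2 (hrot _ _ hz1 (hP _ _ hz1 (by linarith)))

end Triangle

/-! ### The corner at 0 in logarithmic coordinates -/

section Strip

theorem isOpen_strip : IsOpen strip :=
  (isOpen_lt Complex.continuous_re continuous_const).inter
    ((isOpen_lt continuous_const Complex.continuous_im).inter
      (isOpen_lt Complex.continuous_im continuous_const))

/-- The corner with the edge `θ = 0` included. -/
def edgeStrip : Set ℂ := {w | w.re < Real.log (3 / 4) ∧ 0 ≤ w.im ∧ w.im < Real.pi / 3}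

theorem strip_subset_edgeStrip : strip ⊆ edgeStrip := fun _ h => ⟨h.1, h.2.1.le, h.2.2⟩

/-- This coordinate is the distance ρ sin(π/3 − θ) to the side θ = π/3, divided by the height √3/2.
-/
theorem bary_one_exp (w : ℂ) :
    bary 1 (Complex.exp w) = Real.exp w.re * (2 * √3 / 3) * Real.sin (Real.pi / 3 - w.im) := by
  rw [bary_one, Complex.exp_re, Complex.exp_im, Real.sin_sub, Real.sin_pi_div_three,
    Real.cos_pi_div_three]
  linear_combination (-Real.exp w.re * Real.cos w.im / 3) * sq_sqrt_three

theorem norm_exp_lt {w : ℂ} (hw : w.re < Real.log (3 / 4)) : ‖Complex.exp w‖ < 3 / 4 := by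
  rw [Complex.norm_exp]
  calc Real.exp w.re < Real.exp (Real.log (3 / 4)) := Real.exp_lt_exp.2 hw
    _ = 3 / 4 := Real.exp_log (by norm_num)

/-- The side opposite to 0 lies at distance √3/2 > 3/4. -/
theorem bary_zero_pos_of_norm {z : ℂ} (hz : ‖z‖ < 3 / 4) : 0 < bary 0 z := by
  have h3 := sq_sqrt_three
  rw [bary_zero]
  have h1 : ‖z‖ ^ 2 < 9 / 16 := by nlinarith [norm_nonneg z]
  rw [Complex.sq_norm, Complex.normSq_apply] at h1
  by_contra hcon
  nlinarith [sq_nonneg (z.re * √3 - z.im * 3), sq_nonneg (z.re * √3 / 3 - z.im),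
    sq_nonneg (z.re + z.im * √3 / 3 - 1)]

theorem exp_mem_triStar {w : ℂ} (hw : w ∈ edgeStrip) : Complex.exp w ∈ triStar := by
  obtain ⟨h1, h2, h3⟩ := hw
  have hpi := Real.pi_pos
  have b0 := bary_zero_pos_of_norm (norm_exp_lt h1)
  have b1 : 0 < bary 1 (Complex.exp w) := by
    rw [bary_one_exp]
    have := Real.sin_pos_of_pos_of_lt_pi (x := Real.pi / 3 - w.im) (by linarith) (by linarith)
    have := sqrt_three_pos
    positivity
  have b2 : 0 ≤ bary 2 (Complex.exp w) := by
    rw [bary_two, Complex.exp_im]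
    have := Real.sin_nonneg_of_nonneg_of_le_pi h2 (by linarith)
    have := sqrt_three_pos
    positivity
  have hs := bary_sum (Complex.exp w)
  intro i
  fin_cases i
  · change 0 ≤ bary 0 (Complex.exp w) ∧ bary 0 (Complex.exp w) < 1
    constructor <;> linarith
  · change 0 ≤ bary 1 (Complex.exp w) ∧ bary 1 (Complex.exp w) < 1
    constructor <;> linarith
  · change 0 ≤ bary 2 (Complex.exp w) ∧ bary 2 (Complex.exp w) < 1
    constructor <;> linarith

theorem exp_mem_triInt {w : ℂ} (hw : w ∈ strip) : Complex.exp w ∈ triInt := by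
  have hs := exp_mem_triStar (strip_subset_edgeStrip hw)
  obtain ⟨h1, h2, h3⟩ := hw
  have hpi := Real.pi_pos
  intro i
  fin_cases i
  · exact bary_zero_pos_of_norm (norm_exp_lt h1)
  · change 0 < bary 1 (Complex.exp w)
    rw [bary_one_exp]
    have := Real.sin_pos_of_pos_of_lt_pi (x := Real.pi / 3 - w.im) (by linarith) (by linarith)
    have := sqrt_three_pos
    positivity
  · change 0 < bary 2 (Complex.exp w)
    rw [bary_two, Complex.exp_im]
    have := Real.sin_pos_of_pos_of_lt_pi h2 (by linarith)
    have := sqrt_three_pos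
    positivity

theorem ne_zero_of_mem_triInt {z : ℂ} (hz : z ∈ triInt) : z ≠ 0 := by
  rintro rfl
  have := hz 1
  rw [bary_one] at this
  simp at this

theorem log_mem_strip {z : ℂ} (hz : z ∈ triInt) (hn : ‖z‖ < 3 / 4) : Complex.log z ∈ strip := by
  have h0 := ne_zero_of_mem_triInt hz
  have hpi := Real.pi_pos
  have h3 := sqrt_three_pos
  have he := Complex.exp_log h0
  have hr : (Complex.log z).re < Real.log (3 / 4) := by
    rw [Complex.log_re]
    exact Real.log_lt_log (norm_pos_iff.2 h0) hn
  have b1 := hz 1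
  have b2 := hz 2
  rw [← he, bary_one_exp] at b1
  rw [← he, bary_two, Complex.exp_im] at b2
  have hle := Complex.log_im_le_pi z
  have hlt := Complex.neg_pi_lt_log_im z
  have hexp := Real.exp_pos (Complex.log z).re
  have him : 0 < (Complex.log z).im := by
    by_contra hcon
    have := Real.sin_nonpos_of_nonpos_of_neg_pi_le (not_lt.1 hcon) hlt.le
    have : Real.exp (Complex.log z).re * Real.sin (Complex.log z).im ≤ 0 :=
      mul_nonpos_of_nonneg_of_nonpos hexp.le this
    nlinarith
  refine ⟨hr, him, ?_⟩
  by_contra hcon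
  have := Real.sin_nonpos_of_nonpos_of_neg_pi_le (x := Real.pi / 3 - (Complex.log z).im)
    (by linarith) (by linarith)
  have h4 : 0 < Real.exp (Complex.log z).re * (2 * √3 / 3) := by positivity
  nlinarith

end Strip

/-! ### Charts of a 2-cell for its cyclic orderings -/

section Charts

variable {W : Type*} {Y : AbstractSimplicialComplex W}

/-- The cyclic permutation of the vertices of an ordered 2-cell. -/
def cyc (σ : Fin 3 → W) : Fin 3 → W := fun i => σ (i + 1)

theorem IsTri.cyc {σ : Fin 3 → W} (h : IsTri Y σ) : IsTri Y (cyc σ) := by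
  obtain ⟨hi, s, hs, hr⟩ := h
  refine ⟨fun i j hij => add_right_cancel (hi hij), s, hs, ?_⟩
  rw [hr]
  ext w
  constructor
  · rintro ⟨i, rfl⟩; exact ⟨i - 1, by simp [HiggsComplex.cyc]⟩
  · rintro ⟨i, rfl⟩; exact ⟨i + 1, rfl⟩

theorem cyc_cyc_cyc (σ : Fin 3 → W) : cyc (cyc (cyc σ)) = σ := by
  funext i; fin_cases i <;> rfl

theorem chart_rot (σ : Fin 3 → W) (z : ℂ) : chart σ (rot z) = chart (cyc σ) z := by
  classical
  funext w
  simp only [chart, cyc]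
  rw [← Equiv.sum_comp (Equiv.addRight (1 : Fin 3))]
  refine Finset.sum_congr rfl fun i _ => ?_
  simp only [Equiv.coe_addRight, bary_rot]
  by_cases h : σ (i + 1) = w <;> simp [h]

theorem bary_linear_rot (i : Fin 3) (v : ℂ) :
    bary (i + 1) (zeta * v) - bary (i + 1) 0 = bary i v - bary i 0 := by
  have h := sq_sqrt_three
  fin_cases i
  · change bary 1 _ - bary 1 _ = bary 0 _ - bary 0 _
    simp only [bary_zero, bary_one, zeta, Complex.mul_re, Complex.mul_im, Complex.zero_re,
      Complex.zero_im]
    linear_combination (-v.re / 6) * h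
  · change bary 2 _ - bary 2 _ = bary 1 _ - bary 1 _
    simp only [bary_two, bary_one, zeta, Complex.mul_im, Complex.zero_re,
      Complex.zero_im]
    linear_combination (v.re / 3) * h
  · change bary 0 _ - bary 0 _ = bary 2 _ - bary 2 _
    simp only [bary_zero, bary_two, zeta, Complex.mul_re, Complex.mul_im, Complex.zero_re,
      Complex.zero_im]
    linear_combination (-v.re / 6) * h

theorem chartVec_rot (σ : Fin 3 → W) (v : ℂ) : chartVec σ (zeta * v) = chartVec (cyc σ) v := by
  classical
  funext w
  simp only [chartVec, chart, Pi.sub_apply, cyc, ← Finset.sum_sub_distrib]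
  rw [← Equiv.sum_comp (Equiv.addRight (1 : Fin 3))]
  refine Finset.sum_congr rfl fun i _ => ?_
  simp only [Equiv.coe_addRight]
  by_cases h : σ (i + 1) = w
  · simpa [h] using bary_linear_rot i v
  · simp [h]

/-- The three sides of one 2-cell thereby become the first sides of its three cyclic orderings. -/
theorem IsSmoothForm.rot {r : ℕ} {η : FormFamily W r} (h : IsSmoothForm Y η) {σ : Fin 3 → W}
    (hσ : IsTri Y σ) {z : ℂ} (hz : z ∈ triStar) (v : ℂ) :
    η σ (HiggsComplex.rot z) (zeta * v) = η (HiggsComplex.cyc σ) z v :=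
  h.compat _ _ hσ hσ.cyc _ (rot_mem_triStar.2 hz) _ hz _ _ (chart_rot σ z) (chartVec_rot σ v)

/-- Points of the first edge depend only on the first two vertices. -/
theorem chart_real (a b c : W) (x : ℝ) :
    chart ![a, b, c] (x : ℂ) = chart ![a, b, b] (x : ℂ) := by
  classical
  have h2 : bary 2 (x : ℂ) = 0 := by rw [bary_two]; simp
  funext w
  simp only [chart, Fin.sum_univ_three]
  by_cases ha : a = w <;> by_cases hb : b = w <;> simp [h2, ha, hb]

theorem ofReal_mem_triStar {x : ℝ} (h0 : 0 < x) (h1 : x < 1) : (x : ℂ) ∈ triStar := by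
  intro i
  fin_cases i
  · change 0 ≤ bary 0 _ ∧ bary 0 _ < 1
    rw [bary_zero]; simp [h0, h1.le]
  · change 0 ≤ bary 1 _ ∧ bary 1 _ < 1
    rw [bary_one]; simp [h0.le, h1]
  · change 0 ≤ bary 2 _ ∧ bary 2 _ < 1
    rw [bary_two]; simp

theorem ofReal_mem_tri {x : ℝ} (h0 : 0 ≤ x) (h1 : x ≤ 1) : (x : ℂ) ∈ tri := by
  intro i
  fin_cases i
  · change 0 ≤ bary 0 _
    rw [bary_zero]; simp [h1]
  · change 0 ≤ bary 1 _
    rw [bary_one]; simp [h0]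
  · change 0 ≤ bary 2 _
    rw [bary_two]; simp

end Charts

end HiggsComplex

namespace HiggsComplex

open MeasureTheory Set Filter Topology Metric

/-! ### Green's formula on the triangle -/

section Green

theorem measurableSet_triInt : MeasurableSet triInt := isOpen_triInt.measurableSet

theorem volume_triInt_lt_top : volume triInt < ⊤ :=
  (measure_mono triInt_subset_tri).trans_lt isCompact_tri.measure_lt_top

/-- Continuous bounded functions on the open triangle are integrable. -/
theorem integrableOn_triInt {E : Type*} [NormedAddCommGroup E] {f : ℂ → E} {C : ℝ}
    (hf : ContinuousOn f triInt) (hC : ∀ z ∈ triInt, ‖f z‖ ≤ C) : IntegrableOn f triInt :=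
  IntegrableOn.of_bound volume_triInt_lt_top (hf.aestronglyMeasurable measurableSet_triInt) C
    ((ae_restrict_iff' measurableSet_triInt).2 (Eventually.of_forall hC))

theorem mk_mem_triInt {x y : ℝ} :
    (⟨x, y⟩ : ℂ) ∈ triInt ↔ 0 < y ∧ y * √3 / 3 < x ∧ x < 1 - y * √3 / 3 := by
  have h3 := sqrt_three_pos
  constructor
  · intro h
    have h0 := h 0
    have h1 := h 1
    have h2 := h 2
    rw [bary_zero] at h0
    rw [bary_one] at h1
    rw [bary_two] at h2
    refine ⟨?_, by linarith, by linarith⟩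
    by_contra hc
    have : y * √3 ≤ 0 := mul_nonpos_of_nonpos_of_nonneg (not_lt.1 hc) h3.le
    linarith
  · rintro ⟨h1, h2, h3'⟩ i
    have := mul_pos h1 h3
    fin_cases i
    · change 0 < bary 0 _; rw [bary_zero]; linarith
    · change 0 < bary 1 _; rw [bary_one]; linarith
    · change 0 < bary 2 _; rw [bary_two]; linarith

theorem mk_mem_tri {x y : ℝ} (h1 : 0 ≤ y) (h2 : y * √3 / 3 ≤ x) (h3' : x ≤ 1 - y * √3 / 3) :
    (⟨x, y⟩ : ℂ) ∈ tri := by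
  have := mul_nonneg h1 sqrt_three_pos.le
  intro i
  fin_cases i
  · change 0 ≤ bary 0 _; rw [bary_zero]; linarith
  · change 0 ≤ bary 1 _; rw [bary_one]; linarith
  · change 0 ≤ bary 2 _; rw [bary_two]; linarith

theorem hasDerivAt_mk_left {E : Type*} [NormedAddCommGroup E] [NormedSpace ℝ E] {G : ℂ → E}
    {G' : PlaneHom E} {x y : ℝ} (h : HasFDerivAt G G' ⟨x, y⟩) :
    HasDerivAt (fun x : ℝ => G ⟨x, y⟩) (G' 1) x := by
  have h1 : HasDerivAt (fun x : ℝ => (⟨x, y⟩ : ℂ)) 1 x := by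
    have : (fun x : ℝ => (⟨x, y⟩ : ℂ)) = fun x : ℝ => (x : ℂ) + y * Complex.I := by
      funext x; apply Complex.ext <;> simp
    rw [this]
    exact (HasDerivAt.ofReal_comp (hasDerivAt_id x)).add_const _
  exact h.comp_hasDerivAt x h1

theorem hasDerivAt_mk_right {E : Type*} [NormedAddCommGroup E] [NormedSpace ℝ E] {G : ℂ → E}
    {G' : PlaneHom E} {x y : ℝ} (h : HasFDerivAt G G' ⟨x, y⟩) :
    HasDerivAt (fun y : ℝ => G ⟨x, y⟩) (G' Complex.I) y := by
  have h1 : HasDerivAt (fun y : ℝ => (⟨x, y⟩ : ℂ)) Complex.I y := by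
    have : (fun y : ℝ => (⟨x, y⟩ : ℂ)) = fun y : ℝ => (y : ℂ) * Complex.I + x := by
      funext y; apply Complex.ext <;> simp
    rw [this]
    simpa using ((HasDerivAt.ofReal_comp (hasDerivAt_id y)).mul_const Complex.I).add_const (x : ℂ)
  exact h.comp_hasDerivAt y h1

theorem continuous_mk : Continuous fun p : ℝ × ℝ => (⟨p.1, p.2⟩ : ℂ) :=
  Complex.equivRealProdCLM.symm.continuous

theorem integral_complex_eq {E : Type*} [NormedAddCommGroup E] [NormedSpace ℝ E] (f : ℂ → E) :
    ∫ z, f z = ∫ p : ℝ × ℝ, f ⟨p.1, p.2⟩ := by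
  rw [← Complex.volume_preserving_equiv_real_prod.symm.integral_comp
    Complex.measurableEquivRealProd.symm.measurableEmbedding]
  rfl

theorem lintegral_complex_eq (f : ℂ → ENNReal) :
    ∫⁻ z, f z = ∫⁻ p : ℝ × ℝ, f ⟨p.1, p.2⟩ := by
  rw [← Complex.volume_preserving_equiv_real_prod.symm.lintegral_comp_emb
    Complex.measurableEquivRealProd.symm.measurableEmbedding]
  rfl

/-- The fundamental theorem of calculus on the slices of the triangle parallel to the edge `01`. -/
theorem integral_triInt_fderiv_one {G : ℂ → ℝ} {G' : ℂ → PlaneHom ℝ} {C : ℝ}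
    (hG : ContinuousOn G tri) (hd : ∀ z ∈ triInt, HasFDerivAt G (G' z) z)
    (hc : ContinuousOn G' triInt) (hC : ∀ z ∈ triInt, ‖G' z‖ ≤ C) :
    ∫ z in triInt, G' z 1 =
      √3 / 2 * ((∫ s in (0 : ℝ)..1, G (rot s)) - ∫ s in (0 : ℝ)..1, G (rot (rot s))) := by
  have h3 := sqrt_three_pos
  have hsq := sq_sqrt_three
  have hc1 : ContinuousOn (fun z => G' z 1) triInt := hc.clm_apply continuousOn_const
  have hC1 : ∀ z ∈ triInt, ‖G' z 1‖ ≤ C := fun z hz => by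
    simpa using (G' z).le_of_opNorm_le (hC z hz) 1
  have hint : Integrable (triInt.indicator fun z => G' z 1) :=
    (integrable_indicator_iff measurableSet_triInt).2 (integrableOn_triInt hc1 hC1)
  have hint' : Integrable (fun p : ℝ × ℝ => triInt.indicator (fun z => G' z 1) ⟨p.1, p.2⟩) :=
    Complex.volume_preserving_equiv_real_prod.symm.integrable_comp_of_integrable hint
  rw [← integral_indicator measurableSet_triInt, integral_complex_eq]
  rw [Measure.volume_eq_prod] at hint' ⊢
  rw [integral_prod_symm _ hint']
  -- At height `y` the triangle is cut in the segment from y/√3 to 1 − y/√3, which is nonempty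
  -- exactly for 0 < y < √3/2.
  have inner : ∀ y : ℝ, ∫ x : ℝ, triInt.indicator (fun z => G' z 1) ⟨x, y⟩ =
      (Ioo 0 (√3 / 2)).indicator
        (fun y => G ⟨1 - y * √3 / 3, y⟩ - G ⟨y * √3 / 3, y⟩) y := by
    intro y
    by_cases hy : y ∈ Ioo 0 (√3 / 2)
    · rw [indicator_of_mem hy]
      have hab : y * √3 / 3 ≤ 1 - y * √3 / 3 := by nlinarith [hy.1, hy.2]
      have hset : (fun x : ℝ => triInt.indicator (fun z => G' z 1) (⟨x, y⟩ : ℂ)) =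
          (Ioo (y * √3 / 3) (1 - y * √3 / 3)).indicator (fun x : ℝ => G' ⟨x, y⟩ 1) := by
        funext x
        by_cases hx : x ∈ Ioo (y * √3 / 3) (1 - y * √3 / 3)
        · rw [indicator_of_mem hx, indicator_of_mem (mk_mem_triInt.2 ⟨hy.1, hx.1, hx.2⟩)]
        · rw [indicator_of_notMem hx, indicator_of_notMem]
          exact fun h => hx (mk_mem_triInt.1 h).2
      rw [hset, integral_indicator measurableSet_Ioo, ← integral_Ioc_eq_integral_Ioo,
        ← intervalIntegral.integral_of_le hab]
      have hmk : Continuous fun x : ℝ => (⟨x, y⟩ : ℂ) :=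
        continuous_mk.comp (continuous_id.prodMk continuous_const)
      refine intervalIntegral.integral_eq_sub_of_hasDerivAt_of_le hab
        (f := fun x : ℝ => G ⟨x, y⟩) ?_ ?_ ?_
      · exact hG.comp hmk.continuousOn fun x hx => mk_mem_tri hy.1.le hx.1 hx.2
      · exact fun x hx => hasDerivAt_mk_left (hd _ (mk_mem_triInt.2 ⟨hy.1, hx.1, hx.2⟩))
      · rw [intervalIntegrable_iff_integrableOn_Ioo_of_le hab]
        have hm : MapsTo (fun x : ℝ => (⟨x, y⟩ : ℂ)) (Ioo (y * √3 / 3) (1 - y * √3 / 3)) triInt :=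
          fun x hx => mk_mem_triInt.2 ⟨hy.1, hx.1, hx.2⟩
        exact IntegrableOn.of_bound (by simp)
          ((hc1.comp hmk.continuousOn hm).aestronglyMeasurable measurableSet_Ioo) C
          ((ae_restrict_iff' measurableSet_Ioo).2 (Eventually.of_forall fun x hx => hC1 _ (hm hx)))
    · rw [indicator_of_notMem hy]
      have : (fun x : ℝ => triInt.indicator (fun z => G' z 1) (⟨x, y⟩ : ℂ)) = fun _ => 0 := by
        funext x
        refine indicator_of_notMem (fun h => hy ?_) _
        obtain ⟨h1, h2, h4⟩ := mk_mem_triInt.1 h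
        exact ⟨h1, by nlinarith⟩
      rw [this, integral_zero]
  simp_rw [inner]
  rw [integral_indicator measurableSet_Ioo, ← integral_Ioc_eq_integral_Ioo,
    ← intervalIntegral.integral_of_le (by positivity)]
  have hsub := intervalIntegral.integral_comp_mul_left (a := 0) (b := 1) (c := √3 / 2)
    (fun y => G ⟨1 - y * √3 / 3, y⟩ - G ⟨y * √3 / 3, y⟩) (by positivity)
  rw [mul_zero, mul_one] at hsub
  have e : ∫ y in (0 : ℝ)..√3 / 2, (G ⟨1 - y * √3 / 3, y⟩ - G ⟨y * √3 / 3, y⟩) =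
      √3 / 2 * ∫ s in (0 : ℝ)..1, (G ⟨1 - √3 / 2 * s * √3 / 3, √3 / 2 * s⟩ -
        G ⟨√3 / 2 * s * √3 / 3, √3 / 2 * s⟩) := by
    rw [hsub, smul_eq_mul, mul_inv_cancel_left₀ (by positivity)]
  rw [e]
  -- After rescaling the height, right endpoints of slices run along `rot` of the first side. Left
  -- endpoints run backwards along `rot ∘ rot` of it, which the substitution s ↦ 1 − s undoes.
  have p1 : ∀ s : ℝ, (⟨1 - √3 / 2 * s * √3 / 3, √3 / 2 * s⟩ : ℂ) = rot s := by
    intro s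
    apply Complex.ext
    · rw [rot_re]; simp; linear_combination (s / 6) * hsq
    · rw [rot_im]; simp
  have p2 : ∀ s : ℝ, (⟨√3 / 2 * s * √3 / 3, √3 / 2 * s⟩ : ℂ) = rot (rot ((1 - s : ℝ) : ℂ)) := by
    intro s
    apply Complex.ext
    · rw [rot_re, rot_re, rot_im]; simp; linear_combination (s / 6 + (1 - s) / 4) * hsq
    · rw [rot_im, rot_re, rot_im]; simp; ring
  simp_rw [p1, p2]
  have hI : ∀ k : ℝ → ℂ, Continuous k → (∀ s ∈ Icc (0 : ℝ) 1, k s ∈ tri) →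
      IntervalIntegrable (fun s => G (k s)) volume 0 1 := by
    intro k hk hm
    refine ContinuousOn.intervalIntegrable ?_
    rw [uIcc_of_le zero_le_one]
    exact hG.comp hk.continuousOn hm
  rw [intervalIntegral.integral_sub]
  · congr 2
    have := intervalIntegral.integral_comp_sub_left (a := 0) (b := 1)
      (fun s : ℝ => G (rot (rot (s : ℂ)))) 1
    simpa using this
  · exact hI _ (continuous_rot.comp Complex.continuous_ofReal)
      fun s hs => rot_mem_tri.2 (ofReal_mem_tri hs.1 hs.2)
  · refine hI (fun s => rot (rot ((1 - s : ℝ) : ℂ))) ?_ ?_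
    · exact continuous_rot.comp (continuous_rot.comp
        (Complex.continuous_ofReal.comp (continuous_const.sub continuous_id)))
    · exact fun s hs => rot_mem_tri.2 (rot_mem_tri.2 (ofReal_mem_tri (by linarith [hs.2])
        (by linarith [hs.1])))

theorem setIntegral_triInt_rot {E : Type*} [NormedAddCommGroup E] [NormedSpace ℝ E] (f : ℂ → E) :
    ∫ z in triInt, f (rot z) = ∫ z in triInt, f z := by
  have h : rot ⁻¹' triInt = triInt := by ext z; exact rot_mem_triInt
  have := measurePreserving_rot.setIntegral_preimage_emb measurableEmbedding_rot f triInt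
  rwa [h] at this

/-- The same statement for the edge direction `ζ`. -/
theorem integral_triInt_fderiv_zeta {G : ℂ → ℝ} {G' : ℂ → PlaneHom ℝ} {C : ℝ}
    (hG : ContinuousOn G tri) (hd : ∀ z ∈ triInt, HasFDerivAt G (G' z) z)
    (hc : ContinuousOn G' triInt) (hC : ∀ z ∈ triInt, ‖G' z‖ ≤ C) :
    ∫ z in triInt, G' z zeta =
      √3 / 2 * ((∫ s in (0 : ℝ)..1, G (rot (rot s))) - ∫ s in (0 : ℝ)..1, G s) := by
  -- Pulling back by the rotation turns the direction ζ into the direction 1 and permutes the sides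
  -- cyclically.
  have key := integral_triInt_fderiv_one (G := G ∘ rot) (C := C)
    (G' := fun z => (G' (rot z)).comp (ContinuousLinearMap.mul ℝ ℂ zeta))
    (hG.comp continuous_rot.continuousOn fun z hz => rot_mem_tri.2 hz)
    (fun z hz => (hd _ (rot_mem_triInt.2 hz)).comp z (hasFDerivAt_rot z))
    ((hc.comp continuous_rot.continuousOn fun z hz => rot_mem_triInt.2 hz).clm_comp
      continuousOn_const)
    (fun z hz => by
      refine ContinuousLinearMap.opNorm_le_bound _ ((norm_nonneg _).trans (hC z hz)) fun v => ?_
      have := (G' (rot z)).le_of_opNorm_le (hC _ (rot_mem_triInt.2 hz)) (zeta * v)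
      rwa [norm_mul, norm_zeta, one_mul] at this)
  simp only [ContinuousLinearMap.comp_apply, ContinuousLinearMap.mul_apply', mul_one,
    Function.comp_apply, rot_rot_rot] at key
  rw [← key, setIntegral_triInt_rot (fun z => G' z zeta)]

/-- Green's formula on the triangle. -/
theorem green_triangle {l : ℂ → PlaneHom ℝ} {l' : ℂ → PlaneHom (PlaneHom ℝ)} {C : ℝ}
    (hl : ContinuousOn l tri) (hd : ∀ z ∈ triInt, HasFDerivAt l (l' z) z)
    (hc : ContinuousOn l' triInt) (hC : ∀ z ∈ triInt, ‖l' z‖ ≤ C) :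
    ∫ z in triInt, (l' z 1 1 + l' z Complex.I Complex.I) =
      - ((∫ s in (0 : ℝ)..1, l s Complex.I) + (∫ s in (0 : ℝ)..1, l (rot s) (zeta * Complex.I)) +
        ∫ s in (0 : ℝ)..1, l (rot (rot s)) (zeta * (zeta * Complex.I))) := by
  have ev : ∀ v : ℂ, ∃ K : ℝ, ContinuousOn (fun z => l z v) tri ∧
      (∀ z ∈ triInt, HasFDerivAt (fun z => l z v)
        ((ContinuousLinearMap.apply ℝ ℝ v).comp (l' z)) z) ∧
      ContinuousOn (fun z => (ContinuousLinearMap.apply ℝ ℝ v).comp (l' z)) triInt ∧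
      ∀ z ∈ triInt, ‖(ContinuousLinearMap.apply ℝ ℝ v).comp (l' z)‖ ≤ K := by
    intro v
    refine ⟨‖ContinuousLinearMap.apply ℝ ℝ v‖ * C, hl.clm_apply continuousOn_const, ?_, ?_, ?_⟩
    · exact fun z hz => (ContinuousLinearMap.apply ℝ ℝ v).hasFDerivAt.comp z (hd z hz)
    · exact continuousOn_const.clm_comp hc
    · exact fun z hz => (ContinuousLinearMap.opNorm_comp_le _ _).trans
        (mul_le_mul_of_nonneg_left (hC z hz) (norm_nonneg _))
  have i1 := fun v => (ev v).elim fun K h => integral_triInt_fderiv_one h.1 h.2.1 h.2.2.1 h.2.2.2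
  have i2 := fun v => (ev v).elim fun K h => integral_triInt_fderiv_zeta h.1 h.2.1 h.2.2.1 h.2.2.2
  simp only [ContinuousLinearMap.comp_apply, ContinuousLinearMap.apply_apply] at i1 i2
  -- Only the side directions 1 and ζ have been integrated; the derivative in direction i is
  -- recovered from i = (1 + 2ζ)/√3.
  have hI : Complex.I = ((√3)⁻¹ : ℝ) • ((1 : ℂ) + (2 : ℝ) • zeta) := by
    have := sqrt_three_pos.ne'
    apply Complex.ext
    · simp [zeta]; ring
    · simp [zeta]; field_simp; linear_combination -sq_sqrt_three
  have hint : ∀ u v : ℂ, IntegrableOn (fun z => l' z u v) triInt := by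
    intro u v
    refine integrableOn_triInt (C := C * ‖u‖ * ‖v‖)
      ((hc.clm_apply continuousOn_const).clm_apply continuousOn_const) fun z hz => ?_
    exact (l' z u).le_of_opNorm_le ((l' z).le_of_opNorm_le (hC z hz) u) v
  have e1 : ∀ z, l' z Complex.I Complex.I = (√3)⁻¹ * (l' z 1 Complex.I + 2 * l' z zeta Complex.I) := by
    intro z
    conv_lhs => rw [show l' z Complex.I = (√3)⁻¹ • (l' z 1 + (2 : ℝ) • l' z zeta) by
      conv_lhs => rw [hI]
      rw [map_smul, map_add, map_smul]]
    simp [mul_add]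
  have hi1 := i1 1
  have hiI := i1 Complex.I
  have hiz := i2 Complex.I
  have h3 := sqrt_three_pos.ne'
  have b : ∀ (k : ℝ → ℂ), Continuous k → (∀ s ∈ Icc (0 : ℝ) 1, k s ∈ tri) → ∀ v,
      IntervalIntegrable (fun s => l (k s) v) volume 0 1 := by
    intro k hk hm v
    refine ContinuousOn.intervalIntegrable ?_
    rw [uIcc_of_le zero_le_one]
    exact (hl.clm_apply continuousOn_const).comp hk.continuousOn hm
  have c1 : Continuous fun s : ℝ => rot s := continuous_rot.comp Complex.continuous_ofReal
  have b1 := b (fun s => rot s) c1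
    fun s hs => rot_mem_tri.2 (ofReal_mem_tri hs.1 hs.2)
  have b2 := b (fun s => rot (rot s)) (continuous_rot.comp c1)
    fun s hs => rot_mem_tri.2 (rot_mem_tri.2 (ofReal_mem_tri hs.1 hs.2))
  -- The inward normals of the second and third sides are ζi and ζ²i, expanded here in the frame 1,
  -- i.
  have z1 : zeta * Complex.I = (-(√3 / 2)) • (1 : ℂ) + (-(1 / 2 : ℝ)) • Complex.I := by
    apply Complex.ext
    · simp [zeta]
    · simp [zeta]; ring
  have z2 : zeta * (zeta * Complex.I) = (√3 / 2) • (1 : ℂ) + (-(1 / 2 : ℝ)) • Complex.I := by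
    have := sq_sqrt_three
    apply Complex.ext
    · simp [zeta]; ring
    · simp [zeta]; linear_combination (-1 / 4) * this
  have k1 : (∫ s in (0 : ℝ)..1, l (rot s) (zeta * Complex.I)) =
      -(√3 / 2) * (∫ s in (0 : ℝ)..1, l (rot s) 1) -
        1 / 2 * ∫ s in (0 : ℝ)..1, l (rot s) Complex.I := by
    rw [← intervalIntegral.integral_const_mul, ← intervalIntegral.integral_const_mul,
      ← intervalIntegral.integral_sub ((b1 1).const_mul _) ((b1 Complex.I).const_mul _)]
    refine intervalIntegral.integral_congr fun s _ => ?_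
    simp only [z1, map_add, map_smul, smul_eq_mul]; ring
  have k2 : (∫ s in (0 : ℝ)..1, l (rot (rot s)) (zeta * (zeta * Complex.I))) =
      √3 / 2 * (∫ s in (0 : ℝ)..1, l (rot (rot s)) 1) -
        1 / 2 * ∫ s in (0 : ℝ)..1, l (rot (rot s)) Complex.I := by
    rw [← intervalIntegral.integral_const_mul, ← intervalIntegral.integral_const_mul,
      ← intervalIntegral.integral_sub ((b2 1).const_mul _) ((b2 Complex.I).const_mul _)]
    refine intervalIntegral.integral_congr fun s _ => ?_
    simp only [z2, map_add, map_smul, smul_eq_mul]; ring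
  simp_rw [e1]
  have hsum : IntegrableOn (fun z => l' z 1 Complex.I + 2 * l' z zeta Complex.I) triInt :=
    (hint 1 Complex.I).add ((hint zeta Complex.I).const_mul 2)
  rw [integral_add (hint 1 1) (hsum.const_mul _),
    integral_const_mul, integral_add (hint 1 Complex.I) ((hint zeta Complex.I).const_mul 2),
    integral_const_mul, hi1, hiI, hiz, k1, k2]
  field_simp
  ring

end Green

end HiggsComplex

namespace HiggsComplex

open MeasureTheory Set Filter Topology Metric

/-! ### Cutoff functions near the vertices -/

section Cutoff

/-- Radial cutoff functions at the origin. -/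
theorem exists_radial_cutoff : ∃ M : ℝ, 0 ≤ M ∧ ∀ ε : ℝ, 0 < ε → ∃ κ : ℂ → ℝ, ContDiff ℝ 1 κ ∧
    (∀ z, 0 ≤ κ z ∧ κ z ≤ 1) ∧ (∀ z, ‖z‖ ≤ ε → κ z = 0) ∧ (∀ z, 2 * ε ≤ ‖z‖ → κ z = 1) ∧
    ∀ z, ‖fderiv ℝ κ z‖ ≤ (closedBall (0 : ℂ) (2 * ε)).indicator (fun _ => M / ε) z := by
  -- This profile is 0 for |z| ≤ 1 and 1 for |z|² ≥ 2, in particular for |z| ≥ 2. Rescaling it to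
  -- size ε multiplies the gradient by 1/ε.
  let k : ℂ → ℝ := fun z => Real.smoothTransition (‖z‖ ^ 2 - 1)
  have hk : ContDiff ℝ 1 k :=
    Real.smoothTransition.contDiff.comp ((contDiff_norm_sq ℝ).sub contDiff_const)
  have hk1 : ∀ z, 2 ≤ ‖z‖ ^ 2 → k z = 1 := fun z hz =>
    Real.smoothTransition.one_of_one_le (by linarith)
  have hkd : ∀ z : ℂ, 2 < ‖z‖ → fderiv ℝ k z = 0 := by
    intro z hz
    have : k =ᶠ[𝓝 z] fun _ => 1 := by
      filter_upwards [(isOpen_lt continuous_const continuous_norm).mem_nhds hz] with y hy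
      exact hk1 y (by have : 2 < ‖y‖ := hy; nlinarith)
    rw [this.fderiv_eq]; simp
  have hc : HasCompactSupport (fderiv ℝ k) := by
    refine HasCompactSupport.of_support_subset_isCompact (isCompact_closedBall (0 : ℂ) 2) ?_
    intro z hz
    rw [mem_closedBall_zero_iff]
    by_contra hcon
    exact hz (hkd z (not_le.1 hcon))
  obtain ⟨M, hM⟩ := (hk.continuous_fderiv one_ne_zero).bounded_above_of_compact_support hc
  refine ⟨M, (norm_nonneg _).trans (hM 0), fun ε hε => ⟨fun z => k (ε⁻¹ • z), ?_, ?_, ?_, ?_, ?_⟩⟩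
  · exact hk.comp (contDiff_const_smul _)
  · exact fun z => ⟨Real.smoothTransition.nonneg _, Real.smoothTransition.le_one _⟩
  · intro z hz
    refine Real.smoothTransition.zero_of_nonpos ?_
    have : ‖ε⁻¹ • z‖ ≤ 1 := by
      rw [norm_smul, Real.norm_of_nonneg (by positivity), inv_mul_le_iff₀ hε, mul_one]; exact hz
    nlinarith [norm_nonneg (ε⁻¹ • z)]
  · intro z hz
    refine hk1 _ ?_
    have : 2 ≤ ‖ε⁻¹ • z‖ := by
      rw [norm_smul, Real.norm_of_nonneg (by positivity), le_inv_mul_iff₀ hε]; linarith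
    nlinarith
  · intro z
    have hfd : fderiv ℝ (fun z => k (ε⁻¹ • z)) z = ε⁻¹ • fderiv ℝ k (ε⁻¹ • z) := by
      rw [fderiv_comp_smul]
    rw [hfd, norm_smul, Real.norm_of_nonneg (by positivity)]
    by_cases hz : z ∈ closedBall (0 : ℂ) (2 * ε)
    · rw [indicator_of_mem hz, div_eq_inv_mul]
      exact mul_le_mul_of_nonneg_left (hM _) (by positivity)
    · rw [indicator_of_notMem hz, hkd, norm_zero, mul_zero]
      rw [mem_closedBall_zero_iff, not_le] at hz
      rw [norm_smul, Real.norm_of_nonneg (by positivity), lt_inv_mul_iff₀ hε]; linarith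

theorem contDiff_rot : ContDiff ℝ 1 rot := by unfold rot; fun_prop

theorem norm_fderiv_comp_rot {κ : ℂ → ℝ} (hκ : Differentiable ℝ κ) (z : ℂ) :
    ‖fderiv ℝ (κ ∘ rot) z‖ ≤ ‖fderiv ℝ κ (rot z)‖ := by
  rw [((hκ (rot z)).hasFDerivAt.comp z (hasFDerivAt_rot z)).fderiv]
  refine ContinuousLinearMap.opNorm_le_bound _ (norm_nonneg _) fun v => ?_
  have := (fderiv ℝ κ (rot z)).le_opNorm (zeta * v)
  rwa [norm_mul, norm_zeta, one_mul] at this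

/-- Cutoff functions on the triangle that vanish near the vertices. -/
theorem exists_cutoff : ∃ M : ℝ, 0 ≤ M ∧ ∀ ε : ℝ, 0 < ε → ∃ χ : ℂ → ℝ, ContDiff ℝ 1 χ ∧
    (∀ z, 0 ≤ χ z ∧ χ z ≤ 1) ∧ (∀ z, χ (rot z) = χ z) ∧ (∀ z, ‖z‖ ≤ ε → χ z = 0) ∧
    (∀ z, 2 * ε ≤ ‖z‖ → 2 * ε ≤ ‖rot z‖ → 2 * ε ≤ ‖rot (rot z)‖ → χ z = 1) ∧
    ∀ z, ‖fderiv ℝ χ z‖ ≤ (closedBall (0 : ℂ) (2 * ε)).indicator (fun _ => M / ε) z +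
      (closedBall (0 : ℂ) (2 * ε)).indicator (fun _ => M / ε) (rot z) +
      (closedBall (0 : ℂ) (2 * ε)).indicator (fun _ => M / ε) (rot (rot z)) := by
  obtain ⟨M, hM, h⟩ := exists_radial_cutoff
  refine ⟨M, hM, fun ε hε => ?_⟩
  obtain ⟨κ, hd, h01, h0, h1, hb⟩ := h ε hε
  have hd1 : ContDiff ℝ 1 (κ ∘ rot) := hd.comp contDiff_rot
  have hd2 : ContDiff ℝ 1 ((κ ∘ rot) ∘ rot) := hd1.comp contDiff_rot
  -- The points `z` with `rot z = 0` or `rot (rot z) = 0` are the other two vertices, so the product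
  -- vanishes near all three. It is rotation invariant because `rot` has order three.
  refine ⟨fun z => κ z * (κ ∘ rot) z * ((κ ∘ rot) ∘ rot) z, (hd.mul hd1).mul hd2, ?_, ?_, ?_, ?_, ?_⟩
  · intro z
    have a := h01 z
    have b := h01 (rot z)
    have c := h01 (rot (rot z))
    simp only [Function.comp_apply]
    exact ⟨mul_nonneg (mul_nonneg a.1 b.1) c.1,
      mul_le_one₀ (mul_le_one₀ a.2 b.1 b.2) c.1 c.2⟩
  · intro z; simp only [Function.comp_apply, rot_rot_rot]; ring
  · intro z hz; simp [h0 z hz]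
  · intro z a b c; simp [h1 _ a, h1 _ b, h1 _ c]
  · intro z
    have f0 := (hd.differentiable one_ne_zero z).hasFDerivAt
    have f1 := (hd1.differentiable one_ne_zero z).hasFDerivAt
    have f2 := (hd2.differentiable one_ne_zero z).hasFDerivAt
    have g1 := (norm_fderiv_comp_rot (hd.differentiable one_ne_zero) z).trans (hb _)
    have g2 := (norm_fderiv_comp_rot (hd1.differentiable one_ne_zero) z).trans
      ((norm_fderiv_comp_rot (hd.differentiable one_ne_zero) (rot z)).trans (hb _))
    have e : fderiv ℝ (fun z => κ z * (κ ∘ rot) z * ((κ ∘ rot) ∘ rot) z) z = _ :=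
      ((f0.mul f1).mul f2).fderiv
    rw [e]
    have n : ∀ (c : ℝ) (f : PlaneHom ℝ), 0 ≤ c ∧ c ≤ 1 → ‖c • f‖ ≤ ‖f‖ := by
      intro c f hc
      rw [norm_smul, Real.norm_of_nonneg hc.1]
      exact mul_le_of_le_one_left (norm_nonneg _) hc.2
    have a := h01 z
    have b := h01 (rot z)
    have c := h01 (rot (rot z))
    have ab : 0 ≤ κ z * (κ ∘ rot) z ∧ κ z * (κ ∘ rot) z ≤ 1 :=
      ⟨mul_nonneg a.1 b.1, mul_le_one₀ a.2 b.1 b.2⟩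
    refine (norm_add_le _ _).trans ?_
    have t1 := n _ (fderiv ℝ ((κ ∘ rot) ∘ rot) z) ab
    have t2 := n _ (κ z • fderiv ℝ (κ ∘ rot) z + (κ ∘ rot) z • fderiv ℝ κ z) c
    have t3 := norm_add_le (κ z • fderiv ℝ (κ ∘ rot) z) ((κ ∘ rot) z • fderiv ℝ κ z)
    have t4 := n _ (fderiv ℝ (κ ∘ rot) z) a
    have t5 := n _ (fderiv ℝ κ z) b
    simp only [Function.comp_apply, Pi.mul_apply] at *
    linarith [hb z]

theorem eq_zero_of_mem_tri {z : ℂ} (hz : z ∈ tri) (h : 1 ≤ bary 0 z) : z = 0 := by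
  have := norm_le_of_bary_zero hz
  exact norm_le_zero_iff.1 (by linarith)

/-- The points of the closed triangle that are not vertices. -/
theorem mem_triStar_of_ne {z : ℂ} (hz : z ∈ tri) (h0 : z ≠ 0) (h1 : rot z ≠ 0)
    (h2 : rot (rot z) ≠ 0) : z ∈ triStar := by
  have hz1 := rot_mem_tri.2 hz
  have hz2 := rot_mem_tri.2 hz1
  have b1 : bary 0 (rot z) = bary 2 z := bary_rot 2 z
  have b2 : bary 0 (rot (rot z)) = bary 1 z := by
    rw [← bary_rot 1 z]; exact bary_rot 2 (rot z)
  intro i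
  refine ⟨hz i, ?_⟩
  by_contra hcon
  rw [not_lt] at hcon
  fin_cases i
  · exact h0 (eq_zero_of_mem_tri hz hcon)
  · exact h2 (eq_zero_of_mem_tri hz2 (by rw [b2]; exact hcon))
  · exact h1 (eq_zero_of_mem_tri hz1 (by rw [b1]; exact hcon))

theorem triStar_mem_nhdsWithin {z : ℂ} (hz : z ∈ triStar) : triStar ∈ 𝓝[tri] z := by
  have : ∀ᶠ y in 𝓝 z, ∀ i, bary i y < 1 := by
    rw [eventually_all]
    exact fun i => (continuous_bary i).continuousAt.eventually (gt_mem_nhds (hz i).2)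
  filter_upwards [nhdsWithin_le_nhds this, self_mem_nhdsWithin] with y h1 h2 i
  exact ⟨h2 i, h1 i⟩

/-- A cutoff that vanishes near the vertices extends functions from `triStar` to `tri`. -/
theorem continuousOn_cutoff_smul {E : Type*} [NormedAddCommGroup E] [NormedSpace ℝ E]
    {χ : ℂ → ℝ} {ε : ℝ} (hε : 0 < ε) (hχ : Continuous χ) (hrot : ∀ z, χ (rot z) = χ z)
    (h0 : ∀ z, ‖z‖ ≤ ε → χ z = 0) {l : ℂ → E} (hl : ContinuousOn l triStar) :
    ContinuousOn (fun z => χ z • l z) tri := by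
  have hv : ∀ k : ℂ → ℂ, Continuous k → (∀ z, χ (k z) = χ z) → ∀ z, k z = 0 →
      ContinuousAt (fun z => χ z • l z) z := by
    intro k hk hinv z hz
    have : (fun z => χ z • l z) =ᶠ[𝓝 z] fun _ => 0 := by
      have : k ⁻¹' ball 0 ε ∈ 𝓝 z :=
        hk.continuousAt.preimage_mem_nhds (by rw [hz]; exact ball_mem_nhds _ hε)
      filter_upwards [this] with y hy
      rw [← hinv y, h0 _ (mem_ball_zero_iff.1 hy).le, zero_smul]
    exact continuousAt_const.congr this.symm
  intro z hz
  by_cases a : z = 0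
  · exact (hv id continuous_id (fun _ => rfl) z a).continuousWithinAt
  by_cases b : rot z = 0
  · exact (hv rot continuous_rot hrot z b).continuousWithinAt
  by_cases c : rot (rot z) = 0
  · exact (hv (rot ∘ rot) (continuous_rot.comp continuous_rot)
      (fun z => by simp [hrot]) z c).continuousWithinAt
  have hs := mem_triStar_of_ne hz a b c
  exact hχ.continuousWithinAt.smul
    ((hl z hs).mono_of_mem_nhdsWithin (triStar_mem_nhdsWithin hs))

end Cutoff

end HiggsComplex

namespace HiggsComplex

open MeasureTheory Set Filter Topology Metric

/-! ### Integration by parts for balanced families of forms -/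

section BalancedFields

/-- The product rule for the divergence of a form times a cutoff, in bounded form. -/
theorem cutoff_form_derivative {l : ℂ → PlaneHom ℝ} {l' : ℂ → PlaneHom (PlaneHom ℝ)}
    (hl : ContinuousOn l triStar) (hl' : ContinuousOn l' triStar)
    (hd : ∀ z ∈ triInt, HasFDerivAt l (l' z) z) {χ : ℂ → ℝ} {ε : ℝ} (hε : 0 < ε)
    (hχ : ContDiff ℝ 1 χ) (hrot : ∀ z, χ (rot z) = χ z) (h0 : ∀ z, ‖z‖ ≤ ε → χ z = 0) :
    (∀ z ∈ triInt, HasFDerivAt (fun z => χ z • l z)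
      (χ z • l' z + (fderiv ℝ χ z).smulRight (l z)) z) ∧
    ContinuousOn (fun z => χ z • l' z + (fderiv ℝ χ z).smulRight (l z)) triInt ∧
    ∃ C, ∀ z ∈ triInt, ‖χ z • l' z‖ ≤ C ∧ ‖(fderiv ℝ χ z).smulRight (l z)‖ ≤ C := by
  have hsub := triInt_subset_triStar
  have hcf : Continuous (fderiv ℝ χ) := hχ.continuous_fderiv one_ne_zero
  have hcs : ContinuousOn (fun z => (fderiv ℝ χ z).smulRight (l z)) triStar :=
    ((ContinuousLinearMap.smulRightL ℝ ℂ (PlaneHom ℝ)).continuous.comp hcf).continuousOn.clm_apply hl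
  refine ⟨fun z hz => ?_, ?_, ?_⟩
  · exact (hχ.differentiable one_ne_zero z).hasFDerivAt.smul (hd z hz)
  · exact ((hχ.continuous.continuousOn.smul hl').add hcs).mono hsub
  -- `K` is the part of the triangle at distance at least ε from the vertices. It is compact inside
  -- `triStar`, where everything is continuous; on the rest of the open triangle the cutoff and its
  -- differential vanish.
  · set K : Set ℂ := tri ∩ ({z | ε ≤ ‖z‖} ∩ ({z | ε ≤ ‖rot z‖} ∩ {z | ε ≤ ‖rot (rot z)‖})) with hKdef
    have hK : IsCompact K := by
      refine isCompact_tri.inter_right (IsClosed.inter ?_ (IsClosed.inter ?_ ?_))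
      · exact isClosed_le continuous_const continuous_norm
      · exact isClosed_le continuous_const (continuous_norm.comp continuous_rot)
      · exact isClosed_le continuous_const
          (continuous_norm.comp (continuous_rot.comp continuous_rot))
    have hKs : K ⊆ triStar := by
      rintro z ⟨hz, a, b, c⟩
      exact mem_triStar_of_ne hz (norm_pos_iff.1 (hε.trans_le a)) (norm_pos_iff.1 (hε.trans_le b))
        (norm_pos_iff.1 (hε.trans_le c))
    obtain ⟨C₁, hC₁⟩ := hK.exists_bound_of_continuousOn
      ((hχ.continuous.continuousOn.smul hl').mono hKs)
    obtain ⟨C₂, hC₂⟩ := hK.exists_bound_of_continuousOn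
      (f := fun z => (fderiv ℝ χ z).smulRight (l z)) (hcs.mono hKs)
    have hv : ∀ k : ℂ → ℂ, Continuous k → (∀ z, χ (k z) = χ z) → ∀ z, ‖k z‖ < ε →
        χ z = 0 ∧ fderiv ℝ χ z = 0 := by
      intro k hk hinv z hz
      have : χ =ᶠ[𝓝 z] fun _ => 0 := by
        filter_upwards [(isOpen_lt (continuous_norm.comp hk) continuous_const).mem_nhds hz]
          with y hy
        rw [← hinv y]; exact h0 _ (le_of_lt hy)
      refine ⟨this.eq_of_nhds, ?_⟩
      rw [this.fderiv_eq]; simp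
    refine ⟨max C₁ C₂ ⊔ 0, fun z hz => ?_⟩
    by_cases hzK : z ∈ K
    · exact ⟨(hC₁ z hzK).trans (by simp), (hC₂ z hzK).trans (by simp)⟩
    · have : χ z = 0 ∧ fderiv ℝ χ z = 0 := by
        by_cases a : ε ≤ ‖z‖
        · by_cases b : ε ≤ ‖rot z‖
          · have c : ¬ ε ≤ ‖rot (rot z)‖ := fun c => hzK ⟨triInt_subset_tri hz, a, b, c⟩
            exact hv (rot ∘ rot) (continuous_rot.comp continuous_rot) (fun z => by simp [hrot]) z
              (not_le.1 c)
          · exact hv rot continuous_rot hrot z (not_le.1 b)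
        · exact hv id continuous_id (fun _ => rfl) z (not_le.1 a)
      have e : (0 : PlaneHom ℝ).smulRight (l z) = 0 := by ext; simp
      rw [this.1, this.2, zero_smul, e, norm_zero]
      exact ⟨le_max_right _ _, le_max_right _ _⟩

variable {ι : Type*} [Fintype ι] {s : ι → ι} {l : ι → ℂ → PlaneHom ℝ}
  {l' : ι → ℂ → PlaneHom (PlaneHom ℝ)}

/-- The boundary terms in Green's formula cancel for balanced families of forms. -/
theorem sum_integral_cutoff_div (hs : ∀ i, s (s (s i)) = i)
    (hl : ∀ i, ContinuousOn (l i) triStar) (hl' : ∀ i, ContinuousOn (l' i) triStar)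
    (hd : ∀ i, ∀ z ∈ triInt, HasFDerivAt (l i) (l' i z) z)
    (hrot : ∀ i, ∀ z ∈ triStar, ∀ v, l i (rot z) (zeta * v) = l (s i) z v)
    (hbal : ∀ x : ℝ, 0 < x → x < 1 → ∑ i, l i x Complex.I = 0)
    {χ : ℂ → ℝ} {ε : ℝ} (hε : 0 < ε)
    (hχ : ContDiff ℝ 1 χ) (hχrot : ∀ z, χ (rot z) = χ z) (h0 : ∀ z, ‖z‖ ≤ ε → χ z = 0) :
    (∀ i, IntegrableOn (fun z => χ z * (l' i z 1 1 + l' i z Complex.I Complex.I)) triInt) ∧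
    (∀ i, IntegrableOn (fun z => fderiv ℝ χ z 1 * l i z 1 +
      fderiv ℝ χ z Complex.I * l i z Complex.I) triInt) ∧
    ∑ i, ∫ z in triInt, χ z * (l' i z 1 1 + l' i z Complex.I Complex.I) =
      - ∑ i, ∫ z in triInt, (fderiv ℝ χ z 1 * l i z 1 + fderiv ℝ χ z Complex.I * l i z Complex.I) := by
  have hcut := fun i => cutoff_form_derivative (hl i) (hl' i) (hd i) hε hχ hχrot h0
  have hcont := fun i => continuousOn_cutoff_smul hε hχ.continuous hχrot h0 (hl i)
  choose C hC using fun i => (hcut i).2.2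
  have hnn : ∀ (T : PlaneHom (PlaneHom ℝ)) (K : ℝ) (v : ℂ), ‖v‖ = 1 → ‖T‖ ≤ K → |T v v| ≤ K := by
    intro T K v hv hT
    have := (T v).le_of_opNorm_le (T.le_of_opNorm_le hT v) v
    rwa [hv, mul_one, mul_one] at this
  have i1 : ∀ i, IntegrableOn (fun z => χ z * (l' i z 1 1 + l' i z Complex.I Complex.I)) triInt := by
    intro i
    refine integrableOn_triInt (C := C i + C i) ?_ ?_
    · have := (hl' i).mono triInt_subset_triStar
      exact hχ.continuous.continuousOn.mul
        (((this.clm_apply continuousOn_const).clm_apply continuousOn_const).add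
        ((this.clm_apply continuousOn_const).clm_apply continuousOn_const))
    · intro z hz
      have a := hnn _ _ 1 (by simp) (hC i z hz).1
      have b := hnn _ _ Complex.I (by simp) (hC i z hz).1
      simp only [_root_.smul_apply, smul_eq_mul] at a b
      rw [mul_add]
      exact (abs_add_le _ _).trans (add_le_add a b)
  have i2 : ∀ i, IntegrableOn (fun z => fderiv ℝ χ z 1 * l i z 1 +
      fderiv ℝ χ z Complex.I * l i z Complex.I) triInt := by
    intro i
    have hcf : ContinuousOn (fderiv ℝ χ) triInt := (hχ.continuous_fderiv one_ne_zero).continuousOn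
    refine integrableOn_triInt (C := C i + C i) ?_ ?_
    · have := (hl i).mono triInt_subset_triStar
      exact ((hcf.clm_apply continuousOn_const).mul (this.clm_apply continuousOn_const)).add
        ((hcf.clm_apply continuousOn_const).mul (this.clm_apply continuousOn_const))
    · intro z hz
      have a := hnn _ _ 1 (by simp) (hC i z hz).2
      have b := hnn _ _ Complex.I (by simp) (hC i z hz).2
      simp only [ContinuousLinearMap.smulRight_apply, _root_.smul_apply,
        smul_eq_mul] at a b
      exact (abs_add_le _ _).trans (add_le_add a b)
  refine ⟨i1, i2, ?_⟩
  have hgreen := fun i => green_triangle (C := C i + C i) (hcont i) (hcut i).1 (hcut i).2.1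
    (fun z hz => (norm_add_le _ _).trans (add_le_add (hC i z hz).1 (hC i z hz).2))
  have hsplit : ∀ i, ∫ z in triInt, ((χ z • l' i z + (fderiv ℝ χ z).smulRight (l i z)) 1 1 +
      (χ z • l' i z + (fderiv ℝ χ z).smulRight (l i z)) Complex.I Complex.I) =
      (∫ z in triInt, χ z * (l' i z 1 1 + l' i z Complex.I Complex.I)) +
      ∫ z in triInt, (fderiv ℝ χ z 1 * l i z 1 + fderiv ℝ χ z Complex.I * l i z Complex.I) := by
    intro i
    rw [← integral_add (i1 i) (i2 i)]
    refine integral_congr_ae (Eventually.of_forall fun z => ?_)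
    simp only [_root_.add_apply, ContinuousLinearMap.smulRight_apply,
      _root_.smul_apply, smul_eq_mul]
    ring
  -- Neither the forms nor the balancing condition are controlled at the endpoints of an edge; the
  -- cutoff removes these points.
  have hend : ∀ x ∈ uIcc (0 : ℝ) 1, ¬ (0 < x ∧ x < 1) → χ x = 0 := by
    intro x hx hcon
    rw [uIcc_of_le zero_le_one] at hx
    rcases eq_or_lt_of_le hx.1 with h | h
    · rw [← h]; exact h0 _ (by simpa using hε.le)
    rcases eq_or_lt_of_le hx.2 with h' | h'
    · have : rot (rot ((1 : ℝ) : ℂ)) = 0 := by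
        simp only [rot, Complex.ofReal_one, mul_one]
        linear_combination zeta_sum
      rw [h', ← hχrot, ← hχrot, this]
      exact h0 _ (by simpa using hε.le)
    · exact absurd ⟨h, h'⟩ hcon
  -- The flux through the second side in the cell `i` is the flux through the first side in the cell
  -- `s i`; likewise the third side belongs to `s (s i)`.
  have b1 : ∀ i, ∫ x in (0 : ℝ)..1, (χ (rot x) • l i (rot x)) (zeta * Complex.I) =
      ∫ x in (0 : ℝ)..1, (χ x • l (s i) x) Complex.I := by
    intro i
    refine intervalIntegral.integral_congr fun x hx => ?_
    simp only [_root_.smul_apply, smul_eq_mul, hχrot]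
    by_cases h : 0 < x ∧ x < 1
    · rw [hrot i _ (ofReal_mem_triStar h.1 h.2)]
    · rw [hend x hx h, zero_mul, zero_mul]
  have b2 : ∀ i, ∫ x in (0 : ℝ)..1, (χ (rot (rot x)) • l i (rot (rot x)))
      (zeta * (zeta * Complex.I)) = ∫ x in (0 : ℝ)..1, (χ x • l (s (s i)) x) Complex.I := by
    intro i
    refine intervalIntegral.integral_congr fun x hx => ?_
    simp only [_root_.smul_apply, smul_eq_mul, hχrot]
    by_cases h : 0 < x ∧ x < 1
    · have := ofReal_mem_triStar h.1 h.2
      rw [hrot i _ (rot_mem_triStar.2 this), hrot _ _ this]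
    · rw [hend x hx h, zero_mul, zero_mul]
  have hzero : ∑ i, ∫ x in (0 : ℝ)..1, (χ x • l i x) Complex.I = 0 := by
    rw [← intervalIntegral.integral_finsetSum]
    · have : ∀ x ∈ uIcc (0 : ℝ) 1, ∑ i, (χ x • l i x) Complex.I = 0 := by
        intro x hx
        simp only [_root_.smul_apply, smul_eq_mul, ← Finset.mul_sum]
        by_cases h : 0 < x ∧ x < 1
        · rw [hbal x h.1 h.2, mul_zero]
        · rw [hend x hx h, zero_mul]
      rw [intervalIntegral.integral_congr this]
      simp
    · intro i _
      refine ContinuousOn.intervalIntegrable ?_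
      rw [uIcc_of_le zero_le_one]
      exact ((hcont i).clm_apply continuousOn_const).comp Complex.continuous_ofReal.continuousOn
        fun x hx => ofReal_mem_tri hx.1 hx.2
  -- Since `s` permutes the cells, the sums over second and third sides are the sum over first sides
  -- again, which is zero by balance.
  have hbij : Function.Bijective s :=
    ⟨fun a b h => by rw [← hs a, ← hs b, h], fun b => ⟨s (s b), hs b⟩⟩
  have z1 : ∑ i, ∫ x in (0 : ℝ)..1, (χ x • l (s i) x) Complex.I = 0 := by
    refine Eq.trans ?_ hzero
    exact hbij.sum_comp (fun i => ∫ x in (0 : ℝ)..1, (χ x • l i x) Complex.I)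
  have z2 : ∑ i, ∫ x in (0 : ℝ)..1, (χ x • l (s (s i)) x) Complex.I = 0 := by
    refine Eq.trans ?_ hzero
    exact (hbij.comp hbij).sum_comp (fun i => ∫ x in (0 : ℝ)..1, (χ x • l i x) Complex.I)
  rw [eq_neg_iff_add_eq_zero, ← Finset.sum_add_distrib]
  simp_rw [← hsplit, hgreen, b1, b2]
  rw [Finset.sum_neg_distrib, Finset.sum_add_distrib, Finset.sum_add_distrib, hzero, z1, z2]
  simp

/-- A balanced family of forms of class `L²` with nonnegative divergence is divergence free. -/
theorem div_eq_zero_of_balanced (hs : ∀ i, s (s (s i)) = i)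
    (hl : ∀ i, ContinuousOn (l i) triStar) (hl' : ∀ i, ContinuousOn (l' i) triStar)
    (hd : ∀ i, ∀ z ∈ triInt, HasFDerivAt (l i) (l' i z) z)
    (hrot : ∀ i, ∀ z ∈ triStar, ∀ v, l i (rot z) (zeta * v) = l (s i) z v)
    (hbal : ∀ x : ℝ, 0 < x → x < 1 → ∑ i, l i x Complex.I = 0)
    (hL2 : ∀ i, IntegrableOn (fun z => ‖l i z‖ ^ 2) (triInt ∩ ball 0 (3 / 4)))
    (hpos : ∀ i, ∀ z ∈ triInt, 0 ≤ l' i z 1 1 + l' i z Complex.I Complex.I)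
    (i₀ : ι) {z₀ : ℂ} (hz₀ : z₀ ∈ triInt) :
    l' i₀ z₀ 1 1 + l' i₀ z₀ Complex.I Complex.I = 0 := by
  obtain ⟨M, hM, hcut⟩ := exists_cutoff
  set q : ι → ℂ → ℝ := fun i z => l' i z 1 1 + l' i z Complex.I Complex.I with hq
  set a : ι → ℝ → ℝ := fun i ε => ∫ z in triInt ∩ closedBall 0 (2 * ε), ‖l i z‖ ^ 2 with ha
  have hnorm : ∀ i, ∀ z ∈ triStar, ‖l (s i) z‖ = ‖l i (rot z)‖ := by
    intro i z hz
    apply le_antisymm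
    · refine ContinuousLinearMap.opNorm_le_bound _ (norm_nonneg _) fun v => ?_
      rw [← hrot i z hz]
      refine ((l i (rot z)).le_opNorm _).trans ?_
      rw [norm_mul, norm_zeta, one_mul]
    · refine ContinuousLinearMap.opNorm_le_bound _ (norm_nonneg _) fun v => ?_
      have hv : v = zeta * (zeta * zeta * v) := by linear_combination (-v) * zeta_cube
      conv_lhs => rw [hv]
      rw [hrot i z hz]
      refine ((l (s i) z).le_opNorm _).trans ?_
      rw [norm_mul, norm_mul, norm_zeta, one_mul, one_mul]
  -- The error from the cutoff is an integral of |dχ| |l| over discs of radius 2ε at the vertices. A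
  -- weighted AM–GM inequality with a free parameter η splits it: |dχ|² ≲ 1/ε² over an area of at
  -- most 4πε² contributes 4πη, and the rest is the energy of `l` in the disc with weight M²/η. The
  -- factor 3 counts the vertices.
  have est : ∀ ε η : ℝ, 0 < ε → ε ≤ 1 / 4 → 0 < η → ∃ χ : ℂ → ℝ,
      (∀ z, 2 * ε ≤ ‖z‖ → 2 * ε ≤ ‖rot z‖ → 2 * ε ≤ ‖rot (rot z)‖ → χ z = 1) ∧
      (∀ z, 0 ≤ χ z) ∧ (∀ i, IntegrableOn (fun z => χ z * q i z) triInt) ∧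
      ∑ i, ∫ z in triInt, χ z * q i z ≤
        3 * ∑ i, (4 * Real.pi * η + M ^ 2 / η * a i ε) := by
    intro ε η hε hε1 hη
    obtain ⟨χ, hχ, h01, hχrot, h0, h1, hb⟩ := hcut ε hε
    obtain ⟨hint, hint', heq⟩ := sum_integral_cutoff_div hs hl hl' hd hrot hbal hε hχ hχrot h0
    refine ⟨χ, h1, fun z => (h01 z).1, hint, ?_⟩
    set B := closedBall (0 : ℂ) (2 * ε) with hB
    set Q : ι → ℂ → ℝ := fun i => B.indicator fun z => η / ε ^ 2 + M ^ 2 / η * ‖l i z‖ ^ 2 with hQ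
    have hBm : MeasurableSet B := isClosed_closedBall.measurableSet
    have hvolB : volume B ≠ ⊤ := (isCompact_closedBall (0 : ℂ) (2 * ε)).measure_lt_top.ne
    have hL2B : ∀ i, IntegrableOn (fun z => ‖l i z‖ ^ 2) (triInt ∩ B) := fun i =>
      (hL2 i).mono_set (inter_subset_inter_right _ (closedBall_subset_ball (by linarith)))
    have hconst : IntegrableOn (fun _ : ℂ => η / ε ^ 2) (triInt ∩ B) :=
      integrableOn_const (measure_ne_top_of_subset inter_subset_right hvolB)
    have hQint : ∀ i, IntegrableOn (Q i) triInt := by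
      intro i
      rw [hQ, integrableOn_indicator_iff hBm, inter_comm]
      exact hconst.add ((hL2B i).const_mul _)
    have hQval : ∀ i, ∫ z in triInt, Q i z ≤ 4 * Real.pi * η + M ^ 2 / η * a i ε := by
      intro i
      rw [hQ, setIntegral_indicator hBm, integral_add hconst ((hL2B i).const_mul _),
        integral_const_mul, setIntegral_const]
      refine add_le_add ?_ le_rfl
      have hv : volume.real (triInt ∩ B) ≤ Real.pi * (2 * ε) ^ 2 := by
        refine (measureReal_mono inter_subset_right hvolB).trans ?_
        rw [Measure.real, hB, Complex.volume_closedBall]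
        simp only [ENNReal.toReal_mul, ENNReal.toReal_pow, ENNReal.coe_toReal, NNReal.coe_real_pi]
        rw [ENNReal.toReal_ofReal (by positivity), mul_comm]
      rw [smul_eq_mul]
      calc volume.real (triInt ∩ B) * (η / ε ^ 2) ≤ Real.pi * (2 * ε) ^ 2 * (η / ε ^ 2) :=
            mul_le_mul_of_nonneg_right hv (by positivity)
        _ = 4 * Real.pi * η := by field_simp; ring
    -- The factor 2 provides for the two directions 1 and i; the difference of the two sides is a
    -- square divided by η.
    have hN : ∀ (i : ι) (z w : ℂ),
        2 * (B.indicator (fun _ => M / ε) z * ‖l i w‖) ≤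
          B.indicator (fun _ => η / ε ^ 2 + M ^ 2 / η * ‖l i w‖ ^ 2) z := by
      intro i z w
      by_cases hz : z ∈ B
      · rw [indicator_of_mem hz, indicator_of_mem hz]
        have : η / ε ^ 2 + M ^ 2 / η * ‖l i w‖ ^ 2 - 2 * (M / ε * ‖l i w‖) =
            (η / ε - M * ‖l i w‖) ^ 2 / η := by field_simp; ring
        have h2 : 0 ≤ (η / ε - M * ‖l i w‖) ^ 2 / η := by positivity
        linarith
      · rw [indicator_of_notMem hz, indicator_of_notMem hz]; simp
    -- The discs at the other two vertices are rotated to the disc at 0, in the charts of `s (s i)`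
    -- and `s i`; the norm of the form is unchanged.
    have hpt : ∀ i, ∀ z ∈ triInt,
        -(fderiv ℝ χ z 1 * l i z 1 + fderiv ℝ χ z Complex.I * l i z Complex.I) ≤
          Q i z + Q (s (s i)) (rot z) + Q (s i) (rot (rot z)) := by
      intro i z hz
      have hzs := triInt_subset_triStar hz
      have n0 : ‖l (s (s i)) (rot z)‖ = ‖l i z‖ := by
        rw [hnorm _ _ (rot_mem_triStar.2 hzs), hnorm _ _ (rot_mem_triStar.2 (rot_mem_triStar.2 hzs)),
          rot_rot_rot]
      have n1 : ‖l (s i) (rot (rot z))‖ = ‖l i z‖ := by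
        rw [hnorm _ _ (rot_mem_triStar.2 (rot_mem_triStar.2 hzs)), rot_rot_rot]
      have e0 := hN i z z
      have e1 := hN i (rot z) z
      have e2 := hN i (rot (rot z)) z
      have q1 : Q (s (s i)) (rot z) =
          B.indicator (fun _ => η / ε ^ 2 + M ^ 2 / η * ‖l i z‖ ^ 2) (rot z) := by
        simp only [hQ, indicator, n0]
      have q2 : Q (s i) (rot (rot z)) =
          B.indicator (fun _ => η / ε ^ 2 + M ^ 2 / η * ‖l i z‖ ^ 2) (rot (rot z)) := by
        simp only [hQ, indicator, n1]
      have q0 : Q i z = B.indicator (fun _ => η / ε ^ 2 + M ^ 2 / η * ‖l i z‖ ^ 2) z := by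
        simp only [hQ, indicator]
      rw [q0, q1, q2]
      have hv : ∀ v : ℂ, ‖v‖ = 1 → -(fderiv ℝ χ z v * l i z v) ≤ ‖fderiv ℝ χ z‖ * ‖l i z‖ := by
        intro v hv
        have c1 := (fderiv ℝ χ z).le_opNorm v
        have c2 := (l i z).le_opNorm v
        rw [hv, mul_one] at c1 c2
        refine (neg_le_abs _).trans ?_
        rw [abs_mul]
        exact mul_le_mul c1 c2 (abs_nonneg _) (norm_nonneg _)
      have hbz := mul_le_mul_of_nonneg_right (hb z) (norm_nonneg (l i z))
      linarith [hv 1 (by simp), hv Complex.I (by simp)]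
    have hpre : rot ⁻¹' triInt = triInt := by ext z; exact rot_mem_triInt
    have hcomp : ∀ f : ℂ → ℝ, IntegrableOn f triInt → IntegrableOn (fun z => f (rot z)) triInt := by
      intro f hf
      have := (measurePreserving_rot.integrableOn_comp_preimage measurableEmbedding_rot
        (f := f) (s := triInt)).2 hf
      rwa [hpre] at this
    have hle : ∀ i, -∫ z in triInt, (fderiv ℝ χ z 1 * l i z 1 + fderiv ℝ χ z Complex.I * l i z Complex.I) ≤
        (∫ z in triInt, Q i z) + (∫ z in triInt, Q (s (s i)) z) + ∫ z in triInt, Q (s i) z := by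
      intro i
      have c1 := hcomp _ (hQint (s (s i)))
      have c2 := hcomp _ (hcomp _ (hQint (s i)))
      have c3 : IntegrableOn (fun z => Q i z + Q (s (s i)) (rot z)) triInt := (hQint i).add c1
      rw [← setIntegral_triInt_rot (Q (s (s i))), ← setIntegral_triInt_rot (Q (s i)),
        ← setIntegral_triInt_rot (fun z => Q (s i) (rot z)), ← integral_add (hQint i) c1,
        ← integral_add c3 c2, ← integral_neg]
      exact setIntegral_mono_on (hint' i).neg (c3.add c2) measurableSet_triInt (hpt i)
    have hbij : Function.Bijective s :=
      ⟨fun a b h => by rw [← hs a, ← hs b, h], fun b => ⟨s (s b), hs b⟩⟩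
    have z1 : ∑ i, ∫ z in triInt, Q (s i) z = ∑ i, ∫ z in triInt, Q i z :=
      hbij.sum_comp (fun i => ∫ z in triInt, Q i z)
    have z2 : ∑ i, ∫ z in triInt, Q (s (s i)) z = ∑ i, ∫ z in triInt, Q i z :=
      (hbij.comp hbij).sum_comp (fun i => ∫ z in triInt, Q i z)
    rw [heq, ← Finset.sum_neg_distrib]
    refine (Finset.sum_le_sum fun i _ => hle i).trans ?_
    rw [Finset.sum_add_distrib, Finset.sum_add_distrib, z1, z2]
    have := Finset.sum_le_sum fun i (_ : i ∈ Finset.univ) => hQval i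
    linarith
  by_contra hne
  have hc : 0 < q i₀ z₀ := lt_of_le_of_ne (hpos i₀ z₀ hz₀) (Ne.symm hne)
  have hqc : ContinuousOn (q i₀) triInt := by
    have := (hl' i₀).mono triInt_subset_triStar
    exact ((this.clm_apply continuousOn_const).clm_apply continuousOn_const).add
      ((this.clm_apply continuousOn_const).clm_apply continuousOn_const)
  have hev : ∀ᶠ z in 𝓝 z₀, z ∈ triInt ∧ q i₀ z₀ / 2 < q i₀ z :=
    (isOpen_triInt.eventually_mem hz₀).and
      ((hqc.continuousAt (isOpen_triInt.mem_nhds hz₀)).eventually (lt_mem_nhds (by linarith)))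
  obtain ⟨ρ₀, hρ₀, hball⟩ := Metric.eventually_nhds_iff_ball.1 hev
  have hz1 := rot_mem_triInt.2 hz₀
  have p0 := norm_pos_iff.2 (ne_zero_of_mem_triInt hz₀)
  have p1 := norm_pos_iff.2 (ne_zero_of_mem_triInt hz1)
  have p2 := norm_pos_iff.2 (ne_zero_of_mem_triInt (rot_mem_triInt.2 hz1))
  -- The radius is at most half the distance from `z₀` to each vertex, so every point of the ball is
  -- at distance at least ρ from the vertices, and the cutoff is 1 on it once 2ε ≤ ρ.
  obtain ⟨ρ, hρ, hle⟩ : ∃ ρ > 0, ρ ≤ ρ₀ ∧ ρ ≤ ‖z₀‖ / 2 ∧ ρ ≤ ‖rot z₀‖ / 2 ∧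
      ρ ≤ ‖rot (rot z₀)‖ / 2 :=
    ⟨min (min ρ₀ (‖z₀‖ / 2)) (min (‖rot z₀‖ / 2) (‖rot (rot z₀)‖ / 2)), by positivity,
      by simp, by simp, by simp, by simp⟩
  set m := q i₀ z₀ / 2 * volume.real (ball z₀ ρ) with hm
  have hvol : 0 < volume.real (ball z₀ ρ) :=
    ENNReal.toReal_pos (measure_ball_pos volume z₀ hρ).ne' measure_ball_lt_top.ne
  have hmpos : 0 < m := by positivity
  have lower : ∀ ε η : ℝ, 0 < ε → ε ≤ 1 / 4 → 2 * ε ≤ ρ → 0 < η →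
      m ≤ 3 * ∑ i, (4 * Real.pi * η + M ^ 2 / η * a i ε) := by
    intro ε η hε hε1 hερ hη
    obtain ⟨χ, h1, hχ0, hint, hest⟩ := est ε η hε hε1 hη
    refine le_trans ?_ hest
    have hnonneg : ∀ i, 0 ≤ ∫ z in triInt, χ z * q i z := fun i =>
      setIntegral_nonneg measurableSet_triInt fun z hz => mul_nonneg (hχ0 z) (hpos i z hz)
    refine le_trans ?_ (Finset.single_le_sum (fun i _ => hnonneg i) (Finset.mem_univ i₀))
    have hBs : ball z₀ ρ ⊆ triInt := fun z hz => (hball z (ball_subset_ball hle.1 hz)).1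
    have h2 : ∫ z in ball z₀ ρ, χ z * q i₀ z ≤ ∫ z in triInt, χ z * q i₀ z :=
      setIntegral_mono_set (hint i₀)
        ((ae_restrict_iff' measurableSet_triInt).2 (Eventually.of_forall fun z hz =>
          mul_nonneg (hχ0 z) (hpos i₀ z hz))) hBs.eventuallyLE
    refine le_trans ?_ h2
    have h3 : m = ∫ _ in ball z₀ ρ, q i₀ z₀ / 2 := by
      rw [setIntegral_const, smul_eq_mul, mul_comm]
    rw [h3]
    refine setIntegral_mono_on (integrableOn_const measure_ball_lt_top.ne)
      ((hint i₀).mono_set hBs) isOpen_ball.measurableSet fun z hz => ?_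
    have hd0 : ‖z - z₀‖ < ρ := mem_ball_iff_norm.1 hz
    have hd1 : ‖rot z - rot z₀‖ < ρ := by rwa [rot_sub, norm_mul, norm_zeta, one_mul]
    have hd2 : ‖rot (rot z) - rot (rot z₀)‖ < ρ := by rwa [rot_sub, norm_mul, norm_zeta, one_mul]
    have tri : ∀ x y : ℂ, ‖x - y‖ < ρ → ρ ≤ ‖y‖ / 2 → 2 * ε ≤ ‖x‖ := by
      intro x y hxy hy
      have := norm_sub_norm_le y x
      rw [norm_sub_rev] at this
      linarith
    rw [h1 z (tri _ _ hd0 hle.2.1) (tri _ _ hd1 hle.2.2.1) (tri _ _ hd2 hle.2.2.2), one_mul]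
    exact (hball z (ball_subset_ball hle.1 hz)).2.le
  -- The scales stay at most 1/8, so the discs of radius `2 * e n` remain in the region `‖z‖ < 3 /
  -- 4` where square integrability is assumed.
  let e : ℕ → ℝ := fun n => 1 / (8 * ((n : ℝ) + 1))
  have he0 : ∀ n, 0 < e n := fun n => by positivity
  have hemono : Antitone e := fun m n hmn => by
    apply one_div_le_one_div_of_le (by positivity)
    have : (m : ℝ) ≤ n := by exact_mod_cast hmn
    linarith
  have he1 : ∀ n, e n ≤ 1 / 8 := fun n => by
    simpa [e] using hemono (Nat.zero_le n)
  have hetend : Tendsto e atTop (𝓝 0) :=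
    tendsto_const_nhds.div_atTop (Tendsto.const_mul_atTop (by norm_num)
      (tendsto_natCast_atTop_atTop.atTop_add tendsto_const_nhds))
  -- The discs shrink to the vertex 0, which is not in the open triangle, so the energy in them
  -- tends to zero.
  have hatend : ∀ i, Tendsto (fun n => a i (e n)) atTop (𝓝 0) := by
    intro i
    have h := tendsto_setIntegral_of_antitone (μ := volume) (f := fun z => ‖l i z‖ ^ 2)
      (s := fun n => triInt ∩ closedBall 0 (2 * e n))
      (fun n => measurableSet_triInt.inter isClosed_closedBall.measurableSet)
      (fun m n hmn => inter_subset_inter_right _ (closedBall_subset_closedBall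
        (by linarith [hemono hmn])))
      ⟨0, (hL2 i).mono_set (inter_subset_inter_right _ (closedBall_subset_ball
        (by linarith [he1 0])))⟩
    have hemp : ⋂ n, (triInt ∩ closedBall (0 : ℂ) (2 * e n)) = ∅ := by
      rw [eq_empty_iff_forall_notMem]
      intro z hz
      rw [mem_iInter] at hz
      have h0 := ne_zero_of_mem_triInt (hz 0).1
      have h2 : ‖z‖ ≤ 2 * 0 := ge_of_tendsto' (hetend.const_mul 2) fun n => by
        simpa using (hz n).2
      exact h0 (norm_le_zero_iff.1 (by linarith))
    rw [hemp] at h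
    simpa using h
  set N : ℝ := (Fintype.card ι : ℝ) with hN
  have hN0 : 0 ≤ N := Nat.cast_nonneg _
  have hpi := Real.pi_pos
  -- With this η the limiting upper bound 12πNη equals m − η, which is less than the lower bound m.
  set η := m / (12 * Real.pi * N + 1) with hη
  have hη0 : 0 < η := by positivity
  have hlim : Tendsto (fun n => 3 * ∑ i, (4 * Real.pi * η + M ^ 2 / η * a i (e n))) atTop
      (𝓝 (3 * ∑ i : ι, (4 * Real.pi * η + M ^ 2 / η * 0))) :=
    (tendsto_finsetSum _ fun i _ => ((hatend i).const_mul _).const_add _).const_mul _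
  have hge : m ≤ 3 * ∑ i : ι, (4 * Real.pi * η + M ^ 2 / η * 0) := by
    refine ge_of_tendsto hlim ?_
    filter_upwards [hetend.eventually (gt_mem_nhds (half_pos hρ))] with n hn
    exact lower (e n) η (he0 n) ((he1 n).trans (by norm_num)) (by linarith) hη0
  rw [Finset.sum_const, Finset.card_univ, nsmul_eq_mul, ← hN] at hge
  have : 3 * (N * (4 * Real.pi * η + M ^ 2 / η * 0)) = m - η := by
    rw [hη]; field_simp; ring
  linarith

end BalancedFields

end HiggsComplex

namespace HiggsComplex

open MeasureTheory Set Filter Topology Metric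

/-! ### Lifting 2-cells and the stars of edges to the universal cover -/

section Covering

variable {V W : Type*} {X : AbstractSimplicialComplex V} {Y : AbstractSimplicialComplex W}
  {p : W → V}

theorem face_of_subset {K : AbstractSimplicialComplex V} {s t : Finset V} (hs : s ∈ K.faces)
    (hts : t ⊆ s) (ht : t.Nonempty) : t ∈ K.faces :=
  (K.isRelLowerSet_faces hs).2 hts ht

/-- If distinct vertices `a`, `b` of a simplex had the same image, `{a, b}` and `{a}` would be two
lifts through `a` of the simplex `{p a}`. -/
theorem IsUniversalCover.injOn (hp : IsUniversalCover Y X p) {t : Finset W} (ht : t ∈ Y.faces) :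
    InjOn p t := by
  classical
  intro a ha b hb hab
  by_contra hne
  have h1 : ({a, b} : Finset W) ∈ Y.faces := by
    refine face_of_subset ht ?_ ⟨a, by simp⟩
    intro x hx
    simp only [Finset.mem_insert, Finset.mem_singleton] at hx
    rcases hx with rfl | rfl
    · exact ha
    · exact hb
  obtain ⟨u, -, hu⟩ := hp.lift_face a {p a} (X.singleton_mem _) (by simp)
  have e1 := hu {a, b} ⟨h1, by simp, by simp [image_pair, hab]⟩
  have e2 := hu {a} ⟨Y.singleton_mem a, by simp, by simp⟩
  have : b ∈ ({a} : Finset W) := by rw [e2, ← e1]; simp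
  exact hne (Finset.mem_singleton.1 this).symm

theorem IsUniversalCover.isTri_map (hp : IsUniversalCover Y X p) {σ : Fin 3 → W}
    (hσ : IsTri Y σ) : IsTri X (p ∘ σ) := by
  obtain ⟨hi, t, ht, hr⟩ := hσ
  obtain ⟨s, hs, hst⟩ := hp.map_face t ht
  refine ⟨fun i j hij => hi (hp.injOn ht ?_ ?_ hij), s, hs, ?_⟩
  · rw [hr]; exact mem_range_self i
  · rw [hr]; exact mem_range_self j
  · rw [hst, hr, range_comp]

/-- Ordered 2-cells through a point lift to any preimage of the point. -/
theorem IsUniversalCover.exists_lift_at (hp : IsUniversalCover Y X p) {τ : Fin 3 → V}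
    (hτ : IsTri X τ) (w : W) (hw : p w = τ 0) : ∃ σ, IsTri Y σ ∧ p ∘ σ = τ ∧ σ 0 = w := by
  obtain ⟨hi, s, hs, hr⟩ := hτ
  obtain ⟨t, ⟨ht, hwt, hts⟩, -⟩ := hp.lift_face w s hs (by
    rw [← Finset.mem_coe, hr, hw]; exact mem_range_self 0)
  have hex : ∀ i, ∃ a ∈ (t : Set W), p a = τ i := by
    intro i
    have : τ i ∈ p '' (t : Set W) := by rw [hts, hr]; exact mem_range_self i
    exact this
  choose σ hσ hpσ using hex
  have h0 : σ 0 = w := hp.injOn ht (hσ 0) hwt (by rw [hpσ, hw])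
  refine ⟨σ, ⟨fun i j hij => hi (by rw [← hpσ i, ← hpσ j, hij]), t, ht, ?_⟩, funext hpσ, h0⟩
  apply Subset.antisymm
  · intro a ha
    have : p a ∈ range τ := by rw [← hr, ← hts]; exact mem_image_of_mem p ha
    obtain ⟨i, hi'⟩ := this
    exact ⟨i, hp.injOn ht (hσ i) ha (by rw [hpσ, hi'])⟩
  · rintro _ ⟨i, rfl⟩; exact hσ i

theorem IsUniversalCover.exists_lift (hp : IsUniversalCover Y X p) {τ : Fin 3 → V}
    (hτ : IsTri X τ) : ∃ σ, IsTri Y σ ∧ p ∘ σ = τ := by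
  obtain ⟨w, hw⟩ := hp.surjective (τ 0)
  obtain ⟨σ, h1, h2, -⟩ := hp.exists_lift_at hτ w hw
  exact ⟨σ, h1, h2⟩

/-- A lift of an ordered simplex is determined by the lift of one vertex. -/
theorem IsUniversalCover.lift_unique (hp : IsUniversalCover Y X p) {σ σ' : Fin 3 → W}
    (hσ : IsTri Y σ) (hσ' : IsTri Y σ') (h : p ∘ σ = p ∘ σ') (h0 : σ 0 = σ' 0) : σ = σ' := by
  have hX := hp.isTri_map hσ
  obtain ⟨-, s, hs, hr⟩ := hX
  obtain ⟨-, t, ht, hrt⟩ := hσ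
  obtain ⟨-, t', ht', hrt'⟩ := hσ'
  obtain ⟨u, -, hu⟩ := hp.lift_face (σ 0) s hs (by
    rw [← Finset.mem_coe, hr]; exact ⟨0, rfl⟩)
  have e1 := hu t ⟨ht, by rw [← Finset.mem_coe, hrt]; exact ⟨0, rfl⟩, by
    rw [hrt, hr, range_comp]⟩
  have e2 := hu t' ⟨ht', by rw [← Finset.mem_coe, hrt', h0]; exact ⟨0, rfl⟩, by
    rw [hrt', hr, h, range_comp]⟩
  funext i
  refine hp.injOn ht ?_ ?_ (congrFun h i)
  · rw [hrt]; exact ⟨i, rfl⟩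
  · rw [e1, ← e2, hrt']; exact ⟨i, rfl⟩

/-- The two first edges are lifts, through a common vertex, of one edge of `X`. Hence all 2-cells at
an edge of `X` lift to 2-cells at one chosen lift of that edge. -/
theorem IsUniversalCover.edge_lift_unique (hp : IsUniversalCover Y X p) {σ σ' : Fin 3 → W}
    (hσ : IsTri Y σ) (hσ' : IsTri Y σ') (h0 : σ 0 = σ' 0) (h1 : p (σ 1) = p (σ' 1)) :
    σ 1 = σ' 1 := by
  classical
  obtain ⟨hi, t, ht, hrt⟩ := hσ
  obtain ⟨hi', t', ht', hrt'⟩ := hσ'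
  have face : ∀ {k : Fin 3 → W} {u : Finset W}, u ∈ Y.faces → (u : Set W) = range k →
      ({k 0, k 1} : Finset W) ∈ Y.faces := by
    intro k u hu hk
    refine face_of_subset hu ?_ ⟨k 0, by simp⟩
    intro x hx
    rw [← Finset.mem_coe, hk]
    simp only [Finset.mem_insert, Finset.mem_singleton] at hx
    rcases hx with rfl | rfl <;> exact mem_range_self _
  have f1 := face ht hrt
  have f2 := face ht' hrt'
  obtain ⟨s, hs, hps⟩ := hp.map_face _ f1
  obtain ⟨u, -, hu⟩ := hp.lift_face (σ 0) s hs (by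
    rw [← Finset.mem_coe, hps]; exact ⟨σ 0, by simp, rfl⟩)
  have e1 := hu _ ⟨f1, by simp, hps.symm⟩
  have e2 := hu _ ⟨f2, by simp [h0], by rw [hps]; simp [image_pair, h0, h1]⟩
  have : σ 1 ∈ ({σ' 0, σ' 1} : Finset W) := by rw [e2, ← e1]; simp
  simp only [Finset.mem_insert, Finset.mem_singleton] at this
  rcases this with h | h
  · exact absurd (hi (h.trans h0.symm)) (by decide)
  · exact h

theorem vec_eta {α : Type*} (σ : Fin 3 → α) : ![σ 0, σ 1, σ 2] = σ := by
  funext i; fin_cases i <;> rfl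

/-- The cover may be infinite, but uniqueness of lifts determines the third vertex by its image in
the finite set `V`. -/
theorem IsUniversalCover.finite_star [Finite V] (hp : IsUniversalCover Y X p) (a b : W) :
    {c | IsTri Y ![a, b, c]}.Finite := by
  refine Finite.of_injOn (f := p) (t := univ) (mapsTo_univ _ _) ?_ finite_univ
  intro c hc c' hc' h
  have := hp.lift_unique hc hc' (by funext i; fin_cases i <;> simp [h]) rfl
  exact congrFun this 2

/-- A sum over the ordered 2-cells of `X` vanishes if the sum over the 2-cells at each lifted
oriented edge does. -/
theorem IsUniversalCover.sum_eq_zero (hp : IsUniversalCover Y X p) [Finite V]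
    [Fintype {τ : Fin 3 → V // IsTri X τ}] (F : (Fin 3 → W) → ℝ)
    (hF : ∀ σ σ', IsTri Y σ → IsTri Y σ' → p ∘ σ = p ∘ σ' → F σ = F σ')
    (hbal : ∀ a b, ∑ᶠ c ∈ {c | IsTri Y ![a, b, c]}, F ![a, b, c] = 0)
    (lift : {τ : Fin 3 → V // IsTri X τ} → Fin 3 → W)
    (hlift : ∀ τ, IsTri Y (lift τ) ∧ p ∘ lift τ = τ.1) :
    ∑ τ, F (lift τ) = 0 := by
  classical
  have := Fintype.ofFinite V
  -- The cells are grouped by their first oriented edge. For each nonempty group, one member fixes a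
  -- lift of the edge, and the star of this lift corresponds bijectively to the group.
  rw [← Finset.sum_fiberwise Finset.univ
    (fun τ : {τ : Fin 3 → V // IsTri X τ} => (τ.1 0, τ.1 1))]
  refine Finset.sum_eq_zero fun ab _ => ?_
  rcases Finset.eq_empty_or_nonempty
    (Finset.univ.filter fun τ : {τ : Fin 3 → V // IsTri X τ} => (τ.1 0, τ.1 1) = ab) with h | h
  · rw [h, Finset.sum_empty]
  obtain ⟨τ₀, hτ₀⟩ := h
  rw [Finset.mem_filter] at hτ₀
  set a := lift τ₀ 0 with ha
  set b := lift τ₀ 1 with hb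
  have h0 : IsTri Y (lift τ₀) := (hlift τ₀).1
  have hpa : p a = ab.1 := by rw [← hτ₀.2]; exact congrFun (hlift τ₀).2 0
  have hpb : p b = ab.2 := by rw [← hτ₀.2]; exact congrFun (hlift τ₀).2 1
  have hS := hp.finite_star a b
  have hb0 := hbal a b
  rw [finsum_mem_eq_finite_toFinset_sum _ hS] at hb0
  rw [← hb0]
  symm
  refine Finset.sum_bij (fun c hc => ⟨p ∘ ![a, b, c], hp.isTri_map (hS.mem_toFinset.1 hc)⟩)
    ?_ ?_ ?_ ?_
  · intro c hc
    rw [Finset.mem_filter]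
    exact ⟨Finset.mem_univ _, Prod.ext hpa hpb⟩
  · intro c hc c' hc' h
    have := hp.lift_unique (hS.mem_toFinset.1 hc) (hS.mem_toFinset.1 hc') (Subtype.ext_iff.1 h) rfl
    exact congrFun this 2
  · intro τ hτ
    rw [Finset.mem_filter] at hτ
    have t0 : τ.1 0 = ab.1 := congrArg Prod.fst hτ.2
    have t1 : τ.1 1 = ab.2 := congrArg Prod.snd hτ.2
    obtain ⟨σ, hσ, hpσ, hσ0⟩ := hp.exists_lift_at τ.2 a (by rw [hpa, t0])
    have hσ1 : σ 1 = b := hp.edge_lift_unique hσ h0 hσ0 (by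
      change (p ∘ σ) 1 = p b
      rw [hpσ, t1, hpb])
    have e : ![a, b, σ 2] = σ := by rw [← hσ0, ← hσ1]; exact vec_eta σ
    refine ⟨σ 2, hS.mem_toFinset.2 (by change IsTri Y _; rw [e]; exact hσ), ?_⟩
    exact Subtype.ext (by change p ∘ ![a, b, σ 2] = τ.1; rw [e, hpσ])
  · intro c hc
    have hc' := hS.mem_toFinset.1 hc
    have hl := hlift ⟨p ∘ ![a, b, c], hp.isTri_map hc'⟩
    exact hF _ _ hc' hl.1 hl.2.symm

end Covering

end HiggsComplex

namespace HiggsComplex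

open MeasureTheory Set Filter Topology Metric

/-! ### Linear algebra for a Hermitian form and the variation identities -/

section HermitianAlgebra

variable {r : ℕ}

/-- The adjoint of an endomorphism with respect to the Hermitian form `h`. -/
def hAdj (h X : Mat r) : Mat r := h⁻¹ * Xᴴ * h

/-- The real inner product on endomorphisms induced by the Hermitian form `h`. -/
def hInner (h X Y : Mat r) : ℝ := (Matrix.trace (hAdj h X * Y)).re

theorem posDef_isUnit_det {h : Mat r} (hh : h.PosDef) : IsUnit h.det :=
  (Matrix.isUnit_iff_isUnit_det h).1 hh.isUnit

-- Conjugation by `B` turns the adjoint for `h` into the conjugate transpose and the inner product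
-- into the Frobenius one, so later statements reduce to the standard Hermitian form.
open scoped MatrixOrder in
theorem PosDef.exists_conjTranspose_mul_self {h : Mat r} (hh : h.PosDef) :
    ∃ B : Mat r, IsUnit B.det ∧ h = Bᴴ * B := by
  obtain ⟨B, hB⟩ := CStarAlgebra.nonneg_iff_eq_star_mul_self.mp hh.posSemidef.nonneg
  rw [Matrix.star_eq_conjTranspose] at hB
  refine ⟨B, ?_, hB⟩
  have := posDef_isUnit_det hh
  rw [hB, Matrix.det_mul] at this
  exact isUnit_of_mul_isUnit_right this

theorem hAdj_eq {B : Mat r} (hB : IsUnit B.det) (X : Mat r) :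
    hAdj (Bᴴ * B) X = B⁻¹ * (B * X * B⁻¹)ᴴ * B := by
  have h1 : Bᴴ * (B⁻¹)ᴴ = 1 := by
    rw [← Matrix.conjTranspose_mul, Matrix.nonsing_inv_mul _ hB, Matrix.conjTranspose_one]
  have h2 : (Bᴴ)⁻¹ = (B⁻¹)ᴴ := Matrix.inv_eq_right_inv h1
  rw [hAdj, Matrix.mul_inv_rev, h2, Matrix.conjTranspose_mul, Matrix.conjTranspose_mul]
  simp only [Matrix.mul_assoc]

theorem hInner_eq {B : Mat r} (hB : IsUnit B.det) (X Y : Mat r) :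
    hInner (Bᴴ * B) X Y =
      (Matrix.trace ((B * X * B⁻¹)ᴴ * (B * Y * B⁻¹))).re := by
  rw [hInner, hAdj_eq hB, Matrix.trace_mul_comm ((B * X * B⁻¹)ᴴ)]
  rw [show B⁻¹ * (B * X * B⁻¹)ᴴ * B * Y = B⁻¹ * ((B * X * B⁻¹)ᴴ * (B * Y)) by
    simp only [Matrix.mul_assoc], Matrix.trace_mul_comm B⁻¹, Matrix.mul_assoc,
    Matrix.trace_mul_comm ((B * X * B⁻¹)ᴴ)]

theorem hInner_self_nonneg {h : Mat r} (hh : h.PosDef) (X : Mat r) : 0 ≤ hInner h X X := by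
  obtain ⟨B, hB, rfl⟩ := PosDef.exists_conjTranspose_mul_self hh
  rw [hInner_eq hB]
  exact (Complex.le_def.1 (Matrix.posSemidef_conjTranspose_mul_self (B * X * B⁻¹)).trace_nonneg).1

theorem hInner_self_eq_zero {h : Mat r} (hh : h.PosDef) {X : Mat r} (hX : hInner h X X = 0) :
    X = 0 := by
  obtain ⟨B, hB, rfl⟩ := PosDef.exists_conjTranspose_mul_self hh
  rw [hInner_eq hB] at hX
  have hn := Complex.le_def.1
    (Matrix.posSemidef_conjTranspose_mul_self (B * X * B⁻¹)).trace_nonneg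
  have h0 : Matrix.trace ((B * X * B⁻¹)ᴴ * (B * X * B⁻¹)) = 0 :=
    Complex.ext hX hn.2.symm
  rw [Matrix.trace_conjTranspose_mul_self_eq_zero_iff] at h0
  have : X = B⁻¹ * (B * X * B⁻¹) * B := by
    simp only [Matrix.mul_assoc, Matrix.nonsing_inv_mul _ hB, Matrix.mul_one]
    rw [Matrix.nonsing_inv_mul_cancel_left _ _ hB]
  rw [this, h0]; simp

theorem hInner_comm {h : Mat r} (hh : h.PosDef) (X Y : Mat r) : hInner h X Y = hInner h Y X := by
  obtain ⟨B, hB, rfl⟩ := PosDef.exists_conjTranspose_mul_self hh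
  rw [hInner_eq hB, hInner_eq hB]
  have := Matrix.trace_conjTranspose ((B * X * B⁻¹)ᴴ * (B * Y * B⁻¹))
  rw [Matrix.conjTranspose_mul, Matrix.conjTranspose_conjTranspose] at this
  rw [this]
  simp

theorem hInner_sub_right (h X Y Z : Mat r) : hInner h X (Y - Z) = hInner h X Y - hInner h X Z := by
  simp [hInner, Matrix.mul_sub]

theorem hInner_smul_right (h X Y : Mat r) (c : ℝ) : hInner h X (c • Y) = c * hInner h X Y := by
  simp [hInner, Matrix.trace_smul]

theorem hInner_sub_self {h : Mat r} (hh : h.PosDef) (X Y : Mat r) (c : ℝ) :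
    hInner h (Y - c • X) (Y - c • X) =
      hInner h Y Y - 2 * c * hInner h X Y + c ^ 2 * hInner h X X := by
  rw [hInner_sub_right, hInner_smul_right, hInner_comm hh (Y - c • X) Y,
    hInner_comm hh (Y - c • X) X, hInner_sub_right, hInner_sub_right, hInner_smul_right,
    hInner_smul_right, hInner_comm hh Y X]
  ring

theorem hAdj_mul {h : Mat r} (hh : h.PosDef) (X Y : Mat r) :
    hAdj h (X * Y) = hAdj h Y * hAdj h X := by
  rw [hAdj, hAdj, hAdj, Matrix.conjTranspose_mul]
  rw [show h⁻¹ * Yᴴ * h * (h⁻¹ * Xᴴ * h) = h⁻¹ * Yᴴ * (h * (h⁻¹ * (Xᴴ * h))) by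
    simp only [Matrix.mul_assoc], Matrix.mul_nonsing_inv_cancel_left _ _ (posDef_isUnit_det hh)]
  simp only [Matrix.mul_assoc]

theorem hAdj_sub (h X Y : Mat r) : hAdj h (X - Y) = hAdj h X - hAdj h Y := by
  simp [hAdj, Matrix.mul_sub, Matrix.sub_mul]

theorem hAdj_of_selfAdjoint {h X : Mat r} (hh : h.PosDef) (hX : Xᴴ * h = h * X) :
    hAdj h X = X := by
  rw [hAdj, Matrix.mul_assoc, hX, Matrix.nonsing_inv_mul_cancel_left _ _ (posDef_isUnit_det hh)]

/-- The Weitzenböck-type identity for the trace, one direction at a time. -/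
theorem trace_second_variation (g k A₁ A₂ ψ₁ ψ₂ d₁ d₂ : Mat r) :
    Matrix.trace ((ψ₁ * k - k * ψ₂ - A₁ * k + k * A₂) * (g * ψ₁ - ψ₂ * g) +
      k * ((g * (A₁ + ψ₁) - (A₂ + ψ₂) * g) * ψ₁ + g * d₁ -
        (d₂ * g + ψ₂ * (g * (A₁ + ψ₁) - (A₂ + ψ₂) * g)))) =
    2 * Matrix.trace ((ψ₁ * k - k * ψ₂) * (g * ψ₁ - ψ₂ * g)) +
      Matrix.trace (k * g * (d₁ + (A₁ * ψ₁ - ψ₁ * A₁))) -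
      Matrix.trace (g * k * (d₂ + (A₂ * ψ₂ - ψ₂ * A₂))) := by
  -- With `k` in the role of the adjoint of `g`, everything beyond the doubled square term and the
  -- codifferential terms is a commutator with A₁ + ψ₁, whose trace vanishes.
  have e : (ψ₁ * k - k * ψ₂ - A₁ * k + k * A₂) * (g * ψ₁ - ψ₂ * g) +
      k * ((g * (A₁ + ψ₁) - (A₂ + ψ₂) * g) * ψ₁ + g * d₁ -
        (d₂ * g + ψ₂ * (g * (A₁ + ψ₁) - (A₂ + ψ₂) * g))) =
      (ψ₁ * k - k * ψ₂) * (g * ψ₁ - ψ₂ * g) + (ψ₁ * k - k * ψ₂) * (g * ψ₁ - ψ₂ * g) +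
      k * g * (d₁ + (A₁ * ψ₁ - ψ₁ * A₁)) - k * ((d₂ + (A₂ * ψ₂ - ψ₂ * A₂)) * g) +
      (k * (g * ψ₁ - ψ₂ * g) * (A₁ + ψ₁) - (A₁ + ψ₁) * (k * (g * ψ₁ - ψ₂ * g))) := by
    noncomm_ring
  rw [e]
  simp only [Matrix.trace_add, Matrix.trace_sub]
  rw [Matrix.trace_mul_comm (k * (g * ψ₁ - ψ₂ * g)) (A₁ + ψ₁), Matrix.trace_mul_comm k,
    Matrix.mul_assoc _ g k, Matrix.trace_mul_comm _ (g * k)]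
  ring

/-- The first variation of the trace. -/
theorem trace_first_variation (g k A₁ A₂ ψ₁ ψ₂ : Mat r) :
    Matrix.trace ((ψ₁ * k - k * ψ₂ - A₁ * k + k * A₂) * g +
      k * (g * (A₁ + ψ₁) - (A₂ + ψ₂) * g)) = 2 * Matrix.trace (k * (g * ψ₁ - ψ₂ * g)) := by
  have e : (ψ₁ * k - k * ψ₂ - A₁ * k + k * A₂) * g + k * (g * (A₁ + ψ₁) - (A₂ + ψ₂) * g) =
      k * (g * ψ₁ - ψ₂ * g) + k * (g * ψ₁ - ψ₂ * g) + (ψ₁ * (k * g) - k * g * ψ₁) +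
      (k * g * A₁ - A₁ * (k * g)) := by noncomm_ring
  rw [e]
  simp only [Matrix.trace_add, Matrix.trace_sub]
  rw [Matrix.trace_mul_comm (k * g) ψ₁, Matrix.trace_mul_comm (k * g) A₁]
  ring

end HermitianAlgebra

end HiggsComplex

namespace HiggsComplex

open MeasureTheory Set Filter Topology Metric

/-! ### Calculus of functions that are C¹ up to the open edges -/

section OneJets

variable {F G H : Type*} [NormedAddCommGroup F] [NormedSpace ℝ F] [NormedAddCommGroup G]
  [NormedSpace ℝ G] [NormedAddCommGroup H] [NormedSpace ℝ H]

/-- `f` is continuously differentiable on the open triangle, and `f` and its derivative `f'` are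
continuous up to the open edges. -/
structure HasTriDeriv (f : ℂ → F) (f' : ℂ → PlaneHom F) : Prop where
  continuousOn : ContinuousOn f triStar
  continuousOn_deriv : ContinuousOn f' triStar
  hasFDerivAt : ∀ z ∈ triInt, HasFDerivAt f (f' z) z

theorem HasTriDeriv.congr_deriv {f : ℂ → F} {f' f'' : ℂ → PlaneHom F} (h : HasTriDeriv f f')
    (hc : ContinuousOn f'' triStar) (he : ∀ z ∈ triInt, ∀ v, f' z v = f'' z v) :
    HasTriDeriv f f'' :=
  ⟨h.continuousOn, hc, fun z hz =>
    (h.hasFDerivAt z hz).congr_fderiv (ContinuousLinearMap.ext (he z hz))⟩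

theorem HasTriDeriv.clm {f : ℂ → F} {f' : ℂ → PlaneHom F} (h : HasTriDeriv f f') (L : F →L[ℝ] G) :
    HasTriDeriv (fun z => L (f z)) (fun z => L.comp (f' z)) :=
  ⟨L.continuous.comp_continuousOn h.continuousOn,
    continuousOn_const.clm_comp h.continuousOn_deriv,
    fun z hz => L.hasFDerivAt.comp z (h.hasFDerivAt z hz)⟩

theorem HasTriDeriv.bilin {f : ℂ → F} {f' : ℂ → PlaneHom F} {g : ℂ → G} {g' : ℂ → PlaneHom G}
    (hf : HasTriDeriv f f') (hg : HasTriDeriv g g') (B : F →L[ℝ] G →L[ℝ] H) :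
    HasTriDeriv (fun z => B (f z) (g z))
      (fun z => B.precompR ℂ (f z) (g' z) + B.precompL ℂ (f' z) (g z)) := by
  refine ⟨(B.continuous.comp_continuousOn hf.continuousOn).clm_apply hg.continuousOn, ?_,
    fun z hz => B.hasFDerivAt_of_bilinear (hf.hasFDerivAt z hz) (hg.hasFDerivAt z hz)⟩
  exact (((B.precompR ℂ).continuous.comp_continuousOn hf.continuousOn).clm_apply
    hg.continuousOn_deriv).add
    (((B.precompL ℂ).continuous.comp_continuousOn hf.continuousOn_deriv).clm_apply hg.continuousOn)

theorem HasTriDeriv.sub {f g : ℂ → F} {f' g' : ℂ → PlaneHom F}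
    (hf : HasTriDeriv f f') (hg : HasTriDeriv g g') :
    HasTriDeriv (fun z => f z - g z) (fun z => f' z - g' z) :=
  ⟨hf.continuousOn.sub hg.continuousOn, hf.continuousOn_deriv.sub hg.continuousOn_deriv,
    fun z hz => (hf.hasFDerivAt z hz).sub (hg.hasFDerivAt z hz)⟩

theorem HasTriDeriv.add {f g : ℂ → F} {f' g' : ℂ → PlaneHom F}
    (hf : HasTriDeriv f f') (hg : HasTriDeriv g g') :
    HasTriDeriv (fun z => f z + g z) (fun z => f' z + g' z) :=
  ⟨hf.continuousOn.add hg.continuousOn, hf.continuousOn_deriv.add hg.continuousOn_deriv,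
    fun z hz => (hf.hasFDerivAt z hz).add (hg.hasFDerivAt z hz)⟩

theorem HasTriDeriv.inv {f : ℂ → ℝ} {f' : ℂ → PlaneHom ℝ} (h : HasTriDeriv f f')
    (h0 : ∀ z ∈ triStar, f z ≠ 0) :
    HasTriDeriv (fun z => (f z)⁻¹) (fun z => (-(f z ^ 2)⁻¹) • f' z) :=
  ⟨h.continuousOn.inv₀ h0, (((h.continuousOn.pow 2).inv₀ fun z hz =>
    pow_ne_zero 2 (h0 z hz)).neg).smul h.continuousOn_deriv, fun z hz =>
    (hasDerivAt_inv (h0 z (triInt_subset_triStar hz))).comp_hasFDerivAt z (h.hasFDerivAt z hz)⟩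

theorem hasTriDeriv_of_smoothUpTo {K : Set ℂ} {f : ℂ → F} (hK : triStar ⊆ K)
    (hf : SmoothUpTo K f) : ∃ f', HasTriDeriv f f' := by
  obtain ⟨U, fe, hU, hKU, hfe, heq⟩ := hf
  refine ⟨fderiv ℝ fe, ?_, ?_, ?_⟩
  · exact (hfe.continuousOn.mono (hK.trans hKU)).congr (heq.mono hK)
  · exact (hfe.continuousOn_fderiv_of_isOpen hU (by simp)).mono (hK.trans hKU)
  · intro z hz
    have hzK := hK (triInt_subset_triStar hz)
    have h1 : HasFDerivAt fe (fderiv ℝ fe z) z :=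
      ((hfe.contDiffAt (hU.mem_nhds (hKU hzK))).differentiableAt (by simp)).hasFDerivAt
    refine h1.congr_of_eventuallyEq ?_
    filter_upwards [isOpen_triInt.mem_nhds hz] with y hy
    exact heq (hK (triInt_subset_triStar hy))

end OneJets

section MatrixOneJets

variable {r : ℕ}

/-- Left multiplication of matrix-valued forms. -/
def lmul : Mat r →L[ℝ] PlaneHom (Mat r) →L[ℝ] PlaneHom (Mat r) :=
  (ContinuousLinearMap.compL ℝ ℂ (Mat r) (Mat r)).comp (ContinuousLinearMap.mul ℝ (Mat r))

/-- Right multiplication of matrix-valued forms. -/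
def rmul : Mat r →L[ℝ] PlaneHom (Mat r) →L[ℝ] PlaneHom (Mat r) :=
  (ContinuousLinearMap.compL ℝ ℂ (Mat r) (Mat r)).comp (ContinuousLinearMap.mul ℝ (Mat r)).flip

@[simp] theorem lmul_apply (X : Mat r) (η : PlaneHom (Mat r)) (v : ℂ) : lmul X η v = X * η v := rfl

@[simp] theorem rmul_apply (X : Mat r) (η : PlaneHom (Mat r)) (v : ℂ) : rmul X η v = η v * X := rfl

/-- The real part of the trace. -/
def reTr : Mat r →L[ℝ] ℝ :=
  LinearMap.toContinuousLinearMap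
    (Complex.reLm.comp ((Matrix.traceLinearMap (Fin r) ℂ ℂ).restrictScalars ℝ))

/-- The conjugate transpose. -/
def ctr : Mat r →L[ℝ] Mat r :=
  LinearMap.toContinuousLinearMap
    { toFun := fun X => Xᴴ
      map_add' := fun X Y => Matrix.conjTranspose_add X Y
      map_smul' := fun c X => by ext; simp }

theorem lmul_continuousOn {X : ℂ → Mat r} {η : ℂ → PlaneHom (Mat r)} {s : Set ℂ}
    (hX : ContinuousOn X s) (hη : ContinuousOn η s) : ContinuousOn (fun z => lmul (X z) (η z)) s :=
  (lmul.continuous.comp_continuousOn hX).clm_apply hη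

theorem rmul_continuousOn {X : ℂ → Mat r} {η : ℂ → PlaneHom (Mat r)} {s : Set ℂ}
    (hX : ContinuousOn X s) (hη : ContinuousOn η s) : ContinuousOn (fun z => rmul (X z) (η z)) s :=
  (rmul.continuous.comp_continuousOn hX).clm_apply hη

theorem HasTriDeriv.mul {X Y : ℂ → Mat r} {X' Y' : ℂ → PlaneHom (Mat r)} (hX : HasTriDeriv X X')
    (hY : HasTriDeriv Y Y') :
    HasTriDeriv (fun z => X z * Y z) (fun z => lmul (X z) (Y' z) + rmul (Y z) (X' z)) :=
  (hX.bilin hY (ContinuousLinearMap.mul ℝ (Mat r))).congr_deriv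
    ((lmul_continuousOn hX.continuousOn hY.continuousOn_deriv).add
      (rmul_continuousOn hY.continuousOn hX.continuousOn_deriv)) fun _ _ _ => rfl

theorem continuousOn_matrix_inv {X : ℂ → Mat r} {s : Set ℂ} (hX : ContinuousOn X s)
    (hu : ∀ z ∈ s, IsUnit (X z).det) : ContinuousOn (fun z => (X z)⁻¹) s := by
  have : (fun z => (X z)⁻¹) = fun z => Ring.inverse (X z) := by
    funext z; exact Matrix.nonsing_inv_eq_ringInverse _
  rw [this]
  intro z hz
  have hz' := (Matrix.isUnit_iff_isUnit_det _).2 (hu z hz)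
  have := NormedRing.inverse_continuousAt hz'.unit
  exact ContinuousAt.comp_continuousWithinAt (f := X) (g := Ring.inverse) this (hX z hz)

theorem HasTriDeriv.matrix_inv {X : ℂ → Mat r} {X' : ℂ → PlaneHom (Mat r)} (hX : HasTriDeriv X X')
    (hu : ∀ z ∈ triStar, IsUnit (X z).det) :
    HasTriDeriv (fun z => (X z)⁻¹) (fun z => - rmul (X z)⁻¹ (lmul (X z)⁻¹ (X' z))) := by
  have hc := continuousOn_matrix_inv hX.continuousOn hu
  refine ⟨hc, (rmul_continuousOn hc (lmul_continuousOn hc hX.continuousOn_deriv)).neg, ?_⟩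
  intro z hz
  have hz' := (Matrix.isUnit_iff_isUnit_det _).2 (hu z (triInt_subset_triStar hz))
  have h1 := hasFDerivAt_ringInverse (𝕜 := ℝ) hz'.unit
  have h2 : HasFDerivAt (fun z => Ring.inverse (X z)) _ z :=
    HasFDerivAt.comp (f := X) (g := Ring.inverse) z h1 (hX.hasFDerivAt z hz)
  have : (fun z => (X z)⁻¹) = fun z => Ring.inverse (X z) := by
    funext z; exact Matrix.nonsing_inv_eq_ringInverse _
  rw [this]
  refine h2.congr_fderiv (ContinuousLinearMap.ext fun v => ?_)
  have hi : ((hz'.unit⁻¹ : (Mat r)ˣ) : Mat r) = (X z)⁻¹ := by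
    rw [Matrix.nonsing_inv_eq_ringInverse, ← Ring.inverse_unit]; rfl
  simp [hi]

end MatrixOneJets

end HiggsComplex

namespace HiggsComplex

open MeasureTheory Set Filter Topology Metric

/-! ### The logarithmic derivative of |g|² and its divergence on one 2-cell -/

section Chart

variable {r : ℕ} {h g : ℂ → Mat r} {A₁ A₂ ψ₁ ψ₂ : ℂ → PlaneHom (Mat r)}

/-- `d + A` is a unitary connection for the Hermitian form `h` in one chart. -/
structure IsUnitaryOn (h : ℂ → Mat r) (A : ℂ → PlaneHom (Mat r)) : Prop where
  continuousOn : ContinuousOn A triStar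
  deriv : HasTriDeriv h fun z => lmul (h z) (A z) + rmul (h z) (ctr.comp (A z))

/-- This is the product rule for h⁻¹gᴴh, with `i` standing for h⁻¹. As both connections are unitary
for `h`, dh may be expressed through A₁ in the left factor and through A₂ in the right one; the
result is then covariant, and self-adjointness moves the Higgs fields across `h`. -/
theorem hAdj_deriv_identity {h i g A₁ A₂ ψ₁ ψ₂ : Mat r} (hi : h * i = 1) (ih : i * h = 1)
    (h₁ : ψ₁ᴴ * h = h * ψ₁) (h₂ : ψ₂ᴴ * h = h * ψ₂) :
    i * gᴴ * (h * A₂ + A₂ᴴ * h) + (i * (g * (A₁ + ψ₁) - (A₂ + ψ₂) * g)ᴴ +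
      -(i * (h * A₁ + A₁ᴴ * h) * i) * gᴴ) * h =
    ψ₁ * (i * gᴴ * h) - i * gᴴ * h * ψ₂ - A₁ * (i * gᴴ * h) + i * gᴴ * h * A₂ := by
  have e1 : ψ₁ * i = i * ψ₁ᴴ := by
    calc ψ₁ * i = i * h * ψ₁ * i := by rw [ih, one_mul]
      _ = i * (ψ₁ᴴ * h) * i := by rw [h₁]; simp only [mul_assoc]
      _ = i * ψ₁ᴴ * (h * i) := by simp only [mul_assoc]
      _ = i * ψ₁ᴴ := by rw [hi, mul_one]
  have e2 : i * (h * A₁ + A₁ᴴ * h) * i = A₁ * i + i * A₁ᴴ := by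
    calc i * (h * A₁ + A₁ᴴ * h) * i = (i * h) * A₁ * i + i * A₁ᴴ * (h * i) := by noncomm_ring
      _ = _ := by rw [hi, ih, one_mul, mul_one]
  have e3 : ψ₁ * (i * gᴴ * h) = i * ψ₁ᴴ * gᴴ * h := by
    rw [← e1]; simp only [mul_assoc]
  have e4 : i * gᴴ * h * ψ₂ = i * gᴴ * ψ₂ᴴ * h := by
    rw [mul_assoc _ h ψ₂, ← h₂]; simp only [mul_assoc]
  rw [e2, e3, e4, Matrix.conjTranspose_sub, Matrix.conjTranspose_mul, Matrix.conjTranspose_mul,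
    Matrix.conjTranspose_add, Matrix.conjTranspose_add]
  noncomm_ring

/-- The derivative of the adjoint of a covariantly controlled section. -/
theorem hasTriDeriv_hAdj (hpos : ∀ z ∈ tri, (h z).PosDef) (hA₁ : IsUnitaryOn h A₁)
    (hA₂ : IsUnitaryOn h A₂) (hψ₁ : ContinuousOn ψ₁ triStar) (hψ₂ : ContinuousOn ψ₂ triStar)
    (hs₁ : ∀ z ∈ triStar, ∀ v, (ψ₁ z v)ᴴ * h z = h z * ψ₁ z v)
    (hs₂ : ∀ z ∈ triStar, ∀ v, (ψ₂ z v)ᴴ * h z = h z * ψ₂ z v)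
    (hg : HasTriDeriv g fun z => lmul (g z) (A₁ z + ψ₁ z) - rmul (g z) (A₂ z + ψ₂ z)) :
    HasTriDeriv (fun z => hAdj (h z) (g z)) fun z =>
      rmul (hAdj (h z) (g z)) (ψ₁ z) - lmul (hAdj (h z) (g z)) (ψ₂ z) -
        rmul (hAdj (h z) (g z)) (A₁ z) + lmul (hAdj (h z) (g z)) (A₂ z) := by
  have hu : ∀ z ∈ triStar, IsUnit (h z).det := fun z hz =>
    posDef_isUnit_det (hpos z (triStar_subset_tri hz))
  have hk := ((hA₁.deriv.matrix_inv hu).mul (hg.clm ctr)).mul hA₂.deriv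
  have hc : ContinuousOn (fun z => hAdj (h z) (g z)) triStar := hk.continuousOn
  refine hk.congr_deriv ?_ ?_
  · exact (((rmul_continuousOn hc hψ₁).sub (lmul_continuousOn hc hψ₂)).sub
      (rmul_continuousOn hc hA₁.continuousOn)).add (lmul_continuousOn hc hA₂.continuousOn)
  · intro z hz v
    have hz' := triInt_subset_triStar hz
    exact hAdj_deriv_identity (Matrix.mul_nonsing_inv _ (hu z hz'))
      (Matrix.nonsing_inv_mul _ (hu z hz')) (hs₁ z hz' v) (hs₂ z hz' v)

/-- The logarithmic derivative of the norm of `g`, up to a factor two. -/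
def lamForm (h g : Mat r) (ψ₁ ψ₂ : PlaneHom (Mat r)) : PlaneHom ℝ :=
  (hInner h g g)⁻¹ • reTr.comp (lmul (hAdj h g) (lmul g ψ₁ - rmul g ψ₂))

theorem lamForm_apply (h g : Mat r) (ψ₁ ψ₂ : PlaneHom (Mat r)) (v : ℂ) :
    lamForm h g ψ₁ ψ₂ v = (hInner h g g)⁻¹ * hInner h g (g * ψ₁ v - ψ₂ v * g) := rfl

/-- Positive rank is needed: the empty matrix has determinant one and norm zero. -/
theorem hInner_self_pos [NeZero r] {h g : Mat r} (hh : h.PosDef) (hg : g.det = 1) :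
    0 < hInner h g g := by
  refine lt_of_le_of_ne (hInner_self_nonneg hh g) fun h0 => ?_
  have := hInner_self_eq_zero hh h0.symm
  have : Nonempty (Fin r) := ⟨⟨0, Nat.pos_of_ne_zero (NeZero.ne r)⟩⟩
  rw [‹g = 0›, Matrix.det_zero] at hg
  exact zero_ne_one hg

/-- The hypotheses on a complex gauge transformation between two solutions, in one chart. -/
structure ChartData (h g : ℂ → Mat r) (A₁ A₂ ψ₁ ψ₂ : ℂ → PlaneHom (Mat r)) : Prop where
  posDef : ∀ z ∈ tri, (h z).PosDef
  h_cont : ContinuousOn h tri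
  unitary₁ : IsUnitaryOn h A₁
  unitary₂ : IsUnitaryOn h A₂
  smooth₁ : ∃ ψ', HasTriDeriv ψ₁ ψ'
  smooth₂ : ∃ ψ', HasTriDeriv ψ₂ ψ'
  selfAdjoint₁ : ∀ z ∈ triStar, ∀ v, (ψ₁ z v)ᴴ * h z = h z * ψ₁ z v
  selfAdjoint₂ : ∀ z ∈ triStar, ∀ v, (ψ₂ z v)ᴴ * h z = h z * ψ₂ z v
  traceless₁ : ∀ z ∈ triStar, ∀ v, (ψ₁ z v).trace = 0
  traceless₂ : ∀ z ∈ triStar, ∀ v, (ψ₂ z v).trace = 0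
  coclosed₁ : ∀ z ∈ triInt,
    fderiv ℝ ψ₁ z 1 1 + (A₁ z 1 * ψ₁ z 1 - ψ₁ z 1 * A₁ z 1) +
      (fderiv ℝ ψ₁ z Complex.I Complex.I +
        (A₁ z Complex.I * ψ₁ z Complex.I - ψ₁ z Complex.I * A₁ z Complex.I)) = 0
  coclosed₂ : ∀ z ∈ triInt,
    fderiv ℝ ψ₂ z 1 1 + (A₂ z 1 * ψ₂ z 1 - ψ₂ z 1 * A₂ z 1) +
      (fderiv ℝ ψ₂ z Complex.I Complex.I +
        (A₂ z Complex.I * ψ₂ z Complex.I - ψ₂ z Complex.I * A₂ z Complex.I)) = 0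
  det_eq_one : ∀ z ∈ triStar, (g z).det = 1
  deriv : HasTriDeriv g fun z => lmul (g z) (A₁ z + ψ₁ z) - rmul (g z) (A₂ z + ψ₂ z)

theorem ChartData.hasTriDeriv_hAdj (D : ChartData h g A₁ A₂ ψ₁ ψ₂) :
    HasTriDeriv (fun z => hAdj (h z) (g z)) fun z =>
      rmul (hAdj (h z) (g z)) (ψ₁ z) - lmul (hAdj (h z) (g z)) (ψ₂ z) -
        rmul (hAdj (h z) (g z)) (A₁ z) + lmul (hAdj (h z) (g z)) (A₂ z) :=
  HiggsComplex.hasTriDeriv_hAdj D.posDef D.unitary₁ D.unitary₂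
    (D.smooth₁.elim fun _ h => h.continuousOn) (D.smooth₂.elim fun _ h => h.continuousOn)
    D.selfAdjoint₁ D.selfAdjoint₂ D.deriv

theorem ChartData.hasTriDeriv_hInner (D : ChartData h g A₁ A₂ ψ₁ ψ₂) :
    ∃ f', HasTriDeriv (fun z => hInner (h z) (g z) (g z)) f' ∧ ∀ z ∈ triInt, ∀ v,
      f' z v = 2 * hInner (h z) (g z) (g z * ψ₁ z v - ψ₂ z v * g z) := by
  refine ⟨_, (D.hasTriDeriv_hAdj.mul D.deriv).clm reTr, fun z hz v => ?_⟩
  have := congrArg Complex.re (trace_first_variation (g z) (hAdj (h z) (g z)) (A₁ z v) (A₂ z v)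
    (ψ₁ z v) (ψ₂ z v))
  rw [add_comm] at this
  have e : ∀ c : ℂ, (2 * c).re = 2 * c.re := by intro c; simp
  rw [e] at this
  exact this

theorem ChartData.hInner_pos [NeZero r] (D : ChartData h g A₁ A₂ ψ₁ ψ₂) {z : ℂ}
    (hz : z ∈ triStar) : 0 < hInner (h z) (g z) (g z) :=
  hInner_self_pos (D.posDef z (triStar_subset_tri hz)) (D.det_eq_one z hz)

/-- The divergence of the logarithmic derivative. -/
theorem ChartData.exists_div_lamForm [NeZero r] (D : ChartData h g A₁ A₂ ψ₁ ψ₂) :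
    ∃ l', HasTriDeriv (fun z => lamForm (h z) (g z) (ψ₁ z) (ψ₂ z)) l' ∧ ∀ z ∈ triInt,
      l' z 1 1 + l' z Complex.I Complex.I = 2 / hInner (h z) (g z) (g z) *
        ∑ v ∈ ({1, Complex.I} : Finset ℂ), hInner (h z)
          (g z * ψ₁ z v - ψ₂ z v * g z - lamForm (h z) (g z) (ψ₁ z) (ψ₂ z) v • g z)
          (g z * ψ₁ z v - ψ₂ z v * g z - lamForm (h z) (g z) (ψ₁ z) (ψ₂ z) v • g z) := by
  obtain ⟨ψ₁', hψ₁⟩ := D.smooth₁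
  obtain ⟨ψ₂', hψ₂⟩ := D.smooth₂
  obtain ⟨f', hf, hfv⟩ := D.hasTriDeriv_hInner
  have hfi := hf.inv fun z hz => (D.hInner_pos hz).ne'
  have hk := D.hasTriDeriv_hAdj
  have hΨ := (D.deriv.bilin hψ₁ lmul).sub (D.deriv.bilin hψ₂ rmul)
  have hlam := hfi.bilin ((hk.bilin hΨ lmul).clm (ContinuousLinearMap.compL ℝ ℂ (Mat r) ℝ reTr))
    (ContinuousLinearMap.lsmul ℝ ℝ)
  obtain ⟨l', hl', hl'v⟩ : ∃ l', HasTriDeriv (fun z => lamForm (h z) (g z) (ψ₁ z) (ψ₂ z)) l' ∧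
      ∀ z v, l' z v v = (hInner (h z) (g z) (g z))⁻¹ *
        (Matrix.trace (hAdj (h z) (g z) *
          (g z * ψ₁' z v v + (g z * (A₁ z v + ψ₁ z v) - (A₂ z v + ψ₂ z v) * g z) * ψ₁ z v -
            (ψ₂' z v v * g z + ψ₂ z v * (g z * (A₁ z v + ψ₁ z v) - (A₂ z v + ψ₂ z v) * g z))) +
          (ψ₁ z v * hAdj (h z) (g z) - hAdj (h z) (g z) * ψ₂ z v - A₁ z v * hAdj (h z) (g z) +
            hAdj (h z) (g z) * A₂ z v) * (g z * ψ₁ z v - ψ₂ z v * g z))).re +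
        -(hInner (h z) (g z) (g z) ^ 2)⁻¹ * f' z v *
          hInner (h z) (g z) (g z * ψ₁ z v - ψ₂ z v * g z) :=
    ⟨_, hlam, fun _ _ => rfl⟩
  refine ⟨l', hl', fun z hz => ?_⟩
  have hzs := triInt_subset_triStar hz
  have hh := D.posDef z (triInt_subset_tri hz)
  have hpos := D.hInner_pos hzs
  have c₁ := D.coclosed₁ z hz
  have c₂ := D.coclosed₂ z hz
  rw [(hψ₁.hasFDerivAt z hz).fderiv] at c₁
  rw [(hψ₂.hasFDerivAt z hz).fderiv] at c₂
  set f := hInner (h z) (g z) (g z) with hf_def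
  -- The quotient rule in one direction: with q = gψ₁(v) − ψ₂(v)g, the numerator contributes 2|q|²
  -- and one summand of each codifferential, and the denominator contributes −2λ(v)².
  have dir : ∀ v, l' z v v = f⁻¹ * (2 * hInner (h z) (g z * ψ₁ z v - ψ₂ z v * g z)
      (g z * ψ₁ z v - ψ₂ z v * g z) +
      (Matrix.trace (hAdj (h z) (g z) * g z *
        (ψ₁' z v v + (A₁ z v * ψ₁ z v - ψ₁ z v * A₁ z v)))).re -
      (Matrix.trace (g z * hAdj (h z) (g z) *
        (ψ₂' z v v + (A₂ z v * ψ₂ z v - ψ₂ z v * A₂ z v)))).re) -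
      2 * (f⁻¹ * hInner (h z) (g z) (g z * ψ₁ z v - ψ₂ z v * g z)) ^ 2 := by
    intro v
    have e := trace_second_variation (g z) (hAdj (h z) (g z)) (A₁ z v) (A₂ z v) (ψ₁ z v) (ψ₂ z v)
      (ψ₁' z v v) (ψ₂' z v v)
    have ea : hAdj (h z) (g z * ψ₁ z v - ψ₂ z v * g z) =
        ψ₁ z v * hAdj (h z) (g z) - hAdj (h z) (g z) * ψ₂ z v := by
      rw [hAdj_sub, hAdj_mul hh, hAdj_mul hh, hAdj_of_selfAdjoint hh (D.selfAdjoint₁ z hzs v),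
        hAdj_of_selfAdjoint hh (D.selfAdjoint₂ z hzs v)]
    have eN : hInner (h z) (g z * ψ₁ z v - ψ₂ z v * g z) (g z * ψ₁ z v - ψ₂ z v * g z) =
        (Matrix.trace ((ψ₁ z v * hAdj (h z) (g z) - hAdj (h z) (g z) * ψ₂ z v) *
          (g z * ψ₁ z v - ψ₂ z v * g z))).re := by
      rw [hInner, ea]
    have e2 : ∀ c : ℂ, (2 * c).re = 2 * c.re := by intro c; simp
    have er := congrArg Complex.re e
    rw [Complex.sub_re, Complex.add_re, e2, ← eN] at er
    rw [hl'v, hfv z hz v, ← er, add_comm (hAdj (h z) (g z) * _) _,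
      add_comm (g z * ψ₁' z v v) _]
    ring
  have t₁ := congrArg (fun M => (Matrix.trace (hAdj (h z) (g z) * g z * M)).re) c₁
  have t₂ := congrArg (fun M => (Matrix.trace (g z * hAdj (h z) (g z) * M)).re) c₂
  simp only [Matrix.mul_add (hAdj (h z) (g z) * g z) (ψ₁' z 1 1 + _) _,
    Matrix.mul_add (g z * hAdj (h z) (g z)) (ψ₂' z 1 1 + _) _, Matrix.trace_add, Complex.add_re,
    Matrix.mul_zero, Matrix.trace_zero, Complex.zero_re] at t₁ t₂
  -- Summing over 1 and i removes the codifferentials by `t₁` and `t₂`. The remainder is a completed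
  -- square, since ⟨g, q⟩ = λf gives |q − λg|² = |q|² − λ²f.
  rw [Finset.sum_pair (by simp [Complex.ext_iff]), dir, dir, hInner_sub_self hh, hInner_sub_self hh,
    ← hf_def, lamForm_apply, lamForm_apply, ← hf_def]
  field_simp
  linear_combination f * t₁ - f * t₂

/-- Multiplying by g⁻¹ gives a − g⁻¹bg = c · 1, and the trace of this is 0 = c r. -/
theorem trace_eq_zero_of_proportional [NeZero r] {g a b : Mat r} {c : ℝ} (hg : g.det = 1)
    (ha : a.trace = 0) (hb : b.trace = 0) (h : g * a - b * g - c • g = 0) : c = 0 := by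
  have hu : IsUnit g.det := by rw [hg]; exact isUnit_one
  have e : g⁻¹ * (g * a - b * g - c • g) = a - g⁻¹ * (b * g) - c • (1 : Mat r) := by
    rw [Matrix.mul_sub, Matrix.mul_sub, Matrix.nonsing_inv_mul_cancel_left _ _ hu,
      Matrix.mul_smul, Matrix.nonsing_inv_mul _ hu]
  have t := congrArg Matrix.trace e
  rw [h, Matrix.mul_zero, Matrix.trace_zero, Matrix.trace_sub, Matrix.trace_sub, ha,
    Matrix.trace_mul_comm, Matrix.mul_assoc, Matrix.mul_nonsing_inv _ hu, Matrix.mul_one, hb,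
    Matrix.trace_smul, Matrix.trace_one, Fintype.card_fin] at t
  have hr : (r : ℂ) ≠ 0 := Nat.cast_ne_zero.2 (NeZero.ne r)
  simp at t
  rcases t with t | t
  · exact t
  · exact absurd t (NeZero.ne r)

/-- If the divergence vanishes, `g` intertwines the Higgs fields. -/
theorem ChartData.intertwines [NeZero r] (D : ChartData h g A₁ A₂ ψ₁ ψ₂)
    (h0 : ∀ z ∈ triInt, ∑ v ∈ ({1, Complex.I} : Finset ℂ), hInner (h z)
          (g z * ψ₁ z v - ψ₂ z v * g z - lamForm (h z) (g z) (ψ₁ z) (ψ₂ z) v • g z)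
          (g z * ψ₁ z v - ψ₂ z v * g z - lamForm (h z) (g z) (ψ₁ z) (ψ₂ z) v • g z) = 0)
    {z : ℂ} (hz : z ∈ triInt) (v : ℂ) : g z * ψ₁ z v = ψ₂ z v * g z := by
  have hzs := triInt_subset_triStar hz
  have hh := D.posDef z (triInt_subset_tri hz)
  have key : ∀ v ∈ ({1, Complex.I} : Finset ℂ), g z * ψ₁ z v = ψ₂ z v * g z := by
    intro v hv
    have := (Finset.sum_eq_zero_iff_of_nonneg fun v _ => hInner_self_nonneg hh _).1 (h0 z hz) v hv
    have e := hInner_self_eq_zero hh this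
    have c := trace_eq_zero_of_proportional (D.det_eq_one z hzs) (D.traceless₁ z hzs v)
      (D.traceless₂ z hzs v) e
    rw [c, zero_smul, sub_zero] at e
    exact sub_eq_zero.1 e
  have : lmul (g z) (ψ₁ z) = rmul (g z) (ψ₂ z) :=
    planeHom_ext (key 1 (by simp)) (key Complex.I (by simp))
  exact congrArg (fun L : PlaneHom (Mat r) => L v) this

end Chart

end HiggsComplex

namespace HiggsComplex

open MeasureTheory Set Filter Topology Metric

/-! ### Transfer between the triangle and logarithmic coordinates -/

section LogCoordinates

variable {F : Type*} [NormedAddCommGroup F] [NormedSpace ℝ F]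

theorem logForm_apply (η : ℂ → PlaneHom F) (w v : ℂ) :
    logForm η w v = η (Complex.exp w) (Complex.exp w * v) := rfl

theorem continuousOn_logFun {F : Type*} [NormedAddCommGroup F] {f : ℂ → F} (hf : ContinuousOn f triStar) :
    ContinuousOn (logFun f) edgeStrip :=
  hf.comp Complex.continuous_exp.continuousOn fun _ hw => exp_mem_triStar hw

theorem continuousOn_logForm {η : ℂ → PlaneHom F} (hη : ContinuousOn η triStar) :
    ContinuousOn (logForm η) edgeStrip :=
  (continuousOn_logFun hη).clm_comp
    ((ContinuousLinearMap.mul ℝ ℂ).continuous.comp Complex.continuous_exp).continuousOn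

theorem hasFDerivAt_exp_real (w : ℂ) :
    HasFDerivAt Complex.exp (ContinuousLinearMap.mul ℝ ℂ (Complex.exp w)) w :=
  ((Complex.hasDerivAt_exp w).hasFDerivAt.restrictScalars ℝ).congr_fderiv <| by
    ext v; simp [mul_comm]

theorem hasFDerivAt_logFun {f : ℂ → F} {f' : ℂ → PlaneHom F} {w : ℂ}
    (hf : HasFDerivAt f (f' (Complex.exp w)) (Complex.exp w)) :
    HasFDerivAt (logFun f) (logForm f' w) w :=
  hf.comp w (hasFDerivAt_exp_real w)

theorem HasTriDeriv.hasFDerivAt_logFun {f : ℂ → F} {f' : ℂ → PlaneHom F} (h : HasTriDeriv f f')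
    {w : ℂ} (hw : w ∈ strip) : HasFDerivAt (logFun f) (logForm f' w) w :=
  HiggsComplex.hasFDerivAt_logFun (h.hasFDerivAt _ (exp_mem_triInt hw))

theorem HasTriDeriv.hasWeakDeriv {f : ℂ → F} {f' : ℂ → PlaneHom F} (h : HasTriDeriv f f') :
    HasWeakDeriv strip (logFun f) (logForm f') :=
  hasWeakDeriv_of_hasFDerivAt isOpen_strip (fun _ hw => h.hasFDerivAt_logFun hw)
    ((continuousOn_logForm h.continuousOn_deriv).mono strip_subset_edgeStrip)

/-- Differentiability on a corner can be checked in the logarithmic coordinate. -/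
theorem hasFDerivAt_of_logFun {f : ℂ → F} {f' : ℂ → PlaneHom F} {z : ℂ} (hz : z ∈ triInt)
    (h : HasFDerivAt (logFun f) (logForm f' (Complex.log z)) (Complex.log z)) :
    HasFDerivAt f (f' z) z := by
  have h0 := ne_zero_of_mem_triInt hz
  have him : 0 < z.im := by
    have := hz 2
    rw [bary_two] at this
    have := sqrt_three_pos
    by_contra hn
    nlinarith [mul_nonneg (neg_nonneg.2 (not_lt.1 hn)) this.le]
  have hl := (Complex.hasStrictFDerivAt_log_real (x := z) (Or.inr him.ne')).hasFDerivAt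
  have hc := h.comp z hl
  refine (hc.congr_of_eventuallyEq ?_).congr_fderiv ?_
  · filter_upwards [isOpen_triInt.mem_nhds hz] with y hy
    simp [logFun, Complex.exp_log (ne_zero_of_mem_triInt hy)]
  · ext v; simp [logForm_apply, Complex.exp_log h0, h0]

end LogCoordinates

/-! ### From the global hypotheses to data in one chart -/

section Bridge

variable {V W : Type*} {Y : AbstractSimplicialComplex W} {p : W → V} {r : ℕ}

theorem IsSmoothForm.exists_hasTriDeriv {η : FormFamily W r} (h : IsSmoothForm Y η)
    {σ : Fin 3 → W} (hσ : IsTri Y σ) : ∃ η', HasTriDeriv (η σ) η' :=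
  hasTriDeriv_of_smoothUpTo subset_rfl (h.smooth σ hσ)

theorem IsSmoothForm.continuousOn {η : FormFamily W r} (h : IsSmoothForm Y η)
    {σ : Fin 3 → W} (hσ : IsTri Y σ) : ContinuousOn (η σ) triStar :=
  (h.exists_hasTriDeriv hσ).elim fun _ h => h.continuousOn

theorem IsSmoothForm.add {η ξ : FormFamily W r} (hη : IsSmoothForm Y η) (hξ : IsSmoothForm Y ξ) :
    IsSmoothForm Y (η + ξ) where
  smooth σ hσ := by
    obtain ⟨U, f, hU, hKU, hf, hfe⟩ := hη.smooth σ hσ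
    obtain ⟨U', f', hU', hKU', hf', hfe'⟩ := hξ.smooth σ hσ
    refine ⟨U ∩ U', fun z => f z + f' z, hU.inter hU', subset_inter hKU hKU',
      (hf.mono inter_subset_left).add (hf'.mono inter_subset_right), fun z hz => ?_⟩
    simp only [Pi.add_apply, hfe hz, hfe' hz]
  compat σ τ hσ hτ z hz z' hz' v v' h h' := by
    simp only [Pi.add_apply, _root_.add_apply, hη.compat σ τ hσ hτ z hz z' hz' v v' h h',
      hξ.compat σ τ hσ hτ z hz z' hz' v v' h h']

theorem HermitianBundle.continuousOn_metric (E : HermitianBundle Y p r) {σ : Fin 3 → W}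
    (hσ : IsTri Y σ) : ContinuousOn (fun z => E.metric (chart σ z)) tri := by
  obtain ⟨U, f, -, hKU, hf, hfe⟩ := E.metric_smooth σ hσ
  exact (hf.continuousOn.mono hKU).congr hfe

theorem HermitianBundle.continuousOn_trans (E : HermitianBundle Y p r) {σ τ : Fin 3 → W}
    (hσ : IsTri Y σ) (hτ : IsTri Y τ) (h : p ∘ σ = p ∘ τ) :
    ContinuousOn (fun z => E.trans (chart σ z) (chart τ z)) tri := by
  obtain ⟨U, f, -, hKU, hf, hfe⟩ := E.trans_smooth σ τ hσ hτ h
  exact (hf.continuousOn.mono hKU).congr hfe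

theorem HermitianBundle.isUnit_det_trans (E : HermitianBundle Y p r) {σ τ : Fin 3 → W}
    (hσ : IsTri Y σ) (hτ : IsTri Y τ) (h : p ∘ σ = p ∘ τ) {z : ℂ} (hz : z ∈ tri) :
    IsUnit (E.trans (chart σ z) (chart τ z)).det := by
  have := E.trans_mul σ τ σ hσ hτ hσ h h.symm z hz
  rw [E.trans_self σ hσ z hz] at this
  exact Matrix.isUnit_det_of_right_inverse this

theorem IsUnitaryForm.isUnitaryOn {E : HermitianBundle Y p r} {A : FormFamily W r}
    (h : IsUnitaryForm E A) (hA : IsSmoothForm Y A) {σ : Fin 3 → W} (hσ : IsTri Y σ) :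
    IsUnitaryOn (fun z => E.metric (chart σ z)) (A σ) := by
  have hAc := hA.continuousOn hσ
  obtain ⟨m', hm'⟩ := hasTriDeriv_of_smoothUpTo triStar_subset_tri (E.metric_smooth σ hσ)
  have hm := (E.continuousOn_metric hσ).mono triStar_subset_tri
  refine ⟨hAc, hm'.congr_deriv ((lmul_continuousOn hm hAc).add (rmul_continuousOn hm
    (continuousOn_const.clm_comp hAc))) fun z hz v => ?_⟩
  have e : m' z v = _ :=
    (congrArg (fun L : PlaneHom (Mat r) => L v) (hm'.hasFDerivAt z hz).fderiv).symm.trans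
      (h σ hσ z hz v)
  rw [e, add_comm]
  rfl

variable {E : HermitianBundle Y p r} {δ : ℝ} {g : (W → ℝ) → Mat r}

/-- A continuous gauge transformation between smooth connections is continuously differentiable. -/
theorem ConnectionsRelated.hasTriDeriv {α₁ α₂ : FormFamily W r} (h : ConnectionsRelated Y g α₁ α₂)
    (hg : IsComplexGauge E δ g) (h₁ : IsSmoothForm Y α₁) (h₂ : IsSmoothForm Y α₂) {σ : Fin 3 → W}
    (hσ : IsTri Y σ) :
    HasTriDeriv (fun z => g (chart σ z)) fun z =>
      lmul (g (chart σ z)) (α₁ σ z) - rmul (g (chart σ z)) (α₂ σ z) := by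
  have hc : ∀ τ, IsTri Y τ → ContinuousOn (fun z => lmul (g (chart τ z)) (α₁ τ z) -
      rmul (g (chart τ z)) (α₂ τ z)) triStar := fun τ hτ =>
    (lmul_continuousOn (hg.continuous τ hτ) (h₁.continuousOn hτ)).sub
      (rmul_continuousOn (hg.continuous τ hτ) (h₂.continuousOn hτ))
  refine ⟨hg.continuous σ hσ, hc σ hσ, fun z hz => ?_⟩
  refine triInt_induction (ι := {τ : Fin 3 → W // IsTri Y τ}) (s := fun τ => ⟨cyc τ.1, τ.2.cyc⟩)
    (P := fun τ z => HasFDerivAt (fun z => g (chart τ.1 z))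
      (lmul (g (chart τ.1 z)) (α₁ τ.1 z) - rmul (g (chart τ.1 z)) (α₂ τ.1 z)) z)
    ?_ ?_ ⟨σ, hσ⟩ hz
  · rintro ⟨τ, hτ⟩ z hz hn
    -- Solving the gauge relation for the weak derivative gives gα₁ − α₂g almost everywhere. This is
    -- continuous, so `g` is classically differentiable in the corner.
    obtain ⟨b, hb, hbe⟩ := h τ hτ
    have hcl := (continuousOn_logForm (hc τ hτ)).mono strip_subset_edgeStrip
    have hb' := hb.congr_ae isOpen_strip (f'' := logForm fun z => lmul (g (chart τ z)) (α₁ τ z) -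
      rmul (g (chart τ z)) (α₂ τ z)) ?_ (hcl.locallyIntegrableOn isOpen_strip.measurableSet)
    · exact hasFDerivAt_of_logFun (f' := fun z => lmul (g (chart τ z)) (α₁ τ z) -
        rmul (g (chart τ z)) (α₂ τ z)) hz (hb'.hasFDerivAt isOpen_strip
        ((continuousOn_logFun (hg.continuous τ hτ)).mono strip_subset_edgeStrip) hcl
        (log_mem_strip hz hn))
    · filter_upwards [hbe, ae_restrict_mem isOpen_strip.measurableSet] with w hw hws
      have hd : IsUnit (g (chart τ (Complex.exp w))).det := by
        rw [hg.det_eq_one τ hτ _ (exp_mem_triStar (strip_subset_edgeStrip hws))]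
        exact isUnit_one
      ext1 v
      have e := congrArg (fun M => g (chart τ (Complex.exp w)) * M) (hw v)
      simp only [logFun, Matrix.mul_add, Matrix.mul_nonsing_inv_cancel_left _ _ hd,
        Matrix.mul_assoc] at e
      change b w v = g (chart τ (Complex.exp w)) * logForm (α₁ τ) w v -
        logForm (α₂ τ) w v * g (chart τ (Complex.exp w))
      rw [e, add_sub_cancel_right]
  · rintro ⟨τ, hτ⟩ z hz hP
    -- The chart of `τ` is the chart of `cyc τ` composed with `rot ∘ rot`, the inverse rotation; the
    -- chain rule transports the formula to the other corners.
    have hr := (hasFDerivAt_rot (rot (rot z))).comp (rot z) (hasFDerivAt_rot (rot z))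
    simp only at hP
    have hz3 : (rot ∘ rot) (rot z) = z := rot_rot_rot z
    rw [← hz3] at hP
    have hcomp := hP.comp (rot z) hr
    rw [hz3] at hcomp
    refine (hcomp.congr_of_eventuallyEq ?_).congr_fderiv ?_
    · refine Eventually.of_forall fun y => ?_
      simp only [Function.comp, ← chart_rot, rot_rot_rot]
    · ext1 v
      have hzs := triInt_subset_triStar hz
      have e : zeta * (zeta * (zeta * v)) = v := by linear_combination v * zeta_cube
      simp only [ContinuousLinearMap.comp_apply, _root_.sub_apply, lmul_apply, rmul_apply,
        ContinuousLinearMap.mul_apply', ← h₁.rot hτ hzs, ← h₂.rot hτ hzs, e, ← chart_rot]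

theorem IsHitchinPair.chartData {A₁ ψ₁ A₂ ψ₂ : FormFamily W r} (h₁ : IsHitchinPair E δ A₁ ψ₁)
    (h₂ : IsHitchinPair E δ A₂ ψ₂) (hg : IsComplexGauge E δ g)
    (h : ConnectionsRelated Y g (A₁ + ψ₁) (A₂ + ψ₂)) {σ : Fin 3 → W} (hσ : IsTri Y σ) :
    ChartData (fun z => E.metric (chart σ z)) (fun z => g (chart σ z)) (A₁ σ) (A₂ σ) (ψ₁ σ)
      (ψ₂ σ) where
  posDef := E.metric_posDef σ hσ
  h_cont := E.continuousOn_metric hσ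
  unitary₁ := h₁.unitary_A.isUnitaryOn h₁.smooth_A hσ
  unitary₂ := h₂.unitary_A.isUnitaryOn h₂.smooth_A hσ
  smooth₁ := h₁.smooth_ψ.exists_hasTriDeriv hσ
  smooth₂ := h₂.smooth_ψ.exists_hasTriDeriv hσ
  selfAdjoint₁ := h₁.selfAdjoint_ψ σ hσ
  selfAdjoint₂ := h₂.selfAdjoint_ψ σ hσ
  traceless₁ := h₁.traceless_ψ σ hσ
  traceless₂ := h₂.traceless_ψ σ hσ
  coclosed₁ z hz := neg_eq_zero.1 (h₁.solves.coclosed σ hσ z hz)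
  coclosed₂ z hz := neg_eq_zero.1 (h₂.solves.coclosed σ hσ z hz)
  det_eq_one := hg.det_eq_one σ hσ
  deriv := h.hasTriDeriv hg (h₁.smooth_A.add h₁.smooth_ψ) (h₂.smooth_A.add h₂.smooth_ψ) hσ

end Bridge

end HiggsComplex

namespace HiggsComplex

open MeasureTheory Set Filter Topology Metric

/-! ### Square integrals of 1-forms under the exponential map -/

section CornerIntegrals

variable {F : Type*} [NormedAddCommGroup F] [NormedSpace ℝ F]

/-- On the strip t = −Re w is positive, so the weight is at least one for δ ≥ 0. -/
theorem volume_restrict_strip_le {δ : ℝ} (hδ : 0 ≤ δ) :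
    volume.restrict strip ≤ stripMeasure δ := by
  have h : (volume.restrict strip).withDensity 1 ≤ stripMeasure δ := by
    refine withDensity_mono ?_
    filter_upwards [ae_restrict_mem isOpen_strip.measurableSet] with w hw
    have h1 : w.re ≤ 0 := hw.1.le.trans (Real.log_nonpos (by norm_num) (by norm_num))
    rw [Pi.one_apply, ← ENNReal.ofReal_one]
    refine ENNReal.ofReal_le_ofReal (Real.one_le_exp ?_)
    nlinarith
  rwa [withDensity_one] at h

theorem injOn_exp_strip : InjOn Complex.exp strip := by
  intro w hw w' hw' h
  have hpi := Real.pi_pos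
  refine Complex.exp_inj_of_neg_pi_lt_of_le_pi ?_ ?_ ?_ ?_ h
  · linarith [hw.2.1]
  · linarith [hw.2.2]
  · linarith [hw'.2.1]
  · linarith [hw'.2.2]

theorem exp_image_strip : Complex.exp '' strip = triInt ∩ ball 0 (3 / 4) := by
  ext z
  constructor
  · rintro ⟨w, hw, rfl⟩
    exact ⟨exp_mem_triInt hw, by rw [mem_ball_zero_iff]; exact norm_exp_lt hw.1⟩
  · rintro ⟨hz, hn⟩
    exact ⟨Complex.log z, log_mem_strip hz (by rwa [mem_ball_zero_iff] at hn),
      Complex.exp_log (ne_zero_of_mem_triInt hz)⟩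

theorem det_mul_complex (c : ℂ) : (ContinuousLinearMap.mul ℝ ℂ c).det = ‖c‖ ^ 2 := by
  rw [← Complex.normSq_eq_norm_sq, ← Algebra.norm_complex_apply]
  rfl

theorem norm_mul_le_norm_logForm (η : ℂ → PlaneHom F) (w : ℂ) :
    ‖Complex.exp w‖ * ‖η (Complex.exp w)‖ ≤ ‖logForm η w‖ := by
  have hpos : 0 < ‖Complex.exp w‖ := norm_pos_iff.2 (Complex.exp_ne_zero w)
  rw [mul_comm, ← le_div_iff₀ hpos]
  refine ContinuousLinearMap.opNorm_le_bound _ (by positivity) fun v => ?_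
  have := (logForm η w).le_opNorm ((Complex.exp w)⁻¹ * v)
  rw [logForm_apply, mul_inv_cancel_left₀ (Complex.exp_ne_zero w), norm_mul, norm_inv] at this
  refine this.trans_eq ?_
  rw [div_eq_mul_inv, mul_assoc]

/-- The square integral of a form is conformally invariant. -/
theorem integrableOn_sq_of_memLp {η : ℂ → PlaneHom F} (hη : ContinuousOn η triInt)
    (h : MemLp (logForm η) 2 (volume.restrict strip)) :
    IntegrableOn (fun z => ‖η z‖ ^ 2) (triInt ∩ ball 0 (3 / 4)) := by
  have hm : MeasurableSet (triInt ∩ ball (0 : ℂ) (3 / 4)) :=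
    (isOpen_triInt.inter isOpen_ball).measurableSet
  refine ⟨((hη.mono inter_subset_left).norm.pow 2).aestronglyMeasurable hm, ?_⟩
  -- The Jacobian |exp w|² of the change of variables is absorbed by the scaling of the squared norm
  -- of a 1-form under pull-back.
  rw [hasFiniteIntegral_iff_enorm, ← exp_image_strip,
    lintegral_image_eq_lintegral_abs_det_fderiv_mul volume isOpen_strip.measurableSet
      (fun w _ => (hasFDerivAt_exp_real w).hasFDerivWithinAt) injOn_exp_strip]
  have h2 := h.integrable_norm_pow (by norm_num)
  rw [← memLp_one_iff_integrable] at h2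
  refine lt_of_le_of_lt (lintegral_mono fun w => ?_)
    (hasFiniteIntegral_iff_enorm.1 (memLp_one_iff_integrable.1 h2).2)
  rw [det_mul_complex, abs_of_nonneg (by positivity), Real.enorm_of_nonneg (by positivity),
    Real.enorm_of_nonneg (by positivity), ← ENNReal.ofReal_mul (by positivity), ← mul_pow]
  exact ENNReal.ofReal_le_ofReal (pow_le_pow_left₀ (by positivity) (norm_mul_le_norm_logForm η w) 2)

end CornerIntegrals

/-! ### Bounds for the logarithmic derivative by the Higgs fields -/

section HermitianEstimates

variable {r : ℕ}

theorem trace_conjTranspose_mul_self_re (M : Mat r) : (Matrix.trace (Mᴴ * M)).re = ‖M‖ ^ 2 := by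
  have h0 : 0 ≤ ∑ i, ∑ j, ‖M i j‖ ^ (2 : ℝ) :=
    Finset.sum_nonneg fun i _ => Finset.sum_nonneg fun j _ => by positivity
  rw [Matrix.frobenius_norm_def, ← Real.rpow_natCast, ← Real.rpow_mul h0]
  norm_num
  simp only [Matrix.trace, Matrix.diag, Matrix.mul_apply, Matrix.conjTranspose_apply,
    Complex.re_sum]
  rw [Finset.sum_comm]
  refine Finset.sum_congr rfl fun i _ => Finset.sum_congr rfl fun j _ => ?_
  rw [← Complex.normSq_eq_norm_sq, Complex.star_def, Complex.normSq_eq_conj_mul_self.symm,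
    Complex.ofReal_re]

theorem hInner_self_eq {B : Mat r} (hB : IsUnit B.det) (X : Mat r) :
    hInner (Bᴴ * B) X X = ‖B * X * B⁻¹‖ ^ 2 := by
  rw [hInner_eq hB, trace_conjTranspose_mul_self_re]

theorem hInner_mul_self_le {h : Mat r} (hh : h.PosDef) (X Y : Mat r) :
    hInner h (X * Y) (X * Y) ≤ hInner h X X * hInner h Y Y := by
  obtain ⟨B, hB, rfl⟩ := PosDef.exists_conjTranspose_mul_self hh
  rw [hInner_self_eq hB, hInner_self_eq hB, hInner_self_eq hB, ← mul_pow]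
  refine pow_le_pow_left₀ (norm_nonneg _) ?_ 2
  have : B * (X * Y) * B⁻¹ = (B * X * B⁻¹) * (B * Y * B⁻¹) := by
    rw [show (B * X * B⁻¹) * (B * Y * B⁻¹) = B * X * (B⁻¹ * (B * (Y * B⁻¹))) by
      simp only [Matrix.mul_assoc], Matrix.nonsing_inv_mul_cancel_left _ _ hB]
    simp only [Matrix.mul_assoc]
  rw [this]
  exact norm_mul_le _ _

theorem hInner_sub_self_le {h : Mat r} (hh : h.PosDef) (X Y : Mat r) :
    hInner h (X - Y) (X - Y) ≤ 2 * hInner h X X + 2 * hInner h Y Y := by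
  have h1 := hInner_sub_self hh Y X 1
  have h2 := hInner_sub_self hh Y X (-1)
  have h3 := hInner_self_nonneg hh (X - (-1 : ℝ) • Y)
  rw [one_smul] at h1
  linarith

/-- With q = gψ₁(v) − ψ₂(v)g, the inequality 0 ≤ |q − λg|² yields λ²|g|² ≤ |q|² ≤ 2|g|²(|ψ₁(v)|² +
|ψ₂(v)|²). The factor |g|² cancels, so no bound on `g` near the vertices is required. -/
theorem lamForm_sq_le {h g : Mat r} (hh : h.PosDef) (hg : 0 < hInner h g g)
    (ψ₁ ψ₂ : PlaneHom (Mat r)) (v : ℂ) :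
    lamForm h g ψ₁ ψ₂ v ^ 2 ≤ 2 * hInner h (ψ₁ v) (ψ₁ v) + 2 * hInner h (ψ₂ v) (ψ₂ v) := by
  have e1 := hInner_self_nonneg hh (g * ψ₁ v - ψ₂ v * g - lamForm h g ψ₁ ψ₂ v • g)
  have e2 := hInner_sub_self_le hh (g * ψ₁ v) (ψ₂ v * g)
  have e3 := hInner_mul_self_le hh g (ψ₁ v)
  have e4 := hInner_mul_self_le hh (ψ₂ v) g
  have e5 : hInner h g (g * ψ₁ v - ψ₂ v * g) = lamForm h g ψ₁ ψ₂ v * hInner h g g := by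
    rw [lamForm_apply]; field_simp
  rw [hInner_sub_self hh, e5] at e1
  refine le_of_mul_le_mul_right ?_ hg
  nlinarith

theorem norm_entry_le (X : Mat r) (i j : Fin r) : ‖X i j‖ ≤ ‖X‖ :=
  (PiLp.norm_apply_le (p := 2) (WithLp.toLp 2 (X i)) j).trans
    (PiLp.norm_apply_le (p := 2) (WithLp.toLp 2 fun i => WithLp.toLp 2 (X i)) i)

theorem re_trace_le (X : Mat r) : X.trace.re ≤ (r : ℝ) * ‖X‖ := by
  rw [Matrix.trace, Complex.re_sum]
  refine (Finset.sum_le_card_nsmul _ _ ‖X‖ fun i _ => ?_).trans (by simp)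
  exact (Complex.re_le_norm _).trans (norm_entry_le X i i)

theorem hInner_self_le (h X : Mat r) :
    hInner h X X ≤ (r : ℝ) * (‖h⁻¹‖ * ‖h‖) * ‖X‖ ^ 2 := by
  refine (re_trace_le _).trans ?_
  rw [mul_assoc]
  refine mul_le_mul_of_nonneg_left ?_ (Nat.cast_nonneg r)
  calc ‖h⁻¹ * Xᴴ * h * X‖ ≤ ‖h⁻¹‖ * ‖Xᴴ‖ * ‖h‖ * ‖X‖ := by
        refine (norm_mul_le _ _).trans (mul_le_mul_of_nonneg_right ?_ (norm_nonneg _))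
        refine (norm_mul_le _ _).trans (mul_le_mul_of_nonneg_right ?_ (norm_nonneg _))
        exact norm_mul_le _ _
    _ = _ := by rw [Matrix.frobenius_norm_conjTranspose]; ring

theorem norm_lamForm_sq_le {h g : Mat r} (hh : h.PosDef) (hg : 0 < hInner h g g)
    (ψ₁ ψ₂ : PlaneHom (Mat r)) :
    ‖lamForm h g ψ₁ ψ₂‖ ^ 2 ≤
      2 * ((r : ℝ) * (‖h⁻¹‖ * ‖h‖)) * (‖ψ₁‖ ^ 2 + ‖ψ₂‖ ^ 2) := by
  set C := (r : ℝ) * (‖h⁻¹‖ * ‖h‖) with hC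
  have hC0 : 0 ≤ C := by positivity
  have : ‖lamForm h g ψ₁ ψ₂‖ ≤ √(2 * C * (‖ψ₁‖ ^ 2 + ‖ψ₂‖ ^ 2)) := by
    refine ContinuousLinearMap.opNorm_le_bound _ (Real.sqrt_nonneg _) fun v => ?_
    rw [← Real.sqrt_sq (norm_nonneg v), ← Real.sqrt_mul (by positivity), Real.norm_eq_abs,
      ← Real.sqrt_sq_eq_abs]
    refine Real.sqrt_le_sqrt ?_
    refine (lamForm_sq_le hh hg ψ₁ ψ₂ v).trans ?_
    have b : ∀ ψ : PlaneHom (Mat r), hInner h (ψ v) (ψ v) ≤ C * (‖ψ‖ ^ 2 * ‖v‖ ^ 2) := by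
      intro ψ
      refine (hInner_self_le h (ψ v)).trans (mul_le_mul_of_nonneg_left ?_ hC0)
      rw [← mul_pow]
      exact pow_le_pow_left₀ (norm_nonneg _) (ψ.le_opNorm v) 2
    linarith [b ψ₁, b ψ₂]
  calc ‖lamForm h g ψ₁ ψ₂‖ ^ 2 ≤ √(2 * C * (‖ψ₁‖ ^ 2 + ‖ψ₂‖ ^ 2)) ^ 2 :=
        pow_le_pow_left₀ (norm_nonneg _) this 2
    _ = _ := Real.sq_sqrt (by positivity)

/-- A continuous family of positive definite matrices on the triangle has bounded norm and bounded
inverse. -/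
theorem exists_norm_inv_mul_norm_le {h : ℂ → Mat r} (hc : ContinuousOn h tri)
    (hpos : ∀ z ∈ tri, (h z).PosDef) : ∃ C, 0 ≤ C ∧ ∀ z ∈ tri, ‖(h z)⁻¹‖ * ‖h z‖ ≤ C := by
  have hi : ContinuousOn (fun z => (h z)⁻¹) tri :=
    continuousOn_matrix_inv hc fun z hz => posDef_isUnit_det (hpos z hz)
  obtain ⟨C, hC⟩ := isCompact_tri.exists_bound_of_continuousOn (hi.norm.mul hc.norm)
  refine ⟨max C 0, le_max_right _ _, fun z hz => le_max_of_le_left ?_⟩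
  exact (le_abs_self _).trans (hC z hz)

theorem ChartData.integrableOn_lamForm_sq [NeZero r] {h g : ℂ → Mat r}
    {A₁ A₂ ψ₁ ψ₂ : ℂ → PlaneHom (Mat r)} (D : ChartData h g A₁ A₂ ψ₁ ψ₂)
    (h₁ : IntegrableOn (fun z => ‖ψ₁ z‖ ^ 2) (triInt ∩ ball 0 (3 / 4)))
    (h₂ : IntegrableOn (fun z => ‖ψ₂ z‖ ^ 2) (triInt ∩ ball 0 (3 / 4))) :
    IntegrableOn (fun z => ‖lamForm (h z) (g z) (ψ₁ z) (ψ₂ z)‖ ^ 2) (triInt ∩ ball 0 (3 / 4)) := by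
  obtain ⟨C, hC0, hC⟩ := exists_norm_inv_mul_norm_le D.h_cont D.posDef
  obtain ⟨l', hl', -⟩ := D.exists_div_lamForm
  have hm : MeasurableSet (triInt ∩ ball (0 : ℂ) (3 / 4)) :=
    (isOpen_triInt.inter isOpen_ball).measurableSet
  refine Integrable.mono' ((h₁.add h₂).const_mul (2 * ((r : ℝ) * C)))
    ((hl'.continuousOn.mono (inter_subset_left.trans triInt_subset_triStar)).norm.pow
      2 |>.aestronglyMeasurable hm) ?_
  filter_upwards [ae_restrict_mem hm] with z hz
  have hz' := triInt_subset_tri hz.1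
  rw [Real.norm_of_nonneg (by positivity)]
  refine (norm_lamForm_sq_le (D.posDef z hz') (D.hInner_pos (triInt_subset_triStar hz.1)) _ _).trans
    ?_
  refine mul_le_mul_of_nonneg_right ?_ (by positivity)
  have := hC z hz'
  gcongr

end HermitianEstimates

end HiggsComplex

namespace HiggsComplex

open MeasureTheory Set Filter Topology Metric

/-! ### Extension of identities to the open edges -/

theorem triStar_subset_closure_triInt : triStar ⊆ closure triInt := by
  intro z hz
  -- The point is approached along the segment to the barycentre, where all barycentric coordinates
  -- are 1/3.
  have hc : Tendsto (fun t : ℝ => z + t * (⟨1 / 2, √3 / 6⟩ - z)) (𝓝[>] 0) (𝓝 z) := by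
    have : Continuous fun t : ℝ => z + t * ((⟨1 / 2, √3 / 6⟩ : ℂ) - z) := by fun_prop
    have h := (this.tendsto 0).mono_left (nhdsWithin_le_nhds (s := Ioi 0))
    simpa using h
  refine mem_closure_of_tendsto hc ?_
  filter_upwards [Ioo_mem_nhdsGT (zero_lt_one' ℝ)] with t ht
  have e : ∀ i, bary i (z + t * (⟨1 / 2, √3 / 6⟩ - z)) = (1 - t) * bary i z + t * (1 / 3) := by
    intro i
    fin_cases i
    · change bary 0 _ = _ * bary 0 _ + _
      simp [bary_zero]
      linear_combination (-t / 18) * sq_sqrt_three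
    · change bary 1 _ = _ * bary 1 _ + _
      simp [bary_one]
      linear_combination (-t / 18) * sq_sqrt_three
    · change bary 2 _ = _ * bary 2 _ + _
      simp [bary_two]
      linear_combination (t / 9) * sq_sqrt_three
  intro i
  rw [e]
  have := mul_nonneg (sub_nonneg.2 ht.2.le) (hz i).1
  linarith [ht.1]

/-- Continuous functions that agree on the open triangle agree up to the open edges. -/
theorem eqOn_triStar {F : Type*} [TopologicalSpace F] [T2Space F] {f f' : ℂ → F}
    (h : EqOn f f' triInt) (hf : ContinuousOn f triStar) (hf' : ContinuousOn f' triStar) :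
    EqOn f f' triStar :=
  h.of_subset_closure hf hf' triInt_subset_triStar triStar_subset_closure_triInt

/-! ### Invariance under the transition matrices -/

section Conjugation

variable {r : ℕ}

/-- The matrix `T` is an isometry from the form `Tᴴ * h * T` to `h`, so it carries adjoints to
adjoints. Norms, inner products and `lamForm` therefore agree on all lifts. -/
theorem hAdj_conj {T h X X' : Mat r} (hT : IsUnit T.det) (hX : X * T = T * X') :
    T * hAdj (Tᴴ * h * T) X' = hAdj h X * T := by
  have hX' : X' = T⁻¹ * (X * T) := by rw [hX, Matrix.nonsing_inv_mul_cancel_left _ _ hT]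
  have h1 : (T⁻¹)ᴴ * Tᴴ = 1 := by
    rw [← Matrix.conjTranspose_mul, Matrix.mul_nonsing_inv _ hT, Matrix.conjTranspose_one]
  have h2 : (Tᴴ)⁻¹ = (T⁻¹)ᴴ := Matrix.inv_eq_left_inv h1
  have h3 : (T⁻¹)ᴴ * (Tᴴ * (Xᴴ * ((T⁻¹)ᴴ * (Tᴴ * (h * T))))) = Xᴴ * (h * T) := by
    rw [← Matrix.mul_assoc (T⁻¹)ᴴ Tᴴ (h * T), h1, Matrix.one_mul,
      ← Matrix.mul_assoc (T⁻¹)ᴴ Tᴴ, h1, Matrix.one_mul]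
  rw [hAdj, hAdj, Matrix.mul_inv_rev, Matrix.mul_inv_rev, h2, hX', Matrix.conjTranspose_mul,
    Matrix.conjTranspose_mul]
  simp only [Matrix.mul_assoc, Matrix.mul_nonsing_inv_cancel_left _ _ hT, h3]

theorem hInner_conj {T h X X' Z Z' : Mat r} (hT : IsUnit T.det) (hX : X * T = T * X')
    (hZ : Z * T = T * Z') : hInner (Tᴴ * h * T) X' Z' = hInner h X Z := by
  have e : hAdj (Tᴴ * h * T) X' * Z' = T⁻¹ * (hAdj h X * Z * T) := by
    rw [Matrix.mul_assoc _ Z T, hZ, ← Matrix.mul_assoc _ T Z', ← hAdj_conj hT hX,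
      Matrix.mul_assoc T, Matrix.nonsing_inv_mul_cancel_left _ _ hT]
  rw [hInner, hInner, e, Matrix.trace_mul_comm, Matrix.mul_assoc, Matrix.mul_nonsing_inv _ hT,
    Matrix.mul_one]

theorem lamForm_conj {T h g g' : Mat r} {ψ₁ ψ₂ ψ₁' ψ₂' : PlaneHom (Mat r)} (hT : IsUnit T.det)
    (hg : g * T = T * g') (h₁ : ∀ v, ψ₁ v * T = T * ψ₁' v) (h₂ : ∀ v, ψ₂ v * T = T * ψ₂' v) :
    lamForm (Tᴴ * h * T) g' ψ₁' ψ₂' = lamForm h g ψ₁ ψ₂ := by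
  ext1 v
  rw [lamForm_apply, lamForm_apply, hInner_conj hT hg hg, hInner_conj hT hg (Z := g * ψ₁ v - ψ₂ v * g)]
  rw [Matrix.sub_mul, Matrix.mul_sub, Matrix.mul_assoc, h₁, ← Matrix.mul_assoc g, hg,
    Matrix.mul_assoc (ψ₂ v), hg, ← Matrix.mul_assoc, h₂]
  simp only [Matrix.mul_assoc]

end Conjugation

/-! ### Vanishing of the divergence on the whole complex -/

section Vanishing

variable {V W : Type*} {X : AbstractSimplicialComplex V} {Y : AbstractSimplicialComplex W}
  {p : W → V} {r : ℕ} {E : HermitianBundle Y p r} {δ : ℝ} {g : (W → ℝ) → Mat r}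

theorem IsEndForm.conj_triStar {ψ : FormFamily W r} (h : IsEndForm E ψ) (hψ : IsSmoothForm Y ψ)
    {σ τ : Fin 3 → W} (hσ : IsTri Y σ) (hτ : IsTri Y τ) (hp : p ∘ σ = p ∘ τ) {z : ℂ}
    (hz : z ∈ triStar) (v : ℂ) :
    ψ σ z v * E.trans (chart σ z) (chart τ z) = E.trans (chart σ z) (chart τ z) * ψ τ z v := by
  have hT := (E.continuousOn_trans hσ hτ hp).mono triStar_subset_tri
  refine eqOn_triStar (f := fun z => ψ σ z v * E.trans (chart σ z) (chart τ z))
    (f' := fun z => E.trans (chart σ z) (chart τ z) * ψ τ z v) (fun z hz => ?_)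
    (((hψ.continuousOn hσ).clm_apply continuousOn_const).mul hT)
    (hT.mul ((hψ.continuousOn hτ).clm_apply continuousOn_const)) hz
  simp only [h σ τ hσ hτ hp z hz v, Matrix.mul_assoc]
  rw [Matrix.mul_nonsing_inv_cancel_left _ _ (E.isUnit_det_trans hσ hτ hp (triInt_subset_tri hz))]

variable {A₁ ψ₁ A₂ ψ₂ : FormFamily W r}

/-- The form `lamForm` does not depend on the lift of a 2-cell. -/
theorem lamForm_lift (h₁ : IsHitchinPair E δ A₁ ψ₁) (h₂ : IsHitchinPair E δ A₂ ψ₂)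
    (hg : IsComplexGauge E δ g) {σ τ : Fin 3 → W} (hσ : IsTri Y σ) (hτ : IsTri Y τ)
    (hp : p ∘ σ = p ∘ τ) {z : ℂ} (hz : z ∈ triStar) :
    lamForm (E.metric (chart τ z)) (g (chart τ z)) (ψ₁ τ z) (ψ₂ τ z) =
      lamForm (E.metric (chart σ z)) (g (chart σ z)) (ψ₁ σ z) (ψ₂ σ z) := by
  rw [E.metric_trans σ τ hσ hτ hp z (triStar_subset_tri hz)]
  exact lamForm_conj (E.isUnit_det_trans hσ hτ hp (triStar_subset_tri hz))
    (hg.equivariant σ τ hσ hτ hp z hz) (h₁.end_ψ.conj_triStar h₁.smooth_ψ hσ hτ hp hz)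
    (h₂.end_ψ.conj_triStar h₂.smooth_ψ hσ hτ hp hz)

theorem lamForm_rot (h₁ : IsSmoothForm Y ψ₁) (h₂ : IsSmoothForm Y ψ₂) {σ : Fin 3 → W}
    (hσ : IsTri Y σ) {z : ℂ} (hz : z ∈ triStar) (v : ℂ) :
    lamForm (E.metric (chart σ (rot z))) (g (chart σ (rot z))) (ψ₁ σ (rot z)) (ψ₂ σ (rot z))
      (zeta * v) =
    lamForm (E.metric (chart (cyc σ) z)) (g (chart (cyc σ) z)) (ψ₁ (cyc σ) z) (ψ₂ (cyc σ) z) v := by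
  rw [lamForm_apply, lamForm_apply, chart_rot, h₁.rot hσ hz, h₂.rot hσ hz]

/-- On an edge the metric and `g` depend only on the edge point, so the normal component is one
additive functional applied to gψ₁(i) − ψ₂(i)g for every adjacent 2-cell. Balance of the Higgs
fields passes through this functional. -/
theorem lamForm_balanced [Finite V] (hp : IsUniversalCover Y X p) (h₁ : IsBalancedForm Y ψ₁)
    (h₂ : IsBalancedForm Y ψ₂) (a b : W) {x : ℝ} (h0 : 0 < x) (hx : x < 1) :
    ∑ᶠ c ∈ {c | IsTri Y ![a, b, c]},
      lamForm (E.metric (chart ![a, b, c] x)) (g (chart ![a, b, c] x)) (ψ₁ ![a, b, c] x)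
        (ψ₂ ![a, b, c] x) Complex.I = 0 := by
  have hf := hp.finite_star a b
  set h := E.metric (chart ![a, b, b] x) with hh
  set γ := g (chart ![a, b, b] x) with hγ
  set L : Mat r →+ ℝ := AddMonoidHom.mk' (fun M => (hInner h γ γ)⁻¹ * hInner h γ M) fun M N => by
    simp [hInner, Matrix.mul_add]; ring with hL
  have e : ∀ c, lamForm (E.metric (chart ![a, b, c] x)) (g (chart ![a, b, c] x)) (ψ₁ ![a, b, c] x)
        (ψ₂ ![a, b, c] x) Complex.I =
      L (γ * ψ₁ ![a, b, c] x Complex.I - ψ₂ ![a, b, c] x Complex.I * γ) := by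
    intro c
    rw [lamForm_apply, chart_real]
    rfl
  simp only [e]
  rw [← L.map_finsum_mem _ hf, finsum_mem_sub_distrib _ _ hf]
  have e1 := (AddMonoidHom.mulLeft γ).map_finsum_mem (fun c => ψ₁ ![a, b, c] x Complex.I) hf
  have e2 := (AddMonoidHom.mulRight γ).map_finsum_mem (fun c => ψ₂ ![a, b, c] x Complex.I) hf
  simp only [AddMonoidHom.coe_mulLeft, AddMonoidHom.coe_mulRight] at e1 e2
  rw [← e1, ← e2, h₁ a b x h0 hx, h₂ a b x h0 hx]
  simp

/-- A complex gauge transformation between two solutions intertwines the Higgs fields. -/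
theorem intertwines_higgs [Finite V] [NeZero r] (hp : IsUniversalCover Y X p) (hδ : 0 ≤ δ)
    (h₁ : IsHitchinPair E δ A₁ ψ₁) (h₂ : IsHitchinPair E δ A₂ ψ₂) (hg : IsComplexGauge E δ g)
    (h : ConnectionsRelated Y g (A₁ + ψ₁) (A₂ + ψ₂)) {σ : Fin 3 → W} (hσ : IsTri Y σ) {z : ℂ}
    (hz : z ∈ triStar) (v : ℂ) : g (chart σ z) * ψ₁ σ z v = ψ₂ σ z v * g (chart σ z) := by
  have D := fun σ (hσ : IsTri Y σ) => h₁.chartData h₂ hg h hσ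
  refine eqOn_triStar (f := fun z => g (chart σ z) * ψ₁ σ z v)
    (f' := fun z => ψ₂ σ z v * g (chart σ z)) ?_
    ((hg.continuous σ hσ).mul ((h₁.smooth_ψ.continuousOn hσ).clm_apply continuousOn_const))
    (((h₂.smooth_ψ.continuousOn hσ).clm_apply continuousOn_const).mul (hg.continuous σ hσ)) hz
  intro z hz
  refine (D σ hσ).intertwines (fun z hz => ?_) hz v
  choose! l' hl' hdiv using fun σ hσ => (D σ hσ).exists_div_lamForm
  have hpos : ∀ σ (hσ : IsTri Y σ), ∀ z ∈ triInt,
      0 ≤ l' σ z 1 1 + l' σ z Complex.I Complex.I := by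
    intro σ hσ z hz
    rw [hdiv σ hσ z hz]
    exact mul_nonneg (div_nonneg zero_le_two ((D σ hσ).hInner_pos (triInt_subset_triStar hz)).le)
      (Finset.sum_nonneg fun v _ => hInner_self_nonneg ((D σ hσ).posDef z (triInt_subset_tri hz)) _)
  have hL2 : ∀ {A ψ : FormFamily W r}, IsHitchinPair E δ A ψ → ∀ σ, IsTri Y σ →
      IntegrableOn (fun z => ‖ψ σ z‖ ^ 2) (triInt ∩ ball 0 (3 / 4)) := by
    intro A ψ h σ hσ
    obtain ⟨b', -, hb, -⟩ := h.weighted_ψ σ hσ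
    exact integrableOn_sq_of_memLp ((h.smooth_ψ.continuousOn hσ).mono triInt_subset_triStar)
      (hb.mono_measure (volume_restrict_strip_le hδ))
  have := Fintype.ofFinite {τ : Fin 3 → V // IsTri X τ}
  classical
  choose lift₀ hlift₀ using fun τ : {τ : Fin 3 → V // IsTri X τ} => hp.exists_lift τ.2
  set i₀ : {τ : Fin 3 → V // IsTri X τ} := ⟨p ∘ σ, hp.isTri_map hσ⟩ with hi₀
  -- The lift of the cell below `σ` is chosen to be `σ` itself, so that the conclusion holds in the
  -- given chart; the other lifts are arbitrary.
  set lift : {τ : Fin 3 → V // IsTri X τ} → Fin 3 → W := Function.update lift₀ i₀ σ with hlift_def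
  have hlift : ∀ τ, IsTri Y (lift τ) ∧ p ∘ lift τ = τ.1 := by
    intro τ
    by_cases hτ : τ = i₀
    · subst hτ
      simpa [hlift_def, hi₀] using hσ
    · simpa [hlift_def, Function.update_of_ne hτ] using hlift₀ τ
  set l : {τ : Fin 3 → V // IsTri X τ} → ℂ → PlaneHom ℝ := fun τ z =>
    lamForm (E.metric (chart (lift τ) z)) (g (chart (lift τ) z)) (ψ₁ (lift τ) z) (ψ₂ (lift τ) z)
    with hl
  have key := div_eq_zero_of_balanced (s := fun τ => ⟨cyc τ.1, τ.2.cyc⟩) (l := l)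
    (l' := fun τ => l' (lift τ)) (fun τ => Subtype.ext (cyc_cyc_cyc τ.1))
    (fun τ => (hl' _ (hlift τ).1).continuousOn) (fun τ => (hl' _ (hlift τ).1).continuousOn_deriv)
    (fun τ => (hl' _ (hlift τ).1).hasFDerivAt) ?_ ?_
    (fun τ => (D _ (hlift τ).1).integrableOn_lamForm_sq (hL2 h₁ _ (hlift τ).1)
      (hL2 h₂ _ (hlift τ).1)) (fun τ => hpos _ (hlift τ).1) i₀ hz
  · have e0 : lift i₀ = σ := by simp [hlift_def]
    rw [e0, hdiv σ hσ z hz] at key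
    refine (mul_eq_zero.1 key).resolve_left ?_
    exact (div_pos zero_lt_two ((D σ hσ).hInner_pos (triInt_subset_triStar hz))).ne'
  · intro τ z hz v
    simp only [hl]
    rw [lamForm_rot h₁.smooth_ψ h₂.smooth_ψ (hlift τ).1 hz]
    -- The chosen lift of a rotated cell need not be the rotation of the chosen lift; independence
    -- of the lift compares the two.
    refine congrArg (fun L : PlaneHom ℝ => L v)
      (lamForm_lift h₁ h₂ hg (hlift _).1 (hlift τ).1.cyc ?_ hz)
    rw [(hlift _).2]
    change cyc τ.1 = cyc (p ∘ lift τ)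
    rw [(hlift τ).2]
  · intro x h0 hx
    refine hp.sum_eq_zero (fun σ => lamForm (E.metric (chart σ x)) (g (chart σ x)) (ψ₁ σ x)
      (ψ₂ σ x) Complex.I) ?_ ?_ lift hlift
    · intro σ σ' hσ hσ' hpσ
      rw [lamForm_lift h₁ h₂ hg hσ hσ' hpσ (ofReal_mem_triStar h0 hx)]
    · intro a b
      exact lamForm_balanced hp h₁.balanced_ψ h₂.balanced_ψ a b h0 hx

end Vanishing

end HiggsComplex

namespace HiggsComplex

open MeasureTheory Set Filter Topology Metric

/-! ### Inverse square roots as polynomials, and the polar decomposition -/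

section PolarDecomposition

open Polynomial

variable {r : ℕ}

theorem aeval_semiconj {T X Y : Mat r} (h : T * X = Y * T) (q : ℝ[X]) :
    T * aeval X q = aeval Y q * T := by
  induction q using Polynomial.induction_on' with
  | add p q hp hq => rw [map_add, map_add, Matrix.mul_add, Matrix.add_mul, hp, hq]
  | monomial n a =>
    rw [aeval_monomial, aeval_monomial, Algebra.algebraMap_eq_smul_one, smul_one_mul, smul_one_mul,
      Matrix.mul_smul, Matrix.smul_mul]
    exact congrArg (a • ·) (SemiconjBy.pow_right (show SemiconjBy T X Y from h) n)

theorem conjTranspose_aeval (X : Mat r) (q : ℝ[X]) : (aeval X q)ᴴ = aeval Xᴴ q := by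
  rw [aeval_eq_sum_range, aeval_eq_sum_range, Matrix.conjTranspose_sum]
  refine Finset.sum_congr rfl fun i _ => ?_
  rw [Matrix.conjTranspose_smul, Matrix.conjTranspose_pow, star_trivial]

/-- It is applied both to conjugate matrices and to the values of a parallel section at two points.
-/
theorem minpoly_eq_of_aeval {X Y : Mat r} (h : ∀ q : ℝ[X], aeval X q = 0 ↔ aeval Y q = 0) :
    minpoly ℝ X = minpoly ℝ Y := by
  have hX : IsIntegral ℝ X := Algebra.IsIntegral.isIntegral X
  have hY : IsIntegral ℝ Y := Algebra.IsIntegral.isIntegral Y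
  refine Polynomial.eq_of_monic_of_associated (minpoly.monic hX) (minpoly.monic hY)
    (associated_of_dvd_dvd ?_ ?_)
  · exact minpoly.dvd _ _ ((h _).2 (minpoly.aeval ℝ Y))
  · exact minpoly.dvd _ _ ((h _).1 (minpoly.aeval ℝ X))

theorem aeval_diagonal (d : Fin r → ℝ) (q : ℝ[X]) :
    aeval (Matrix.diagonal fun i => (d i : ℂ)) q = Matrix.diagonal fun i => ((q.eval (d i) : ℝ) : ℂ) := by
  induction q using Polynomial.induction_on' with
  | add p q hp hq => rw [map_add, hp, hq, Matrix.diagonal_add]; simp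
  | monomial n a =>
    rw [aeval_monomial, Algebra.algebraMap_eq_smul_one, smul_one_mul, Matrix.diagonal_pow,
      ← Matrix.diagonal_smul]
    congr 1
    funext i
    simp

/-- `H` is diagonalizable with positive eigenvalues. -/
def IsPosDiagonalizable (H : Mat r) : Prop :=
  ∃ (Q : Mat r) (d : Fin r → ℝ), IsUnit Q.det ∧ (∀ i, 0 < d i) ∧
    H * Q = Q * Matrix.diagonal fun i => (d i : ℂ)

/-- With h = BᴴB and M = BgB⁻¹, conjugation by `B` turns the matrix into MᴴM, which is positive
definite; the spectral theorem applies. -/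
theorem isPosDiagonalizable_hAdj_mul_self {h g : Mat r} (hh : h.PosDef) (hg : IsUnit g.det) :
    IsPosDiagonalizable (hAdj h g * g) := by
  obtain ⟨B, hB, rfl⟩ := PosDef.exists_conjTranspose_mul_self hh
  have hBi : IsUnit B⁻¹.det := by
    rw [Matrix.det_nonsing_inv]; exact hB.ringInverse
  set M := B * g * B⁻¹ with hM
  have hMd : IsUnit M.det := by
    rw [hM, Matrix.det_mul, Matrix.det_mul]
    exact (hB.mul hg).mul hBi
  have hMu : IsUnit M := (Matrix.isUnit_iff_isUnit_det M).2 hMd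
  have hP : (Mᴴ * M).PosDef := Matrix.PosDef.conjTranspose_mul_self M
    (Matrix.mulVec_injective_iff_isUnit.2 hMu)
  set U : Mat r := (hP.isHermitian.eigenvectorUnitary : Matrix (Fin r) (Fin r) ℂ) with hU
  have hUU : star U * U = 1 := Unitary.coe_star_mul_self hP.isHermitian.eigenvectorUnitary
  have hUd : IsUnit U.det := Matrix.isUnit_det_of_left_inverse hUU
  have spec : Mᴴ * M = U * Matrix.diagonal (fun i => (hP.isHermitian.eigenvalues i : ℂ)) * star U :=
    by
      have := hP.isHermitian.spectral_theorem
      rw [Unitary.conjStarAlgAut_apply] at this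
      exact this
  refine ⟨B⁻¹ * U, hP.isHermitian.eigenvalues, ?_, hP.eigenvalues_pos, ?_⟩
  · rw [Matrix.det_mul]; exact hBi.mul hUd
  · rw [hAdj_eq hB]
    have e1 : B⁻¹ * Mᴴ * B * g * (B⁻¹ * U) = B⁻¹ * (Mᴴ * M * U) := by
      simp only [hM, Matrix.mul_assoc]
    have e2 := congrArg (· * U) spec
    rw [Matrix.mul_assoc _ (star U) U, hUU, Matrix.mul_one] at e2
    rw [← hM, e1, e2, Matrix.mul_assoc]

/-- The real polynomial that takes the value `x ^ (-1/2)` at the eigenvalues of `H`. -/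
def invSqrtPoly (H : Mat r) : ℝ[X] :=
  Lagrange.interpolate (minpoly ℝ H).roots.toFinset id fun x => (√x)⁻¹

/-- The inverse square root of a matrix that is diagonalizable with positive eigenvalues. -/
def invSqrt (H : Mat r) : Mat r := aeval H (invSqrtPoly H)

theorem invSqrtPoly_congr {H K : Mat r} (h : minpoly ℝ H = minpoly ℝ K) :
    invSqrtPoly H = invSqrtPoly K := by
  rw [invSqrtPoly, invSqrtPoly, h]

/-- The interpolating polynomial depends only on the minimal polynomial, so both sides evaluate the
same polynomial. -/
theorem invSqrt_conj {T H K : Mat r} (hT : IsUnit T.det) (h : H * T = T * K) :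
    invSqrt H * T = T * invSqrt K := by
  have hq : ∀ q : ℝ[X], T * aeval K q = aeval H q * T := aeval_semiconj h.symm
  have hm : minpoly ℝ H = minpoly ℝ K := by
    refine minpoly_eq_of_aeval fun q => ⟨fun h0 => ?_, fun h0 => ?_⟩
    · have := hq q
      rw [h0, Matrix.zero_mul] at this
      have e := congrArg (T⁻¹ * ·) this
      simpa [Matrix.nonsing_inv_mul_cancel_left _ _ hT] using e
    · have := hq q
      rw [h0, Matrix.mul_zero] at this
      have e := congrArg (· * T⁻¹) this.symm
      simpa [Matrix.mul_nonsing_inv_cancel_right _ _ hT] using e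
  rw [invSqrt, invSqrt, invSqrtPoly_congr hm, hq]

theorem invSqrt_comm {H X : Mat r} (h : H * X = X * H) : invSqrt H * X = X * invSqrt H :=
  (aeval_semiconj h.symm _).symm

/-- The minimal polynomial annihilates the diagonal matrix, so every diagonal entry is a root, hence
an interpolation node. -/
theorem invSqrt_diag {H Q : Mat r} {d : Fin r → ℝ} (hQ : IsUnit Q.det)
    (h : H * Q = Q * Matrix.diagonal fun i => (d i : ℂ)) :
    invSqrt H * Q = Q * Matrix.diagonal fun i => (((√(d i))⁻¹ : ℝ) : ℂ) := by
  have hq : ∀ q : ℝ[X], aeval H q * Q = Q * Matrix.diagonal fun i => ((q.eval (d i) : ℝ) : ℂ) :=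
    fun q => by rw [← aeval_semiconj h.symm q, aeval_diagonal]
  have hroot : ∀ i, d i ∈ (minpoly ℝ H).roots.toFinset := by
    intro i
    have hne : minpoly ℝ H ≠ 0 := minpoly.ne_zero (Algebra.IsIntegral.isIntegral H)
    rw [Multiset.mem_toFinset, mem_roots hne, IsRoot.def]
    have e := hq (minpoly ℝ H)
    rw [minpoly.aeval, Matrix.zero_mul] at e
    have e' := congrArg (Q⁻¹ * ·) e
    simp only [Matrix.mul_zero, Matrix.nonsing_inv_mul_cancel_left _ _ hQ] at e'
    have e'' := congrFun (congrFun e' i) i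
    rw [Matrix.diagonal_apply_eq, Matrix.zero_apply] at e''
    exact_mod_cast e''.symm
  rw [invSqrt, hq]
  congr 2
  funext i
  rw [invSqrtPoly, ← Lagrange.eval_interpolate_at_node (fun x => (√x)⁻¹) (injOn_id _) (hroot i)]
  rfl

theorem IsPosDiagonalizable.invSqrt_mul_invSqrt {H : Mat r} (hH : IsPosDiagonalizable H) :
    invSqrt H * invSqrt H * H = 1 := by
  obtain ⟨Q, d, hQ, hd, h⟩ := hH
  have hS := invSqrt_diag hQ h
  have e : invSqrt H * invSqrt H * H * Q = Q := by
    rw [Matrix.mul_assoc _ H Q, h, ← Matrix.mul_assoc _ Q, Matrix.mul_assoc _ _ Q, hS,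
      ← Matrix.mul_assoc _ Q, hS]
    simp only [Matrix.mul_assoc, Matrix.diagonal_mul_diagonal]
    have : (fun i => (((√(d i))⁻¹ : ℝ) : ℂ) * (((√(d i))⁻¹ : ℝ) : ℂ) * (d i : ℂ)) = fun _ => 1 := by
      funext i
      have hpos := Real.sqrt_pos.2 (hd i)
      have : (√(d i))⁻¹ * (√(d i))⁻¹ * d i = 1 := by
        nth_rewrite 3 [← Real.mul_self_sqrt (hd i).le]
        field_simp
      exact_mod_cast this
    rw [this]
    exact (congrArg (Q * ·) Matrix.diagonal_one).trans (Matrix.mul_one Q)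
  have := congrArg (· * Q⁻¹) e
  simpa [Matrix.mul_nonsing_inv_cancel_right _ _ hQ, Matrix.mul_nonsing_inv _ hQ] using this

/-- The square of this determinant is one; as a product of positive numbers it cannot be −1. -/
theorem IsPosDiagonalizable.det_invSqrt {H : Mat r} (hH : IsPosDiagonalizable H)
    (hd : H.det = 1) : (invSqrt H).det = 1 := by
  have h2 := congrArg Matrix.det hH.invSqrt_mul_invSqrt
  rw [Matrix.det_mul, Matrix.det_mul, hd, mul_one, Matrix.det_one] at h2
  obtain ⟨Q, d, hQ, hpos, h⟩ := hH
  have e := congrArg Matrix.det (invSqrt_diag hQ h)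
  rw [Matrix.det_mul, Matrix.det_mul, mul_comm, Matrix.det_diagonal] at e
  have e' := hQ.mul_left_cancel e
  rw [← Complex.ofReal_prod] at e'
  rw [e'] at h2 ⊢
  have hp : 0 < ∏ i, (√(d i))⁻¹ :=
    Finset.prod_pos fun i _ => inv_pos.2 (Real.sqrt_pos.2 (hpos i))
  have h3 : (∏ i, (√(d i))⁻¹) * (∏ i, (√(d i))⁻¹) = 1 := by exact_mod_cast h2
  have : ∏ i, (√(d i))⁻¹ = 1 := by nlinarith
  rw [this, Complex.ofReal_one]

theorem invSqrt_selfAdjoint {h H : Mat r} (hH : Hᴴ * h = h * H) :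
    (invSqrt H)ᴴ * h = h * invSqrt H := by
  rw [invSqrt, conjTranspose_aeval, ← aeval_semiconj hH.symm]

/-- The unitary factor in the polar decomposition of `g` with respect to `h`. -/
def unitaryPart (h g : Mat r) : Mat r := g * invSqrt (hAdj h g * g)

theorem mul_hAdj_mul {h : Mat r} (hh : h.PosDef) (g : Mat r) : h * (hAdj h g * g) = gᴴ * h * g := by
  rw [hAdj]
  simp only [Matrix.mul_assoc]
  rw [Matrix.mul_nonsing_inv_cancel_left _ _ (posDef_isUnit_det hh)]

theorem conjTranspose_hAdj_mul {h : Mat r} (hh : h.PosDef) (g : Mat r) :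
    (hAdj h g * g)ᴴ * h = h * (hAdj h g * g) := by
  have h1 := congrArg Matrix.conjTranspose (mul_hAdj_mul hh g)
  rw [Matrix.conjTranspose_mul, Matrix.conjTranspose_mul (gᴴ * h), Matrix.conjTranspose_mul gᴴ,
    Matrix.conjTranspose_conjTranspose, hh.isHermitian.eq, ← Matrix.mul_assoc] at h1
  rw [h1, mul_hAdj_mul hh]

theorem det_hAdj_mul {h g : Mat r} (hh : h.PosDef) (hg : g.det = 1) : (hAdj h g * g).det = 1 := by
  have h1 := congrArg Matrix.det (mul_hAdj_mul hh g)
  rw [Matrix.det_mul, Matrix.det_mul (gᴴ * h), Matrix.det_mul gᴴ, Matrix.det_conjTranspose, hg,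
    star_one, one_mul] at h1
  exact (posDef_isUnit_det hh).mul_left_cancel h1

theorem det_unitaryPart {h g : Mat r} (hh : h.PosDef) (hg : g.det = 1) :
    (unitaryPart h g).det = 1 := by
  rw [unitaryPart, Matrix.det_mul, hg, one_mul]
  exact (isPosDiagonalizable_hAdj_mul_self hh (by rw [hg]; exact isUnit_one)).det_invSqrt
    (det_hAdj_mul hh hg)

/-- With S the inverse square root of H = g^*g, self-adjoint and commuting with H, one has
(gS)^*(gS) = SHS = S²H = 1. -/
theorem unitary_unitaryPart {h g : Mat r} (hh : h.PosDef) (hg : IsUnit g.det) :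
    (unitaryPart h g)ᴴ * h * unitaryPart h g = h := by
  set H := hAdj h g * g with hH
  have hS := invSqrt_selfAdjoint (conjTranspose_hAdj_mul hh g)
  have hc : invSqrt H * H = H * invSqrt H := invSqrt_comm rfl
  have h1 := (isPosDiagonalizable_hAdj_mul_self hh hg).invSqrt_mul_invSqrt
  rw [← hH] at h1 hS
  rw [unitaryPart, ← hH, Matrix.conjTranspose_mul]
  calc (invSqrt H)ᴴ * gᴴ * h * (g * invSqrt H)
      = (invSqrt H)ᴴ * (gᴴ * h * g) * invSqrt H := by simp only [Matrix.mul_assoc]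
    _ = ((invSqrt H)ᴴ * h) * (H * invSqrt H) := by
        rw [← mul_hAdj_mul hh]; simp only [Matrix.mul_assoc, hH]
    _ = h * (invSqrt H * invSqrt H * H) := by rw [hS, ← hc]; simp only [Matrix.mul_assoc]
    _ = h := by rw [h1, Matrix.mul_one]

theorem unitaryPart_conj {T h g g' : Mat r} (hT : IsUnit T.det) (hg : g * T = T * g') :
    unitaryPart h g * T = T * unitaryPart (Tᴴ * h * T) g' := by
  have hk : hAdj h g * T = T * hAdj (Tᴴ * h * T) g' := (hAdj_conj hT hg).symm
  have hH : hAdj h g * g * T = T * (hAdj (Tᴴ * h * T) g' * g') := by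
    rw [Matrix.mul_assoc, hg, ← Matrix.mul_assoc, hk, Matrix.mul_assoc]
  rw [unitaryPart, unitaryPart, Matrix.mul_assoc, invSqrt_conj hT hH, ← Matrix.mul_assoc, hg,
    Matrix.mul_assoc]

/-- The unitary factor intertwines all self-adjoint matrices that `g` intertwines. -/
theorem unitaryPart_intertwines {h g a b : Mat r} (hh : h.PosDef) (ha : aᴴ * h = h * a)
    (hb : bᴴ * h = h * b) (hab : g * a = b * g) :
    unitaryPart h g * a = b * unitaryPart h g := by
  -- Taking adjoints in the intertwining relation shows that `a` commutes with the adjoint of `g`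
  -- times `g`, hence with every polynomial in it.
  have h1 : a * hAdj h g = hAdj h g * b := by
    have := congrArg (hAdj h) hab
    rwa [hAdj_mul hh, hAdj_mul hh, hAdj_of_selfAdjoint hh ha, hAdj_of_selfAdjoint hh hb] at this
  have hH : hAdj h g * g * a = a * (hAdj h g * g) := by
    rw [Matrix.mul_assoc, hab, ← Matrix.mul_assoc, ← h1, Matrix.mul_assoc]
  rw [unitaryPart, Matrix.mul_assoc, invSqrt_comm hH, ← Matrix.mul_assoc, hab, Matrix.mul_assoc]

end PolarDecomposition

end HiggsComplex

namespace HiggsComplex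

open MeasureTheory Set Filter Topology Metric

theorem convex_triInt : Convex ℝ triInt := by
  intro z hz z' hz' a b ha hb hab i
  have e : ∀ i, bary i (a • z + b • z') = a * bary i z + b * bary i z' := by
    intro i
    fin_cases i
    · change bary 0 _ = _ * bary 0 _ + _ * bary 0 _
      simp [bary_zero]
      linear_combination -hab
    · change bary 1 _ = _ * bary 1 _ + _ * bary 1 _
      simp [bary_one]
      ring
    · change bary 2 _ = _ * bary 2 _ + _ * bary 2 _
      simp [bary_two]
      ring
  rw [e]
  rcases ha.eq_or_lt with rfl | ha
  · have : b = 1 := by linarith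
    rw [this]
    linarith [hz' i]
  · have := mul_pos ha (hz i)
    have := mul_nonneg hb (hz' i).le
    linarith

/-- A function on the triangle whose derivative vanishes is constant. -/
theorem HasTriDeriv.eq_of_deriv_eq_zero {f : ℂ → ℝ} {f' : ℂ → PlaneHom ℝ} (h : HasTriDeriv f f')
    (h0 : ∀ z ∈ triInt, f' z = 0) {z z' : ℂ} (hz : z ∈ triStar) (hz' : z' ∈ triStar) :
    f z = f z' := by
  obtain ⟨z₀, hz₀⟩ : triInt.Nonempty :=
    closure_nonempty_iff.1 ⟨z, triStar_subset_closure_triInt hz⟩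
  have hc : EqOn f (fun _ => f z₀) triStar := by
    refine eqOn_triStar (fun y hy => ?_) h.continuousOn continuousOn_const
    refine isOpen_triInt.is_const_of_fderiv_eq_zero convex_triInt.isPreconnected
      (fun y hy => (h.hasFDerivAt y hy).differentiableAt.differentiableWithinAt)
      (fun y hy => ?_) hy hz₀
    rw [(h.hasFDerivAt y hy).fderiv, h0 y hy, Pi.zero_apply]
  exact (hc hz).trans (hc hz').symm

theorem HasTriDeriv.congr {F : Type*} [NormedAddCommGroup F] [NormedSpace ℝ F] {f k : ℂ → F}
    {f' : ℂ → PlaneHom F} (h : HasTriDeriv f f') (he : EqOn k f triStar) : HasTriDeriv k f' :=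
  ⟨h.continuousOn.congr he, h.continuousOn_deriv, fun z hz =>
    (h.hasFDerivAt z hz).congr_of_eventuallyEq <| by
      filter_upwards [isOpen_triInt.mem_nhds hz] with y hy using he (triInt_subset_triStar hy)⟩

/-! ### Parallel sections and differentiability of the unitary factor -/

section Parallel

open Polynomial

variable {r : ℕ} {h g : ℂ → Mat r} {A A₁ A₂ : ℂ → PlaneHom (Mat r)}

/-- `X` is a parallel section of the endomorphisms for the connection `d + A`. -/
def IsParallel (A : ℂ → PlaneHom (Mat r)) (X : ℂ → Mat r) : Prop :=
  HasTriDeriv X fun z => lmul (X z) (A z) - rmul (X z) (A z)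

/-- Commutation with A is a derivation, so parallel sections form a real algebra. -/
theorem IsParallel.aeval {X : ℂ → Mat r} (hA : ContinuousOn A triStar) (hX : IsParallel A X)
    (q : ℝ[X]) : IsParallel A fun z => aeval (X z) q := by
  have hconst : ∀ c : ℝ, IsParallel A fun _ => c • (1 : Mat r) := by
    intro c
    have hc : ContinuousOn (fun _ : ℂ => c • (1 : Mat r)) triStar := continuousOn_const
    refine ⟨hc, (lmul_continuousOn hc hA).sub (rmul_continuousOn hc hA), fun z _ => ?_⟩
    refine (hasFDerivAt_const _ z).congr_fderiv ?_
    ext1 v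
    simp
  have hmul : ∀ {Z Z' : ℂ → Mat r}, IsParallel A Z → IsParallel A Z' →
      IsParallel A fun z => Z z * Z' z := by
    intro Z Z' hZ hZ'
    have hm := HasTriDeriv.mul hZ hZ'
    refine hm.congr_deriv ((lmul_continuousOn hm.continuousOn hA).sub
      (rmul_continuousOn hm.continuousOn hA)) fun z hz v => ?_
    simp only [_root_.add_apply, _root_.sub_apply, lmul_apply, rmul_apply]
    noncomm_ring
  induction q using Polynomial.induction_on with
  | C a =>
    simp only [aeval_C, Algebra.algebraMap_eq_smul_one]
    exact hconst a
  | add p q hp hq =>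
    have hm := HasTriDeriv.add hp hq
    simp only [map_add]
    refine hm.congr_deriv ((lmul_continuousOn hm.continuousOn hA).sub
      (rmul_continuousOn hm.continuousOn hA)) fun z hz v => ?_
    simp only [_root_.add_apply, _root_.sub_apply, lmul_apply, rmul_apply]
    noncomm_ring
  | monomial n a ih =>
    have e : (fun z => Polynomial.aeval (X z) (C a * Polynomial.X ^ (n + 1))) =
        fun z => Polynomial.aeval (X z) (C a * Polynomial.X ^ n) * X z := by
      funext z
      simp only [map_mul, aeval_C, map_pow, aeval_X, pow_succ, mul_assoc]
    rw [e]
    exact hmul ih hX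

/-- The norm of a parallel section is constant. -/
theorem IsParallel.eq_zero {X : ℂ → Mat r} (hpos : ∀ z ∈ tri, (h z).PosDef)
    (hA : IsUnitaryOn h A) (hX : IsParallel A X) {z z' : ℂ} (hz : z ∈ triStar)
    (hz' : z' ∈ triStar) (h0 : X z = 0) : X z' = 0 := by
  have hk := hasTriDeriv_hAdj (ψ₁ := 0) (ψ₂ := 0) (g := X) hpos hA hA continuousOn_const
    continuousOn_const (by simp) (by simp) (by simpa [IsParallel] using hX)
  have hf : HasTriDeriv (fun z => hInner (h z) (X z) (X z)) _ := (hk.mul hX).clm reTr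
  have hc := hf.eq_of_deriv_eq_zero (fun z hz => ?_) hz hz'
  · simp only [h0] at hc
    refine hInner_self_eq_zero (hpos z' (triStar_subset_tri hz')) (hc.symm.trans ?_)
    simp [hInner]
  · ext1 v
    change (Matrix.trace (hAdj (h z) (X z) * (X z * A z v - A z v * X z) +
      ((0 : Mat r) * hAdj (h z) (X z) - hAdj (h z) (X z) * (0 : Mat r) - A z v * hAdj (h z) (X z) +
        hAdj (h z) (X z) * A z v) * X z)).re = 0
    simp only [Matrix.zero_mul, Matrix.mul_zero, sub_zero, zero_sub, Matrix.mul_sub, Matrix.add_mul,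
      Matrix.neg_mul, Matrix.trace_add, Matrix.trace_sub, Matrix.trace_neg]
    have e1 : Matrix.trace (hAdj (h z) (X z) * (X z * A z v)) =
        Matrix.trace (A z v * hAdj (h z) (X z) * X z) := by
      rw [← Matrix.mul_assoc, Matrix.trace_mul_comm, Matrix.mul_assoc]
    have e2 : hAdj (h z) (X z) * (A z v * X z) = hAdj (h z) (X z) * A z v * X z :=
      (Matrix.mul_assoc _ _ _).symm
    rw [e1, e2]
    simp

/-- For each real polynomial q the section q(H) is parallel, so it vanishes everywhere or nowhere.
The minimal polynomial is thus constant, and the interpolating polynomial at the single point 1/2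
serves the whole triangle. -/
theorem IsParallel.invSqrt {H : ℂ → Mat r} (hpos : ∀ z ∈ tri, (h z).PosDef)
    (hA : IsUnitaryOn h A) (hH : IsParallel A H) : IsParallel A fun z => invSqrt (H z) := by
  have hm : ∀ z ∈ triStar, ∀ z' ∈ triStar, minpoly ℝ (H z) = minpoly ℝ (H z') := by
    intro z hz z' hz'
    exact minpoly_eq_of_aeval fun q =>
      ⟨(hH.aeval hA.continuousOn q).eq_zero hpos hA hz hz',
        (hH.aeval hA.continuousOn q).eq_zero hpos hA hz' hz⟩
  have h0 : ((1 / 2 : ℝ) : ℂ) ∈ triStar := ofReal_mem_triStar (by norm_num) (by norm_num)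
  have he : EqOn (fun z => HiggsComplex.invSqrt (H z))
      (fun z => Polynomial.aeval (H z) (invSqrtPoly (H ((1 / 2 : ℝ) : ℂ)))) triStar := by
    intro z hz
    simp only [HiggsComplex.invSqrt, invSqrtPoly_congr (hm z hz _ h0)]
  have hq := hH.aeval hA.continuousOn (invSqrtPoly (H ((1 / 2 : ℝ) : ℂ)))
  have hk := HasTriDeriv.congr hq he
  refine hk.congr_deriv ((lmul_continuousOn hk.continuousOn hA.continuousOn).sub
    (rmul_continuousOn hk.continuousOn hA.continuousOn)) fun z hz v => ?_
  have e := he (triInt_subset_triStar hz)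
  simp only at e ⊢
  rw [e]

/-- The unitary part of a gauge transformation between unitary connections is again one. -/
theorem hasTriDeriv_unitaryPart (hpos : ∀ z ∈ tri, (h z).PosDef) (hA₁ : IsUnitaryOn h A₁)
    (hA₂ : IsUnitaryOn h A₂)
    (hg : HasTriDeriv g fun z => lmul (g z) (A₁ z) - rmul (g z) (A₂ z)) :
    HasTriDeriv (fun z => unitaryPart (h z) (g z)) fun z =>
      lmul (unitaryPart (h z) (g z)) (A₁ z) - rmul (unitaryPart (h z) (g z)) (A₂ z) := by
  -- With zero Higgs fields the adjoint k of `g` satisfies dk = kA₂ − A₁k, so in the derivative of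
  -- kg the terms with A₂ cancel and kg is parallel for A₁.
  have hk := hasTriDeriv_hAdj (ψ₁ := 0) (ψ₂ := 0) (g := g) hpos hA₁ hA₂ continuousOn_const
    continuousOn_const (by simp) (by simp) (by simpa using hg)
  have hm := hk.mul hg
  have hH : IsParallel A₁ fun z => hAdj (h z) (g z) * g z := by
    refine hm.congr_deriv ((lmul_continuousOn hm.continuousOn hA₁.continuousOn).sub
      (rmul_continuousOn hm.continuousOn hA₁.continuousOn)) fun z hz v => ?_
    simp only [_root_.add_apply, _root_.sub_apply, lmul_apply, rmul_apply, Pi.zero_apply, map_zero,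
      _root_.zero_apply]
    noncomm_ring
  have hu := hg.mul (hH.invSqrt hpos hA₁)
  refine hu.congr_deriv ((lmul_continuousOn hu.continuousOn hA₁.continuousOn).sub
      (rmul_continuousOn hu.continuousOn hA₂.continuousOn)) fun z hz v => ?_
  simp only [_root_.add_apply, _root_.sub_apply, lmul_apply, rmul_apply, unitaryPart]
  noncomm_ring

end Parallel

end HiggsComplex

namespace HiggsComplex

open MeasureTheory Set Filter Topology Metric

/-! ### The weighted embedding of L²_{1,δ} into L⁴_δ -/

section SobolevEmbedding

/-- The bound |f(x)| ≤ |f(y)| + ∫|f'| is averaged over `y` in an interval of length one. -/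
theorem enorm_le_lintegral_enorm_add {J : Set ℝ} (hJ : J.OrdConnected) {a : ℝ}
    (ha : Ioo a (a + 1) ⊆ J) {f f' : ℝ → ℝ} (hd : ∀ x ∈ J, HasDerivAt f (f' x) x)
    (hc : ContinuousOn f' J) {x : ℝ} (hx : x ∈ J) :
    ‖f x‖ₑ ≤ ∫⁻ y in J, (‖f y‖ₑ + ‖f' y‖ₑ) := by
  have key : ∀ y ∈ J, ‖f x‖ₑ ≤ ‖f y‖ₑ + ∫⁻ s in J, ‖f' s‖ₑ := by
    intro y hy
    have hsub : uIcc y x ⊆ J := hJ.uIcc_subset hy hx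
    have e := intervalIntegral.integral_eq_sub_of_hasDerivAt (fun s hs => hd s (hsub hs))
      (hc.mono hsub).intervalIntegrable
    have : f x = f y + (f x - f y) := by ring
    rw [this]
    refine (enorm_add_le _ _).trans (add_le_add le_rfl ?_)
    rw [← e]
    have h1 : ‖∫ s in y..x, f' s‖ₑ = ‖∫ s in uIoc y x, f' s‖ₑ := by
      rw [← ofReal_norm, ← ofReal_norm, intervalIntegral.norm_intervalIntegral_eq]
    rw [h1]
    exact (enorm_integral_le_lintegral_enorm _).trans
      (lintegral_mono_set (uIoc_subset_uIcc.trans hsub))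
  have hv : volume (Ioo a (a + 1)) = 1 := by rw [Real.volume_Ioo]; simp
  calc ‖f x‖ₑ = ∫⁻ _ in Ioo a (a + 1), ‖f x‖ₑ := by rw [setLIntegral_const, hv, mul_one]
    _ ≤ ∫⁻ y in Ioo a (a + 1), (‖f y‖ₑ + ∫⁻ s in J, ‖f' s‖ₑ) :=
        setLIntegral_mono' measurableSet_Ioo fun y hy => key y (ha hy)
    _ = (∫⁻ y in Ioo a (a + 1), ‖f y‖ₑ) + ∫⁻ s in J, ‖f' s‖ₑ := by
        rw [lintegral_add_right _ measurable_const, setLIntegral_const, hv, mul_one]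
    _ ≤ (∫⁻ y in J, ‖f y‖ₑ) + ∫⁻ s in J, ‖f' s‖ₑ := add_le_add (lintegral_mono_set ha) le_rfl
    _ ≤ _ := le_lintegral_add _ _

/-- One factor of g² is bounded by a function of x alone and the other by a function of y alone, so
the double integral factors. -/
theorem lintegral_sq_lt_top_of_slices {g k : ℝ × ℝ → ENNReal} (hk : Measurable k)
    (h1 : ∀ x y, g (x, y) ≤ ∫⁻ y', k (x, y')) (h2 : ∀ x y, g (x, y) ≤ ∫⁻ x', k (x', y))
    (hi : ∫⁻ q, k q < ⊤) : ∫⁻ q, g q ^ 2 < ⊤ := by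
  calc ∫⁻ q, g q ^ 2
      ≤ ∫⁻ q : ℝ × ℝ, (∫⁻ y', k (q.1, y')) * (∫⁻ x', k (x', q.2)) := by
        refine lintegral_mono fun q => ?_
        rw [sq]
        exact mul_le_mul' (h1 q.1 q.2) (h2 q.1 q.2)
    _ = (∫⁻ x, ∫⁻ y', k (x, y')) * ∫⁻ y, ∫⁻ x', k (x', y) :=
        lintegral_prod_mul hk.lintegral_prod_right'.aemeasurable
          hk.lintegral_prod_left'.aemeasurable
    _ < ⊤ := by
        have e1 := lintegral_prod (μ := volume) (ν := volume) k hk.aemeasurable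
        have e2 := lintegral_prod_symm (μ := volume) (ν := volume) k hk.aemeasurable
        rw [← e1, ← e2]
        exact ENNReal.mul_lt_top hi hi

/-- The embedding of `W^{1,1}` into `L²` on the strip. -/
theorem integrableOn_sq_strip {G : ℂ → ℝ} {G' : ℂ → PlaneHom ℝ}
    (hd : ∀ w ∈ strip, HasFDerivAt G (G' w) w) (hc : ContinuousOn G' strip)
    (hG : IntegrableOn G strip) (hG' : IntegrableOn G' strip) :
    IntegrableOn (fun w => G w ^ 2) strip := by
  classical
  have hGc : ContinuousOn G strip := fun w hw => (hd w hw).continuousAt.continuousWithinAt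
  have hms := isOpen_strip.measurableSet
  refine ⟨(hGc.pow 2).aestronglyMeasurable hms, ?_⟩
  rw [hasFiniteIntegral_iff_enorm]
  set k : ℂ → ENNReal := strip.indicator fun w => ‖G w‖ₑ + ‖G' w‖ₑ with hk
  have hkm : Measurable k := by
    rw [hk, ← piecewise_eq_indicator]
    exact (hGc.enorm.add hc.enorm).measurable_piecewise continuousOn_const hms
  have hkm' : Measurable fun q : ℝ × ℝ => k ⟨q.1, q.2⟩ := hkm.comp continuous_mk.measurable
  have hfin : ∫⁻ q : ℝ × ℝ, k ⟨q.1, q.2⟩ < ⊤ := by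
    rw [← lintegral_complex_eq k, hk, lintegral_indicator hms,
      lintegral_add_left' hG.1.enorm]
    exact ENNReal.add_lt_top.2 ⟨hasFiniteIntegral_iff_enorm.1 hG.2,
      hasFiniteIntegral_iff_enorm.1 hG'.2⟩
  have hdir : ∀ w v : ℂ, ‖v‖ = 1 → ‖G' w v‖ₑ ≤ ‖G' w‖ₑ := by
    intro w v hv
    rw [← ofReal_norm, ← ofReal_norm]
    refine ENNReal.ofReal_le_ofReal ?_
    simpa [hv] using (G' w).le_opNorm v
  -- The slices in the angular direction have length π/3 > 1, so they contain the unit interval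
  -- required by the one-dimensional estimate.
  have hpi := Real.pi_gt_three
  have key := lintegral_sq_lt_top_of_slices
    (g := fun q => strip.indicator (fun w => ‖G w‖ₑ) ⟨q.1, q.2⟩) hkm' ?_ ?_ hfin
  · rw [← lintegral_indicator hms, lintegral_complex_eq]
    refine lt_of_le_of_lt (lintegral_mono fun q => ?_) key
    by_cases hq : (⟨q.1, q.2⟩ : ℂ) ∈ strip
    · simp only [indicator_of_mem hq]
      rw [enorm_pow]
    · simp only [indicator_of_notMem hq]
      exact zero_le
  · intro x y
    by_cases hq : (⟨x, y⟩ : ℂ) ∈ strip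
    · simp only [indicator_of_mem hq]
      have hJ : ∀ y' ∈ Ioo 0 (Real.pi / 3), (⟨x, y'⟩ : ℂ) ∈ strip := fun y' hy' =>
        ⟨hq.1, hy'.1, hy'.2⟩
      have b := enorm_le_lintegral_enorm_add (f := fun y => G ⟨x, y⟩)
        (f' := fun y => G' ⟨x, y⟩ Complex.I) (J := Ioo 0 (Real.pi / 3)) (a := 0) ordConnected_Ioo
        (Ioo_subset_Ioo le_rfl (by linarith)) (fun y' hy' => hasDerivAt_mk_right (hd _ (hJ y' hy')))
        ((hc.comp (continuous_mk.comp (Continuous.prodMk_right x)).continuousOn hJ).clm_apply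
          continuousOn_const) (x := y) ⟨hq.2.1, hq.2.2⟩
      refine b.trans ?_
      rw [← lintegral_indicator measurableSet_Ioo]
      refine lintegral_mono fun y' => ?_
      by_cases hy' : y' ∈ Ioo 0 (Real.pi / 3)
      · rw [indicator_of_mem hy', hk, indicator_of_mem (hJ y' hy')]
        exact add_le_add le_rfl (hdir _ _ (by simp))
      · rw [indicator_of_notMem hy']; exact zero_le
    · simp only [indicator_of_notMem hq]
      exact zero_le
  · intro x y
    by_cases hq : (⟨x, y⟩ : ℂ) ∈ strip
    · simp only [indicator_of_mem hq]
      have hJ : ∀ x' ∈ Iio (Real.log (3 / 4)), (⟨x', y⟩ : ℂ) ∈ strip := fun x' hx' =>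
        ⟨hx', hq.2.1, hq.2.2⟩
      have b := enorm_le_lintegral_enorm_add (f := fun x => G ⟨x, y⟩)
        (f' := fun x => G' ⟨x, y⟩ 1) (J := Iio (Real.log (3 / 4))) (a := Real.log (3 / 4) - 1)
        ordConnected_Iio (fun s hs => by simpa using hs.2)
        (fun x' hx' => hasDerivAt_mk_left (hd _ (hJ x' hx')))
        ((hc.comp (continuous_mk.comp (Continuous.prodMk_left y)).continuousOn hJ).clm_apply
          continuousOn_const) (x := x) hq.1
      refine b.trans ?_
      rw [← lintegral_indicator measurableSet_Iio]
      refine lintegral_mono fun x' => ?_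
      by_cases hx' : x' ∈ Iio (Real.log (3 / 4))
      · rw [indicator_of_mem hx', hk, indicator_of_mem (hJ x' hx')]
        exact add_le_add le_rfl (hdir _ _ (by simp))
      · rw [indicator_of_notMem hx']; exact zero_le
    · simp only [indicator_of_notMem hq]
      exact zero_le

theorem integrable_stripMeasure_iff {δ : ℝ} {f : ℂ → ℝ} :
    Integrable f (stripMeasure δ) ↔ IntegrableOn (fun w => f w * Real.exp (-w.re * δ)) strip := by
  rw [stripMeasure, integrable_withDensity_iff (by fun_prop) (by simp), IntegrableOn]
  simp only [ENNReal.toReal_ofReal (Real.exp_nonneg _)]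

theorem stripMeasure_absolutelyContinuous (δ : ℝ) : stripMeasure δ ≪ volume.restrict strip :=
  withDensity_absolutelyContinuous _ _

theorem aestronglyMeasurable_stripMeasure {F : Type*} [NormedAddCommGroup F] {f : ℂ → F}
    (hf : ContinuousOn f strip) (δ : ℝ) : AEStronglyMeasurable f (stripMeasure δ) := by
  classical
  refine AEStronglyMeasurable.mono_ac (stripMeasure_absolutelyContinuous δ) ?_
  exact hf.aestronglyMeasurable isOpen_strip.measurableSet

theorem ae_stripMeasure_mem (δ : ℝ) : ∀ᵐ w ∂(stripMeasure δ), w ∈ strip :=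
  (stripMeasure_absolutelyContinuous δ).ae_le (ae_restrict_mem isOpen_strip.measurableSet)

/-- The embedding is applied to G = f² e^{tδ}: its derivative is integrable because f and f' are in
the weighted L², and G² = f⁴ e^{2tδ} dominates f⁴ e^{tδ} since t > 0 and δ ≥ 0. -/
theorem memLp_four_real {δ : ℝ} (hδ : 0 ≤ δ) {f : ℂ → ℝ} {f' : ℂ → PlaneHom ℝ}
    (hd : ∀ w ∈ strip, HasFDerivAt f (f' w) w) (hc : ContinuousOn f' strip)
    (h : MemLp f 2 (stripMeasure δ)) (h' : MemLp f' 2 (stripMeasure δ)) :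
    MemLp f 4 (stripMeasure δ) := by
  have hms := isOpen_strip.measurableSet
  have hfc : ContinuousOn f strip := fun w hw => (hd w hw).continuousAt.continuousWithinAt
  have hsq := integrable_stripMeasure_iff.1 (h.integrable_norm_pow (by norm_num))
  have hsq' := integrable_stripMeasure_iff.1 (h'.integrable_norm_pow (by norm_num))
  set e : ℂ → ℝ := fun w => Real.exp (-w.re * δ) with he
  set e' : ℂ → PlaneHom ℝ := fun w => e w • ((-δ) • Complex.reCLM) with he'
  have hec : Continuous e := by rw [he]; fun_prop
  have hde : ∀ w, HasFDerivAt e (e' w) w := by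
    intro w
    have h1 : HasFDerivAt (fun w : ℂ => -w.re * δ) ((-δ) • Complex.reCLM) w := by
      have := (Complex.reCLM.hasFDerivAt (x := w)).const_mul (-δ)
      refine this.congr_of_eventuallyEq (Eventually.of_forall fun y => ?_)
      simp [mul_comm]
    exact h1.exp
  set G : ℂ → ℝ := fun w => f w * f w * e w with hGdef
  have hdG : ∀ w ∈ strip, HasFDerivAt G
      ((f w * f w) • e' w + e w • (f w • f' w + f w • f' w)) w := fun w hw =>
    ((hd w hw).mul (hd w hw)).mul (hde w)
  have he'c : Continuous e' := hec.smul continuous_const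
  have hcG : ContinuousOn (fun w => (f w * f w) • e' w + e w • (f w • f' w + f w • f' w)) strip :=
    ((hfc.mul hfc).smul he'c.continuousOn).add
      (hec.continuousOn.smul ((hfc.smul hc).add (hfc.smul hc)))
  have hGi : IntegrableOn G strip := by
    refine hsq.congr (Eventually.of_forall fun w => ?_)
    simp only [hGdef, he, Real.norm_eq_abs, sq, abs_mul_abs_self]
  have hG'i : IntegrableOn
      (fun w => (f w * f w) • e' w + e w • (f w • f' w + f w • f' w)) strip := by
    refine Integrable.mono' ((hsq.const_mul (δ + 1)).add hsq') (hcG.aestronglyMeasurable hms)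
      (Eventually.of_forall fun w => ?_)
    have hew : 0 < e w := Real.exp_pos _
    have n1 : ‖e' w‖ ≤ e w * δ := by
      rw [he', norm_smul, norm_smul, Real.norm_of_nonneg hew.le, Complex.reCLM_norm, mul_one,
        norm_neg, Real.norm_of_nonneg hδ]
    have n2 : ‖f w • f' w‖ = ‖f w‖ * ‖f' w‖ := norm_smul _ _
    calc ‖(f w * f w) • e' w + e w • (f w • f' w + f w • f' w)‖
        ≤ ‖f w‖ ^ 2 * (e w * δ) + e w * (2 * (‖f w‖ * ‖f' w‖)) := by
          refine (norm_add_le _ _).trans (add_le_add ?_ ?_)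
          · rw [norm_smul, norm_mul, ← sq]
            exact mul_le_mul_of_nonneg_left n1 (by positivity)
          · rw [norm_smul, Real.norm_of_nonneg hew.le]
            refine mul_le_mul_of_nonneg_left ?_ hew.le
            refine (norm_add_le _ _).trans ?_
            rw [n2]; linarith
      _ ≤ (δ + 1) * (‖f w‖ ^ 2 * e w) + ‖f' w‖ ^ 2 * e w := by
          nlinarith [mul_nonneg hew.le (sq_nonneg (‖f w‖ - ‖f' w‖))]
  have key := integrableOn_sq_strip hdG hcG hGi hG'i
  rw [← integrable_norm_rpow_iff h.1 (by norm_num) (by norm_num)]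
  have h4 : (fun w => ‖f w‖ ^ (4 : ENNReal).toReal) = fun w => f w ^ 4 := by
    funext w
    rw [show (4 : ENNReal).toReal = ((4 : ℕ) : ℝ) by norm_num, Real.rpow_natCast,
      Real.norm_eq_abs, Even.pow_abs (by decide)]
  rw [h4, integrable_stripMeasure_iff]
  refine Integrable.mono' key ((hfc.pow 4).mul hec.continuousOn |>.aestronglyMeasurable hms) ?_
  filter_upwards [ae_restrict_mem hms] with w hw
  have hre : w.re ≤ 0 := hw.1.le.trans (Real.log_nonpos (by norm_num) (by norm_num))
  have h1 : 1 ≤ Real.exp (-w.re * δ) := Real.one_le_exp (by nlinarith)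
  rw [Real.norm_of_nonneg (by positivity)]
  simp only [hGdef, he]
  nlinarith [mul_nonneg (by positivity : 0 ≤ f w ^ 4 * Real.exp (-w.re * δ)) (sub_nonneg.2 h1)]

/-- The embedding of `L²_{1,δ}` into `L⁴_δ`, for smooth functions. -/
theorem memLp_four {F : Type*} [NormedAddCommGroup F] [NormedSpace ℝ F] [FiniteDimensional ℝ F]
    {δ : ℝ} (hδ : 0 ≤ δ) {f : ℂ → F} {f' : ℂ → PlaneHom F}
    (hd : ∀ w ∈ strip, HasFDerivAt f (f' w) w) (hc : ContinuousOn f' strip)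
    (h : MemLp f 2 (stripMeasure δ)) (h' : MemLp f' 2 (stripMeasure δ)) :
    MemLp f 4 (stripMeasure δ) := by
  set b := Module.finBasis ℝ F with hb
  set ℓ : Fin (Module.finrank ℝ F) → F →L[ℝ] ℝ := fun i => LinearMap.toContinuousLinearMap (b.coord i)
    with hℓ
  have hi : ∀ i, MemLp (fun w => ℓ i (f w)) 4 (stripMeasure δ) := by
    intro i
    refine memLp_four_real hδ (f' := fun w => (ℓ i).comp (f' w))
      (fun w hw => (ℓ i).hasFDerivAt.comp w (hd w hw)) (continuousOn_const.clm_comp hc)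
      ((ℓ i).comp_memLp' h) ?_
    exact (ContinuousLinearMap.compL ℝ ℂ F ℝ (ℓ i)).comp_memLp' h'
  have hs : MemLp (fun w => ∑ i, ℓ i (f w) • b i) 4 (stripMeasure δ) := by
    refine memLp_finsetSum _ fun i _ => ?_
    exact ((ContinuousLinearMap.toSpanSingleton ℝ (b i)).comp_memLp' (hi i))
  refine hs.ae_eq (Eventually.of_forall fun w => ?_)
  exact b.sum_repr (f w)

end SobolevEmbedding

end HiggsComplex

namespace HiggsComplex

open MeasureTheory Set Filter Topology Metric

/-! ### Weighted estimates for the derivative of a bounded gauge transformation -/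

section StripJets

variable {F G H : Type*} [NormedAddCommGroup F] [NormedSpace ℝ F] [NormedAddCommGroup G]
  [NormedSpace ℝ G] [NormedAddCommGroup H] [NormedSpace ℝ H]

/-- `f` is continuously differentiable on the strip, and `f` and its derivative `f'` are continuous
up to the edge `θ = 0`. -/
structure HasStripDeriv (f : ℂ → F) (f' : ℂ → PlaneHom F) : Prop where
  continuousOn : ContinuousOn f edgeStrip
  continuousOn_deriv : ContinuousOn f' edgeStrip
  hasFDerivAt : ∀ w ∈ strip, HasFDerivAt f (f' w) w

theorem HasTriDeriv.logFun {f : ℂ → F} {f' : ℂ → PlaneHom F} (h : HasTriDeriv f f') :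
    HasStripDeriv (logFun f) (logForm f') :=
  ⟨continuousOn_logFun h.continuousOn, continuousOn_logForm h.continuousOn_deriv,
    fun _ hw => h.hasFDerivAt_logFun hw⟩

theorem HasStripDeriv.bilin {f : ℂ → F} {f' : ℂ → PlaneHom F} {g : ℂ → G} {g' : ℂ → PlaneHom G}
    (hf : HasStripDeriv f f') (hg : HasStripDeriv g g') (B : F →L[ℝ] G →L[ℝ] H) :
    HasStripDeriv (fun z => B (f z) (g z))
      (fun z => B.precompR ℂ (f z) (g' z) + B.precompL ℂ (f' z) (g z)) := by
  refine ⟨(B.continuous.comp_continuousOn hf.continuousOn).clm_apply hg.continuousOn, ?_,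
    fun z hz => B.hasFDerivAt_of_bilinear (hf.hasFDerivAt z hz) (hg.hasFDerivAt z hz)⟩
  exact (((B.precompR ℂ).continuous.comp_continuousOn hf.continuousOn).clm_apply
    hg.continuousOn_deriv).add
    (((B.precompL ℂ).continuous.comp_continuousOn hf.continuousOn_deriv).clm_apply hg.continuousOn)

theorem HasStripDeriv.sub {f g : ℂ → F} {f' g' : ℂ → PlaneHom F}
    (hf : HasStripDeriv f f') (hg : HasStripDeriv g g') :
    HasStripDeriv (fun z => f z - g z) (fun z => f' z - g' z) :=
  ⟨hf.continuousOn.sub hg.continuousOn, hf.continuousOn_deriv.sub hg.continuousOn_deriv,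
    fun z hz => (hf.hasFDerivAt z hz).sub (hg.hasFDerivAt z hz)⟩

theorem HasStripDeriv.hasWeakDeriv {f : ℂ → F} {f' : ℂ → PlaneHom F} (h : HasStripDeriv f f') :
    HasWeakDeriv strip f f' :=
  hasWeakDeriv_of_hasFDerivAt isOpen_strip h.hasFDerivAt
    (h.continuousOn_deriv.mono strip_subset_edgeStrip)

theorem hasStripDeriv_exp : HasStripDeriv (fun w => ContinuousLinearMap.mul ℝ ℂ (Complex.exp w))
    fun w => (ContinuousLinearMap.mul ℝ ℂ).comp (ContinuousLinearMap.mul ℝ ℂ (Complex.exp w)) := by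
  have hc : Continuous fun w => ContinuousLinearMap.mul ℝ ℂ (Complex.exp w) :=
    (ContinuousLinearMap.mul ℝ ℂ).continuous.comp Complex.continuous_exp
  exact ⟨hc.continuousOn, (continuous_const.clm_comp hc).continuousOn, fun w _ =>
    (ContinuousLinearMap.mul ℝ ℂ).hasFDerivAt.comp w (hasFDerivAt_exp_real w)⟩

theorem HasTriDeriv.exists_logForm {η : ℂ → PlaneHom F} {η' : ℂ → PlaneHom (PlaneHom F)}
    (h : HasTriDeriv η η') : ∃ a', HasStripDeriv (logForm η) a' :=
  ⟨_, h.logFun.bilin hasStripDeriv_exp (ContinuousLinearMap.compL ℝ ℂ ℂ F)⟩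

/-- By uniqueness of weak derivatives, the integrable one given by the hypothesis is the classical
one almost everywhere. -/
theorem HasStripDeriv.memLp_deriv [CompleteSpace F] {δ : ℝ} {f : ℂ → F} {f' f'' : ℂ → PlaneHom F}
    (h : HasStripDeriv f f') (h' : HasWeightedDeriv δ f f'') : MemLp f' 2 (stripMeasure δ) :=
  h'.2.2.ae_eq ((stripMeasure_absolutelyContinuous δ).ae_le
    (h'.1.ae_eq isOpen_strip h.hasWeakDeriv))

theorem memLp_bilin_of_bounded {δ M : ℝ} {q : ENNReal} (B : F →L[ℝ] G →L[ℝ] H) {f : ℂ → F}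
    {g : ℂ → G} (hf : ContinuousOn f edgeStrip) (hg : ContinuousOn g edgeStrip)
    (hM : ∀ w ∈ strip, ‖f w‖ ≤ M) (h : MemLp g q (stripMeasure δ)) :
    MemLp (fun w => B (f w) (g w)) q (stripMeasure δ) := by
  refine h.of_le_mul (c := ‖B‖ * M) (aestronglyMeasurable_stripMeasure
    (((B.continuous.comp_continuousOn hf).clm_apply hg).mono strip_subset_edgeStrip) δ) ?_
  filter_upwards [ae_stripMeasure_mem δ] with w hw
  refine (B.le_opNorm₂ _ _).trans ?_
  gcongr
  exact hM w hw

theorem memLp_bilin_of_four {δ : ℝ} (B : F →L[ℝ] G →L[ℝ] H) {f : ℂ → F}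
    {g : ℂ → G} (hf : ContinuousOn f edgeStrip) (hg : ContinuousOn g edgeStrip)
    (h : MemLp f 4 (stripMeasure δ)) (h' : MemLp g 4 (stripMeasure δ)) :
    MemLp (fun w => B (f w) (g w)) 2 (stripMeasure δ) := by
  have : ENNReal.HolderTriple 4 4 2 := ⟨by
    rw [← two_mul, show (4 : ENNReal) = 2 * 2 by norm_num,
      ENNReal.mul_inv (by simp) (by simp), ← mul_assoc, ENNReal.mul_inv_cancel (by simp) (by simp),
      one_mul]⟩
  have hm : MemLp (fun w => ‖f w‖ * ‖g w‖) 2 (stripMeasure δ) := h'.norm.mul h.norm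
  refine hm.of_le_mul (c := ‖B‖) (aestronglyMeasurable_stripMeasure
    (((B.continuous.comp_continuousOn hf).clm_apply hg).mono strip_subset_edgeStrip) δ) ?_
  refine Eventually.of_forall fun w => (B.le_opNorm₂ _ _).trans_eq ?_
  rw [norm_mul, norm_norm, norm_norm, mul_assoc]

theorem memLp_add' {F : Type*} [NormedAddCommGroup F] {μ : Measure ℂ} {q : ENNReal} {f g : ℂ → F} (hf : MemLp f q μ)
    (hg : MemLp g q μ) : MemLp (fun w => f w + g w) q μ := hf.add hg

theorem memLp_sub' {F : Type*} [NormedAddCommGroup F] {μ : Measure ℂ} {q : ENNReal} {f g : ℂ → F} (hf : MemLp f q μ)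
    (hg : MemLp g q μ) : MemLp (fun w => f w - g w) q μ := hf.sub hg

/-- In the product rule, one term is bounded times L² and the other is L⁴ times L⁴. -/
theorem HasStripDeriv.exists_memLp_bilin {δ M : ℝ} (B : F →L[ℝ] G →L[ℝ] H) {f : ℂ → F}
    {f' : ℂ → PlaneHom F} {g : ℂ → G} {g' : ℂ → PlaneHom G} (hf : HasStripDeriv f f')
    (hg : HasStripDeriv g g') (hM : ∀ w ∈ strip, ‖f w‖ ≤ M) (hf' : MemLp f' 4 (stripMeasure δ))
    (hg4 : MemLp g 4 (stripMeasure δ)) (hg' : MemLp g' 2 (stripMeasure δ)) :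
    ∃ k', HasStripDeriv (fun w => B (f w) (g w)) k' ∧ MemLp k' 2 (stripMeasure δ) := by
  have h1 : MemLp (fun w => B.precompR ℂ (f w) (g' w)) 2 (stripMeasure δ) :=
    memLp_bilin_of_bounded (F := F) (G := PlaneHom G) (H := PlaneHom H) (B.precompR ℂ)
      hf.continuousOn hg.continuousOn_deriv hM hg'
  have h2 : MemLp (fun w => B.precompL ℂ (f' w) (g w)) 2 (stripMeasure δ) :=
    memLp_bilin_of_four (F := PlaneHom F) (G := G) (H := PlaneHom H) (B.precompL ℂ)
      hf.continuousOn_deriv hg.continuousOn hf' hg4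
  exact ⟨_, hf.bilin hg B, memLp_add' (F := PlaneHom H) h1 h2⟩

/-- The derivative of a bounded function `f` with `f' = B₁ (f, a₁) - B₂ (f, a₂)` is of class
`L²_{1,δ}` if the coefficients `a₁` and `a₂` are. -/
theorem HasStripDeriv.exists_hasWeightedDeriv [FiniteDimensional ℝ F] {δ M : ℝ} (hδ : 0 ≤ δ)
    (B₁ B₂ : F →L[ℝ] PlaneHom F →L[ℝ] PlaneHom F) {f : ℂ → F} {a₁ a₂ : ℂ → PlaneHom F}
    {a₁' a₂' b₁ b₂ : ℂ → PlaneHom (PlaneHom F)}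
    (hf : HasStripDeriv f fun w => B₁ (f w) (a₁ w) - B₂ (f w) (a₂ w))
    (hM : ∀ w ∈ strip, ‖f w‖ ≤ M) (ha₁ : HasStripDeriv a₁ a₁') (ha₂ : HasStripDeriv a₂ a₂')
    (hw₁ : HasWeightedDeriv δ a₁ b₁) (hw₂ : HasWeightedDeriv δ a₂ b₂) :
    ∃ b', HasStripDeriv (fun w => B₁ (f w) (a₁ w) - B₂ (f w) (a₂ w)) b' ∧
      HasWeightedDeriv δ (fun w => B₁ (f w) (a₁ w) - B₂ (f w) (a₂ w)) b' := by
  have : CompleteSpace (PlaneHom F) := FiniteDimensional.complete ℝ _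
  have m₁ := ha₁.memLp_deriv hw₁
  have m₂ := ha₂.memLp_deriv hw₂
  have f₁ := memLp_four hδ ha₁.hasFDerivAt (ha₁.continuousOn_deriv.mono strip_subset_edgeStrip)
    hw₁.2.1 m₁
  have f₂ := memLp_four hδ ha₂.hasFDerivAt (ha₂.continuousOn_deriv.mono strip_subset_edgeStrip)
    hw₂.2.1 m₂
  have hq : ∀ q : ENNReal, MemLp a₁ q (stripMeasure δ) → MemLp a₂ q (stripMeasure δ) →
      MemLp (fun w => B₁ (f w) (a₁ w) - B₂ (f w) (a₂ w)) q (stripMeasure δ) :=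
    fun q hq₁ hq₂ => memLp_sub' (F := PlaneHom F)
      (memLp_bilin_of_bounded B₁ hf.continuousOn ha₁.continuousOn hM hq₁)
      (memLp_bilin_of_bounded B₂ hf.continuousOn ha₂.continuousOn hM hq₂)
  -- The derivative of `f` is itself bounded times L⁴, hence L⁴; this handles the terms in which it
  -- multiplies a coefficient.
  have f := hq 4 f₁ f₂
  obtain ⟨k₁, hk₁, hk₁m⟩ := hf.exists_memLp_bilin B₁ ha₁ hM f f₁ m₁
  obtain ⟨k₂, hk₂, hk₂m⟩ := hf.exists_memLp_bilin B₂ ha₂ hM f f₂ m₂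
  have hb := hk₁.sub hk₂
  exact ⟨_, hb, hb.hasWeakDeriv, hq 2 hw₁.2.1 hw₂.2.1,
    memLp_sub' (F := PlaneHom (PlaneHom F)) hk₁m hk₂m⟩

end StripJets

section Membership

variable {r : ℕ} {u : ℂ → Mat r} {A₁ A₂ : ℂ → PlaneHom (Mat r)}
  {A₁' A₂' b₁ b₂ : ℂ → PlaneHom (PlaneHom (Mat r))} {δ M : ℝ}

/-- The derivative of a bounded gauge transformation between connections of class `L²_{1,δ}` is of
class `L²_{1,δ}`. -/
theorem exists_hasWeightedDeriv (hδ : 0 ≤ δ)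
    (hu : HasTriDeriv u fun z => lmul (u z) (A₁ z) - rmul (u z) (A₂ z))
    (hM : ∀ z ∈ triStar, ‖u z‖ ≤ M) (h₁ : HasTriDeriv A₁ A₁') (h₂ : HasTriDeriv A₂ A₂')
    (hw₁ : HasWeightedDeriv δ (logForm A₁) b₁) (hw₂ : HasWeightedDeriv δ (logForm A₂) b₂) :
    ∃ b', HasStripDeriv (logForm fun z => lmul (u z) (A₁ z) - rmul (u z) (A₂ z)) b' ∧
      HasWeightedDeriv δ (logForm fun z => lmul (u z) (A₁ z) - rmul (u z) (A₂ z)) b' := by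
  obtain ⟨a₁', ha₁⟩ := h₁.exists_logForm
  obtain ⟨a₂', ha₂⟩ := h₂.exists_logForm
  have e : (logForm fun z => lmul (u z) (A₁ z) - rmul (u z) (A₂ z)) =
      fun w => lmul (logFun u w) (logForm A₁ w) - rmul (logFun u w) (logForm A₂ w) := rfl
  have hU := hu.logFun
  rw [e] at hU ⊢
  exact hU.exists_hasWeightedDeriv (F := Mat r) hδ lmul rmul
    (fun w hw => hM _ (exp_mem_triStar (strip_subset_edgeStrip hw))) ha₁ ha₂ hw₁ hw₂

end Membership

end HiggsComplex

namespace HiggsComplex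

open MeasureTheory Set Filter Topology Metric

/-! ### Green's formula on the strip -/

section WeakBalance

theorem IsCompact.exists_lt_of_forall_lt {K : Set ℂ} (hK : IsCompact K) {f : ℂ → ℝ}
    (hf : Continuous f) {c : ℝ} (h : ∀ w ∈ K, f w < c) : ∃ c' < c, ∀ w ∈ K, f w < c' := by
  rcases K.eq_empty_or_nonempty with rfl | hne
  · exact ⟨c - 1, by linarith, by simp⟩
  · obtain ⟨w₀, hw₀, hmax⟩ := hK.exists_isMaxOn hne hf.continuousOn
    have := h w₀ hw₀
    exact ⟨(f w₀ + c) / 2, by linarith, fun w hw => by have : f w ≤ f w₀ := hmax hw; linarith⟩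

/-- A compact subset of the doubled strip lies in a rectangle. -/
theorem exists_rectangle {K : Set ℂ} (hK : IsCompact K) (hKs : K ⊆ doubleStrip) :
    ∃ x₀ x₁ y₁ : ℝ, x₀ ≤ x₁ ∧ x₁ < Real.log (3 / 4) ∧ 0 < y₁ ∧ y₁ < Real.pi / 3 ∧
      ∀ w ∈ K, x₀ < w.re ∧ w.re < x₁ ∧ |w.im| < y₁ := by
  obtain ⟨x₁, hx₁, h₁⟩ := IsCompact.exists_lt_of_forall_lt hK Complex.continuous_re
    (fun w hw => (hKs hw).1)
  obtain ⟨y₁, hy₁, h₂⟩ := IsCompact.exists_lt_of_forall_lt hK Complex.continuous_im.abs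
    (fun w hw => (hKs hw).2)
  obtain ⟨C, hC⟩ := hK.exists_bound_of_continuousOn (f := fun w => w) continuousOn_id
  have hpi := Real.pi_pos
  refine ⟨min (-C - 1) x₁, x₁, max y₁ (Real.pi / 6), min_le_right _ _, hx₁,
    lt_max_of_lt_right (by linarith), max_lt hy₁ (by linarith), fun w hw =>
    ⟨min_lt_of_left_lt ?_, h₁ w hw, lt_max_of_lt_left (h₂ w hw)⟩⟩
  have := (Complex.abs_re_le_norm w).trans (hC w hw)
  linarith [neg_abs_le w.re]

variable {F : Type*} [NormedAddCommGroup F] [NormedSpace ℝ F]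

/-- Green's formula on the strip. -/
theorem HasStripDeriv.integral_divergence {b : ℂ → PlaneHom F} {b' : ℂ → PlaneHom (PlaneHom F)}
    (hb : HasStripDeriv b b') {φ : ℂ → ℝ} (hφ : ContDiff ℝ ∞ φ) {x₀ x₁ y₁ : ℝ} (hx : x₀ ≤ x₁)
    (hx₁ : x₁ < Real.log (3 / 4)) (hy : 0 < y₁) (hy₁ : y₁ < Real.pi / 3)
    (hK : ∀ w ∈ tsupport φ, x₀ < w.re ∧ w.re < x₁ ∧ |w.im| < y₁) :
    ∫ w in strip, (φ w • (b' w 1 1 + b' w Complex.I Complex.I) +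
        (fderiv ℝ φ w 1 • b w 1 + fderiv ℝ φ w Complex.I • b w Complex.I)) =
      -∫ s in x₀..x₁, φ s • b s Complex.I := by
  set D : ℂ → F := fun w => φ w • (b' w 1 1 + b' w Complex.I Complex.I) +
        (fderiv ℝ φ w 1 • b w 1 + fderiv ℝ φ w Complex.I • b w Complex.I) with hD
  have hφ' : Continuous (fderiv ℝ φ) := hφ.continuous_fderiv (by simp)
  have hev : ∀ v, ContinuousOn (fun w => b w v) edgeStrip := fun v =>
    hb.continuousOn.clm_apply continuousOn_const
  have hev' : ∀ v, ContinuousOn (fun w => b' w v v) edgeStrip := fun v =>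
    (hb.continuousOn_deriv.clm_apply continuousOn_const).clm_apply continuousOn_const
  have hDc : ContinuousOn D edgeStrip :=
    (hφ.continuous.continuousOn.smul ((hev' 1).add (hev' Complex.I))).add
      (((hφ'.clm_apply continuous_const).continuousOn.smul (hev 1)).add
        ((hφ'.clm_apply continuous_const).continuousOn.smul (hev Complex.I)))
  have hz : ∀ w, w ∉ tsupport φ → φ w = 0 := fun w hw => image_eq_zero_of_notMem_tsupport hw
  have hz' : ∀ w, w ∉ tsupport φ → fderiv ℝ φ w = 0 := fun w hw =>
    image_eq_zero_of_notMem_tsupport fun h => hw (tsupport_fderiv_subset ℝ h)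
  set R : Set (ℝ × ℝ) := uIcc x₀ x₁ ×ˢ uIcc 0 y₁ with hR
  have hRs : ∀ q ∈ R, (⟨q.1, q.2⟩ : ℂ) ∈ edgeStrip := by
    rintro ⟨x, y⟩ ⟨h1, h2⟩
    rw [uIcc_of_le hx] at h1
    rw [uIcc_of_le hy.le] at h2
    exact ⟨h1.2.trans_lt hx₁, h2.1, h2.2.trans_lt hy₁⟩
  have hRc : IsCompact R := isCompact_uIcc.prod isCompact_uIcc
  have hmk : ContinuousOn (fun q : ℝ × ℝ => (⟨q.1, q.2⟩ : ℂ)) R := continuous_mk.continuousOn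
  have hDi : IntegrableOn (fun q : ℝ × ℝ => D ⟨q.1, q.2⟩) R :=
    (hDc.comp hmk hRs).integrableOn_compact hRc
  have hk : ∀ v, ∀ w ∈ strip, HasFDerivAt (fun w => φ w • b w v)
      (φ w • (b' w).flip v + (fderiv ℝ φ w).smulRight (b w v)) w := by
    intro v w hw
    have h1 : HasFDerivAt φ (fderiv ℝ φ w) w :=
      (hφ.differentiable (by simp)).differentiableAt.hasFDerivAt
    have h2 : HasFDerivAt (fun w => b w v) ((b' w).flip v) w :=
      ((hb.hasFDerivAt w hw).clm_apply (hasFDerivAt_const v w)).congr_fderiv (by ext; simp)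
    exact h1.smul h2
  have hmkd : ∀ q : ℝ × ℝ, HasFDerivAt (fun q : ℝ × ℝ => (⟨q.1, q.2⟩ : ℂ))
      (Complex.equivRealProdCLM.symm : ℝ × ℝ →L[ℝ] ℂ) q := fun q =>
    Complex.equivRealProdCLM.symm.hasFDerivAt
  have e1 : (Complex.equivRealProdCLM.symm : ℝ × ℝ →L[ℝ] ℂ) (1, 0) = 1 := by
    apply Complex.ext <;> simp
  have e2 : (Complex.equivRealProdCLM.symm : ℝ × ℝ →L[ℝ] ℂ) (0, 1) = Complex.I := by
    apply Complex.ext <;> simp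
  have hint : ∀ q ∈ Ioo (min x₀ x₁) (max x₀ x₁) ×ˢ Ioo (min 0 y₁) (max 0 y₁) \ (∅ : Set (ℝ × ℝ)),
      (⟨q.1, q.2⟩ : ℂ) ∈ strip := by
    rintro ⟨x, y⟩ ⟨⟨h1, h2⟩, -⟩
    rw [min_eq_left hx, max_eq_right hx] at h1
    rw [min_eq_left hy.le, max_eq_right hy.le] at h2
    exact ⟨h1.2.trans hx₁, h2.1, h2.2.trans hy₁⟩
  have hdiv : ∀ w, (φ w • (b' w).flip 1 + (fderiv ℝ φ w).smulRight (b w 1)) 1 +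
      (φ w • (b' w).flip Complex.I + (fderiv ℝ φ w).smulRight (b w Complex.I)) Complex.I = D w := by
    intro w
    simp only [hD, _root_.add_apply, _root_.smul_apply, ContinuousLinearMap.flip_apply,
      ContinuousLinearMap.smulRight_apply, smul_add]
    abel
  have key := integral2_divergence_prod_of_hasFDerivAt_off_countable
    (fun q : ℝ × ℝ => φ ⟨q.1, q.2⟩ • b ⟨q.1, q.2⟩ 1)
    (fun q : ℝ × ℝ => φ ⟨q.1, q.2⟩ • b ⟨q.1, q.2⟩ Complex.I)
    (fun q => (φ ⟨q.1, q.2⟩ • (b' ⟨q.1, q.2⟩).flip 1 +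
      (fderiv ℝ φ ⟨q.1, q.2⟩).smulRight (b ⟨q.1, q.2⟩ 1)).comp
      (Complex.equivRealProdCLM.symm : ℝ × ℝ →L[ℝ] ℂ))
    (fun q => (φ ⟨q.1, q.2⟩ • (b' ⟨q.1, q.2⟩).flip Complex.I +
      (fderiv ℝ φ ⟨q.1, q.2⟩).smulRight (b ⟨q.1, q.2⟩ Complex.I)).comp
      (Complex.equivRealProdCLM.symm : ℝ × ℝ →L[ℝ] ℂ))
    x₀ 0 x₁ y₁ ∅ countable_empty
    ((hφ.continuous.continuousOn.smul (hev 1)).comp hmk hRs)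
    ((hφ.continuous.continuousOn.smul (hev Complex.I)).comp hmk hRs)
    (fun q hq => HasFDerivAt.comp (g := fun w => φ w • b w 1) q (hk 1 _ (hint q hq)) (hmkd q))
    (fun q hq => HasFDerivAt.comp (g := fun w => φ w • b w Complex.I) q (hk Complex.I _ (hint q hq)) (hmkd q))
    (by simpa only [ContinuousLinearMap.comp_apply, e1, e2, hdiv] using hDi)
  simp only [ContinuousLinearMap.comp_apply, e1, e2, hdiv] at key
  -- The test function vanishes on three sides of the rectangle, so only the side θ = 0 contributes.
  have b1 : ∀ x, φ ⟨x, y₁⟩ = 0 := fun x => hz _ fun h => by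
    have := (hK _ h).2.2
    simp [abs_of_pos hy] at this
  have b2 : ∀ y, φ ⟨x₁, y⟩ = 0 := fun y => hz _ fun h => lt_irrefl _ (hK _ h).2.1
  have b3 : ∀ y, φ ⟨x₀, y⟩ = 0 := fun y => hz _ fun h => lt_irrefl _ (hK _ h).1
  simp only [b1, b2, b3, zero_smul, intervalIntegral.integral_zero, zero_sub, add_zero,
    sub_zero] at key
  rw [show (∫ s in x₀..x₁, φ s • b s Complex.I) =
    ∫ x in x₀..x₁, φ ⟨x, 0⟩ • b ⟨x, 0⟩ Complex.I from rfl, ← key]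
  set S : Set ℂ := {w | w.re ∈ Ioc x₀ x₁ ∧ w.im ∈ Ioc 0 y₁} with hS
  have hSs : S ⊆ strip := fun w hw => ⟨hw.1.2.trans_lt hx₁, hw.2.1, hw.2.2.trans_lt hy₁⟩
  have hSm : MeasurableSet S :=
    (Complex.measurable_re measurableSet_Ioc).inter (Complex.measurable_im measurableSet_Ioc)
  rw [setIntegral_eq_of_subset_of_forall_sdiff_eq_zero isOpen_strip.measurableSet hSs
    fun w hw => ?_]
  · rw [← integral_indicator hSm, integral_complex_eq]
    have ei : (fun q : ℝ × ℝ => S.indicator D ⟨q.1, q.2⟩) =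
        (Ioc x₀ x₁ ×ˢ Ioc 0 y₁).indicator fun q : ℝ × ℝ => D ⟨q.1, q.2⟩ := by
      funext q
      by_cases hq : q ∈ Ioc x₀ x₁ ×ˢ Ioc 0 y₁
      · rw [indicator_of_mem hq, indicator_of_mem (show (⟨q.1, q.2⟩ : ℂ) ∈ S from hq)]
      · rw [indicator_of_notMem hq, indicator_of_notMem (show (⟨q.1, q.2⟩ : ℂ) ∉ S from hq)]
    rw [ei, integral_indicator (measurableSet_Ioc.prod measurableSet_Ioc), Measure.volume_eq_prod,
      setIntegral_prod]
    · simp only [intervalIntegral.integral_of_le hx, intervalIntegral.integral_of_le hy.le]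
    · refine hDi.mono_set (prod_mono ?_ ?_)
      · rw [uIcc_of_le hx]; exact Ioc_subset_Icc_self
      · rw [uIcc_of_le hy.le]; exact Ioc_subset_Icc_self
  · have : w ∉ tsupport φ := fun h => hw.2
      ⟨⟨(hK w h).1, (hK w h).2.1.le⟩, hw.1.2.1, ((le_abs_self _).trans_lt (hK w h).2.2).le⟩
    simp only [hz w this, hz' w this, zero_smul, _root_.zero_apply, add_zero]

end WeakBalance

end HiggsComplex

namespace HiggsComplex

open MeasureTheory Set Filter Topology Metric

/-! ### The polar factor as an element of the unitary gauge group -/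

section UnitaryGauge

variable {V W : Type*} {X : AbstractSimplicialComplex V} {Y : AbstractSimplicialComplex W}
  {p : W → V} {r : ℕ} {E : HermitianBundle Y p r} {δ : ℝ} {u g : (W → ℝ) → Mat r}
  {A₁ ψ₁ A₂ ψ₂ : FormFamily W r}

/-- Unitary matrices are bounded. -/
theorem norm_sq_le_of_unitary {h u : Mat r} (hh : h.PosDef) (hu : uᴴ * h * u = h) :
    ‖u‖ ^ 2 ≤ r ^ 3 * (‖h⁻¹‖ * ‖h‖) := by
  obtain ⟨B, hB, rfl⟩ := PosDef.exists_conjTranspose_mul_self hh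
  -- Since u^*u = 1, its squared norm for the metric is r. The comparison with the Frobenius norm
  -- costs ‖B‖² ≤ r‖h‖ and ‖B⁻¹‖² ≤ r‖h⁻¹‖, which makes the factor r³.
  have h1 : hInner (Bᴴ * B) u u = r := by
    have : hAdj (Bᴴ * B) u * u = 1 := by
      rw [hAdj, Matrix.mul_assoc, Matrix.mul_assoc, ← Matrix.mul_assoc uᴴ, hu,
        Matrix.nonsing_inv_mul _ (posDef_isUnit_det hh)]
    rw [hInner, this, Matrix.trace_one]
    simp
  rw [hInner_self_eq hB] at h1
  have h2 : ‖B‖ ^ 2 ≤ r * ‖Bᴴ * B‖ := by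
    rw [← trace_conjTranspose_mul_self_re]; exact re_trace_le _
  have h3 : ‖B⁻¹‖ ^ 2 ≤ r * ‖(Bᴴ * B)⁻¹‖ := by
    rw [← Matrix.frobenius_norm_conjTranspose, ← trace_conjTranspose_mul_self_re,
      Matrix.conjTranspose_conjTranspose, Matrix.mul_inv_rev, Matrix.conjTranspose_nonsing_inv]
    exact re_trace_le _
  have h4 : u = B⁻¹ * (B * u * B⁻¹) * B := by
    simp only [Matrix.mul_assoc, Matrix.nonsing_inv_mul _ hB, Matrix.mul_one]
    rw [Matrix.nonsing_inv_mul_cancel_left _ _ hB]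
  have h5 : ‖u‖ ≤ ‖B⁻¹‖ * ‖B * u * B⁻¹‖ * ‖B‖ := by
    conv_lhs => rw [h4]
    exact (norm_mul_le _ _).trans (mul_le_mul_of_nonneg_right (norm_mul_le _ _) (norm_nonneg _))
  calc ‖u‖ ^ 2 ≤ (‖B⁻¹‖ * ‖B * u * B⁻¹‖ * ‖B‖) ^ 2 := pow_le_pow_left₀ (norm_nonneg _) h5 2
    _ = ‖B⁻¹‖ ^ 2 * ‖B * u * B⁻¹‖ ^ 2 * ‖B‖ ^ 2 := by ring
    _ ≤ (r * ‖(Bᴴ * B)⁻¹‖) * r * (r * ‖Bᴴ * B‖) := by rw [h1]; gcongr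
    _ = _ := by ring

theorem exists_norm_le_of_unitary {h u : ℂ → Mat r} (hc : ContinuousOn h tri)
    (hpos : ∀ z ∈ tri, (h z).PosDef) (hu : ∀ z ∈ triStar, (u z)ᴴ * h z * u z = h z) :
    ∃ M, ∀ z ∈ triStar, ‖u z‖ ≤ M := by
  obtain ⟨C, -, hC⟩ := exists_norm_inv_mul_norm_le hc hpos
  refine ⟨√(r ^ 3 * C), fun z hz => Real.le_sqrt_of_sq_le ?_⟩
  have hz' := triStar_subset_tri hz
  exact (norm_sq_le_of_unitary (hpos z hz') (hu z hz)).trans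
    (mul_le_mul_of_nonneg_left (hC z hz') (by positivity))

/-- The derivative of a gauge transformation between balanced connections is balanced. -/
theorem isWeaklyBalanced_of_hasStripDeriv [Finite V] (hp : IsUniversalCover Y X p)
    (h₁ : IsBalancedForm Y A₁) (h₂ : IsBalancedForm Y A₂)
    {b' : (Fin 3 → W) → ℂ → PlaneHom (PlaneHom (Mat r))}
    (hb : ∀ σ, IsTri Y σ → HasStripDeriv (logForm fun z =>
      lmul (u (chart σ z)) (A₁ σ z) - rmul (u (chart σ z)) (A₂ σ z)) (b' σ)) :
    IsWeaklyBalanced Y (fun σ => logForm fun z =>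
      lmul (u (chart σ z)) (A₁ σ z) - rmul (u (chart σ z)) (A₂ σ z)) b' := by
  intro a a' φ hφ hφc hφs
  obtain ⟨x₀, x₁, y₁, hx, hx₁, hy, hy₁, hK⟩ := exists_rectangle hφc hφs
  have hf := hp.finite_star a a'
  have e : ∀ c ∈ {c | IsTri Y ![a, a', c]}, _ := fun c hc =>
    (hb ![a, a', c] hc).integral_divergence hφ hx hx₁ hy hy₁ hK
  rw [finsum_mem_congr rfl e, finsum_mem_eq_finite_toFinset_sum _ hf, Finset.sum_neg_distrib,
    neg_eq_zero, ← intervalIntegral.integral_finsetSum]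
  · rw [← intervalIntegral.integral_zero (a := x₀) (b := x₁)]
    refine intervalIntegral.integral_congr fun s hs => ?_
    rw [uIcc_of_le hx] at hs
    have hs1 : Real.exp s < 1 := by
      rw [Real.exp_lt_one_iff]
      exact (hs.2.trans_lt hx₁).trans_le (Real.log_nonpos (by norm_num) (by norm_num))
    have b₁ := h₁ a a' (Real.exp s) (Real.exp_pos s) hs1
    have b₂ := h₂ a a' (Real.exp s) (Real.exp_pos s) hs1
    rw [finsum_mem_eq_finite_toFinset_sum _ hf] at b₁ b₂
    rw [← Finset.smul_sum]
    -- At the edge point e^s the vector ∂_θ is e^s times the inward normal i, and `u` has one common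
    -- value for all 2-cells at the edge.
    have ev : ∀ c, logForm (fun z => lmul (u (chart ![a, a', c] z)) (A₁ ![a, a', c] z) -
        rmul (u (chart ![a, a', c] z)) (A₂ ![a, a', c] z)) s Complex.I =
        Real.exp s • (u (chart ![a, a', a'] (Real.exp s : ℝ)) *
          A₁ ![a, a', c] (Real.exp s : ℝ) Complex.I -
          A₂ ![a, a', c] (Real.exp s : ℝ) Complex.I *
            u (chart ![a, a', a'] (Real.exp s : ℝ))) := by
      intro c
      rw [logForm_apply, ← Complex.ofReal_exp, ← Complex.real_smul, map_smul, chart_real]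
      rfl
    simp only [ev]
    rw [← Finset.smul_sum, Finset.sum_sub_distrib, ← Finset.mul_sum, ← Finset.sum_mul, b₁, b₂]
    simp
  · intro c hc
    rw [Finite.mem_toFinset] at hc
    refine ContinuousOn.intervalIntegrable ?_
    have hco : ContinuousOn (fun s : ℝ => (s : ℂ)) (uIcc x₀ x₁) :=
      Complex.continuous_ofReal.continuousOn
    refine (hφ.continuous.comp_continuousOn hco).smul
      (((hb _ hc).continuousOn.comp hco fun s hs => ?_).clm_apply continuousOn_const)
    rw [uIcc_of_le hx] at hs
    exact ⟨by simpa using hs.2.trans_lt hx₁, by simp, by simpa using Real.pi_pos⟩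

/-- A gauge transformation between connections of class `L²_{1,δ}` that preserves the metric belongs
to the unitary gauge group. -/
theorem isUnitaryGauge_of_hasTriDeriv [Finite V] (hp : IsUniversalCover Y X p) (hδ : 0 ≤ δ)
    (h₁ : IsHitchinPair E δ A₁ ψ₁) (h₂ : IsHitchinPair E δ A₂ ψ₂)
    (hd : ∀ σ, IsTri Y σ → HasTriDeriv (fun z => u (chart σ z)) fun z =>
      lmul (u (chart σ z)) (A₁ σ z) - rmul (u (chart σ z)) (A₂ σ z))
    (heq : ∀ σ τ, IsTri Y σ → IsTri Y τ → p ∘ σ = p ∘ τ → ∀ z ∈ triStar,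
      u (chart σ z) * E.trans (chart σ z) (chart τ z) =
        E.trans (chart σ z) (chart τ z) * u (chart τ z))
    (hdet : ∀ σ, IsTri Y σ → ∀ z ∈ triStar, (u (chart σ z)).det = 1)
    (hu : ∀ σ, IsTri Y σ → ∀ z ∈ triStar,
      (u (chart σ z))ᴴ * E.metric (chart σ z) * u (chart σ z) = E.metric (chart σ z)) :
    IsUnitaryGauge E δ u where
  continuous σ hσ := (hd σ hσ).continuousOn
  equivariant := heq
  det_eq_one := hdet
  unitary := hu
  weighted_balanced := by
    have key : ∀ σ, IsTri Y σ → ∃ b', HasStripDeriv (logForm fun z =>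
        lmul (u (chart σ z)) (A₁ σ z) - rmul (u (chart σ z)) (A₂ σ z)) b' ∧
        HasWeightedDeriv δ (logForm fun z =>
          lmul (u (chart σ z)) (A₁ σ z) - rmul (u (chart σ z)) (A₂ σ z)) b' := by
      intro σ hσ
      obtain ⟨M, hM⟩ := exists_norm_le_of_unitary (E.continuousOn_metric hσ) (E.metric_posDef σ hσ)
        (hu σ hσ)
      obtain ⟨A₁', hA₁⟩ := h₁.smooth_A.exists_hasTriDeriv hσ
      obtain ⟨A₂', hA₂⟩ := h₂.smooth_A.exists_hasTriDeriv hσ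
      obtain ⟨b₁, hb₁⟩ := h₁.weighted_A σ hσ
      obtain ⟨b₂, hb₂⟩ := h₂.weighted_A σ hσ
      exact exists_hasWeightedDeriv hδ (hd σ hσ) hM hA₁ hA₂ hb₁ hb₂
    choose! b' hb' hw using key
    exact ⟨_, b', fun σ hσ => ⟨(hd σ hσ).hasWeakDeriv, hw σ hσ⟩,
      isWeaklyBalanced_of_hasStripDeriv hp h₁.balanced_A h₂.balanced_A hb'⟩

theorem connectionsRelated_of_hasTriDeriv
    (hd : ∀ σ, IsTri Y σ → HasTriDeriv (fun z => u (chart σ z)) fun z =>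
      lmul (u (chart σ z)) (A₁ σ z) - rmul (u (chart σ z)) (A₂ σ z))
    (hdet : ∀ σ, IsTri Y σ → ∀ z ∈ triStar, (u (chart σ z)).det = 1) :
    ConnectionsRelated Y u A₁ A₂ := by
  intro σ hσ
  refine ⟨_, (hd σ hσ).hasWeakDeriv, ?_⟩
  filter_upwards [ae_restrict_mem isOpen_strip.measurableSet] with w hw v
  have hdu : IsUnit (u (chart σ (Complex.exp w))).det := by
    rw [hdet σ hσ _ (exp_mem_triStar (strip_subset_edgeStrip hw))]
    exact isUnit_one
  change logForm (A₁ σ) w v = (u (chart σ (Complex.exp w)))⁻¹ *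
    (u (chart σ (Complex.exp w)) * logForm (A₁ σ) w v -
      logForm (A₂ σ) w v * u (chart σ (Complex.exp w))) +
    (u (chart σ (Complex.exp w)))⁻¹ * logForm (A₂ σ) w v * u (chart σ (Complex.exp w))
  rw [Matrix.mul_sub, Matrix.nonsing_inv_mul_cancel_left _ _ hdu, Matrix.mul_assoc, sub_add_cancel]

/-- Once the Higgs fields are intertwined they cancel from dg, so `g` already relates the unitary
connections A₁ and A₂. Its unitary factor then relates both the connections and the Higgs fields. -/
theorem unitaryGaugeEquivalent_of_intertwines [Finite V] (hp : IsUniversalCover Y X p)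
    (hδ : 0 ≤ δ) (h₁ : IsHitchinPair E δ A₁ ψ₁) (h₂ : IsHitchinPair E δ A₂ ψ₂)
    (hg : IsComplexGauge E δ g) (h : ConnectionsRelated Y g (A₁ + ψ₁) (A₂ + ψ₂))
    (hψ : ∀ σ, IsTri Y σ → ∀ z ∈ triStar, ∀ v,
      g (chart σ z) * ψ₁ σ z v = ψ₂ σ z v * g (chart σ z)) :
    UnitaryGaugeEquivalent E δ A₁ ψ₁ A₂ ψ₂ := by
  have hpos : ∀ σ, IsTri Y σ → ∀ z ∈ triStar, (E.metric (chart σ z)).PosDef := fun σ hσ z hz =>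
    E.metric_posDef σ hσ z (triStar_subset_tri hz)
  have hgu : ∀ σ, IsTri Y σ → ∀ z ∈ triStar, IsUnit (g (chart σ z)).det := fun σ hσ z hz => by
    rw [hg.det_eq_one σ hσ z hz]; exact isUnit_one
  set u : (W → ℝ) → Mat r := fun x => unitaryPart (E.metric x) (g x) with hu
  have hd : ∀ σ, IsTri Y σ → HasTriDeriv (fun z => u (chart σ z)) fun z =>
      lmul (u (chart σ z)) (A₁ σ z) - rmul (u (chart σ z)) (A₂ σ z) := by
    intro σ hσ
    have D := h₁.chartData h₂ hg h hσ
    refine hasTriDeriv_unitaryPart (E.metric_posDef σ hσ) D.unitary₁ D.unitary₂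
      (D.deriv.congr_deriv ((lmul_continuousOn D.deriv.continuousOn D.unitary₁.continuousOn).sub
        (rmul_continuousOn D.deriv.continuousOn D.unitary₂.continuousOn)) fun z hz v => ?_)
    simp only [_root_.sub_apply, lmul_apply, rmul_apply, _root_.add_apply, Matrix.mul_add,
      Matrix.add_mul, hψ σ hσ z (triInt_subset_triStar hz) v]
    abel
  have hdet : ∀ σ, IsTri Y σ → ∀ z ∈ triStar, (u (chart σ z)).det = 1 := fun σ hσ z hz =>
    det_unitaryPart (hpos σ hσ z hz) (hg.det_eq_one σ hσ z hz)
  refine ⟨u, isUnitaryGauge_of_hasTriDeriv hp hδ h₁ h₂ hd ?_ hdet ?_,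
    connectionsRelated_of_hasTriDeriv hd hdet, ?_⟩
  · intro σ τ hσ hτ hpστ z hz
    simp only [hu]
    rw [E.metric_trans σ τ hσ hτ hpστ z (triStar_subset_tri hz)]
    exact unitaryPart_conj (E.isUnit_det_trans hσ hτ hpστ (triStar_subset_tri hz))
      (hg.equivariant σ τ hσ hτ hpστ z hz)
  · intro σ hσ z hz
    exact unitary_unitaryPart (hpos σ hσ z hz) (hgu σ hσ z hz)
  · intro σ hσ z hz v
    have hdu : IsUnit (u (chart σ z)).det := by rw [hdet σ hσ z hz]; exact isUnit_one
    rw [Matrix.mul_assoc, ← unitaryPart_intertwines (hpos σ hσ z hz)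
      (h₁.selfAdjoint_ψ σ hσ z hz v) (h₂.selfAdjoint_ψ σ hσ z hz v) (hψ σ hσ z hz v),
      Matrix.nonsing_inv_mul_cancel_left _ _ hdu]

end UnitaryGauge

end HiggsComplex

end

open HiggsComplex in
theorem mainTheorem4 {V W : Type*} [Finite V] (X : AbstractSimplicialComplex V)
    (hX : IsAdmissible X) (hX' : WithoutBoundary X)
    (Y : AbstractSimplicialComplex W) (p : W → V) (hp : IsUniversalCover Y X p)
    (r : ℕ) (E : HermitianBundle Y p r) (δ : ℝ) (hδ : 0 ≤ δ)
    (A₁ ψ₁ A₂ ψ₂ : FormFamily W r)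
    (h₁ : IsHitchinPair E δ A₁ ψ₁) (h₂ : IsHitchinPair E δ A₂ ψ₂)
    (h : ComplexGaugeEquivalent E δ A₁ ψ₁ A₂ ψ₂) :
    UnitaryGaugeEquivalent E δ A₁ ψ₁ A₂ ψ₂ := by
  obtain ⟨g, hg, hrel⟩ := h
  refine unitaryGaugeEquivalent_of_intertwines hp hδ h₁ h₂ hg hrel fun σ hσ z hz v => ?_
  -- In rank zero |g|² vanishes and log |g|² is meaningless, but there is only one empty matrix.
  rcases Nat.eq_zero_or_pos r with rfl | hr
  · exact Subsingleton.elim _ _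
  · have : NeZero r := ⟨hr.ne'⟩
    exact intertwines_higgs hp hδ h₁ h₂ hg hrel hσ hz v
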